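/- **Model.** For $L>0$ and $n\ge1$ place nodes $1,\dots,n$ independently and uniformly on the segment $[0,L]$; the id of a node is its index, the density is $\lambda=n/L$, and two distinct nodes are neighbours iff their distance is smaller than $1$. Let $G$ be this graph and $\mathcal N(v)$ the set of neighbours of $v$. For a set $A$ of nodes, $\deg(A)=\sum_{v\in A}\deg(v)$. * *MPR selection.* Each node $v$ selects an MPR set $M(v)\subseteq\mathcal N(v)$: every node at distance two from $v$ has a neighbour in $M(v)$, and no element of $M(v)$ can be removed. The selection is made by an arbitrary fixed rule that depends on the graph (with its ids) only. * *MPR flooding CDS.* A packet starts from a uniformly random source and propagates in synchronous rounds. The source transmits; another node transmits, once, iff it has been selected as MPR by a node from which it received its first copy (in the round of first reception). The set consists of all transmitting nodes, the source included. * *MPR CDS.* Node $v$ belongs to it iff its id is smaller than the ids of all its neighbours, or its neighbour $y$ of smallest id satisfies $y<v$ and $v\in M(y)$. * *1999 Wu–Li CDS.* Node $v$ belongs to it iff its id is smaller than the ids of all its neighbours, or the set $\{u\in\mathcal N(v):u<v\}$ is not a connected dominating set of $\mathcal N(v)$. **Theorem 2.** Up to border effects, the average total degree on a segment of length $\ell>1$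 is asymptotically $2\ell\lambda$ for the MPR flooding CDS, $3\ell\lambda$ for the MPR CDS and $4\ell\lambda$ for the 1999 Wu–Li CDS, as $\lambda\to\infty$. Precisely, write $(\kappa_A)=(2,3,4)$ for these three sets $A$ respectively. 1. (Network on $[0,\ell]$.) There is an absolute constant $C$ such that for all $\ell>1$, all MPR selection rules and all sufficiently large $n$, with $\lambda=n/\ell$, $$\bigl|\,\mathbb E[\deg(A)]-\kappa_A\,\ell\lambda\,\bigr|\le C\lambda .$$ 2. (Segment of length $\ell$ away from the borders.) For all $\ell>1$, all MPR selection rules and all $\varepsilon>0$, for all sufficiently large $m$, the network on $[0,\ell+2m]$ satisfies, for all sufficiently large $n$ and with $\lambda=n/(\ell+2m)$, $$\bigl|\,\mathbb E[\deg(A\cap[m,m+\ell])]-\kappa_A\,\ell\lambda\,\bigr|\le\varepsilon\lambda ,$$ where $A\cap[m,m+\ell]$ is the set of nodes of $A$ with position in $[m,m+\ell]$ and the degrees are those in the whole network. -/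

import Mathlib

open Filter Set MeasureTheory ProbabilityTheory

/-- The 1D unit disk graph of nodes `1, …, n` at positions `x`: two distinct nodes are neighbours
iff their distance is smaller than `1`. The id of a node is its index. -/
def unitDiskGraph {n : ℕ} (x : Fin n → ℝ) : SimpleGraph (Fin n) where
  Adj u v := u ≠ v ∧ |x u - x v| < 1
  symm := ⟨fun u v h => ⟨h.1.symm, by rw [abs_sub_comm]; exact h.2⟩⟩
  loopless := ⟨fun _ h => h.1 rfl⟩

/-- `S` is a connected dominating set of the set of nodes `T`. -/
def IsCDSOf {V : Type*} (G : SimpleGraph V) (S T : Set V) : Prop :=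
  S ⊆ T ∧ (∀ w ∈ T, w ∈ S ∨ ∃ u ∈ S, G.Adj u w) ∧ (G.induce S).Connected

/-- The 1999 Wu–Li set: `v` belongs to it iff its id is smaller than those of all its neighbours,
or its neighbours of smaller id do not form a connected dominating set of its neighbourhood. -/
def wuLiSet {n : ℕ} (G : SimpleGraph (Fin n)) : Set (Fin n) :=
  {v | (∀ u, G.Adj v u → v < u) ∨
    ¬ IsCDSOf G {u | G.Adj v u ∧ u < v} (G.neighborSet v)}

/-- `M` is a set of neighbours of `v` that covers every node at distance exactly two of `v`. -/
def CoversTwoHop {V : Type*} (G : SimpleGraph V) (v : V) (M : Set V) : Prop :=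
  M ⊆ G.neighborSet v ∧
    ∀ w, w ≠ v → ¬ G.Adj v w → (∃ u, G.Adj v u ∧ G.Adj u w) → ∃ u ∈ M, G.Adj u w

/-- A multipoint relay (MPR) set of `v`: a covering set without redundant element. -/
def IsMPRSet {V : Type*} (G : SimpleGraph V) (v : V) (M : Set V) : Prop :=
  Minimal (CoversTwoHop G v) M

/-- A rule by which, in a graph with nodes `1, …, n`, each node selects a set of nodes. -/
abbrev SelectionRule : Type :=
  ∀ n : ℕ, SimpleGraph (Fin n) → Fin n → Set (Fin n)

/-- The rule selects an MPR set for every node of every 1D unit disk graph. -/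
def IsMPRRule (M : SelectionRule) : Prop :=
  ∀ (n : ℕ) (x : Fin n → ℝ) (v : Fin n),
    IsMPRSet (unitDiskGraph x) v (M n (unitDiskGraph x) v)

/-- The MPR CDS: `v` belongs to it iff its id is smaller than those of all its neighbours, or its
neighbour `y` of smallest id has a smaller id than `v`, and has selected `v` as an MPR. -/
def mprCDS {n : ℕ} (G : SimpleGraph (Fin n)) (M : Fin n → Set (Fin n)) : Set (Fin n) :=
  {v | (∀ u, G.Adj v u → v < u) ∨
    ∃ y, G.Adj v y ∧ (∀ u, G.Adj v u → y ≤ u) ∧ y < v ∧ v ∈ M y}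

/-- MPR flooding from the source `s`, round by round. First component: the nodes that hold the
packet after `t` rounds of transmissions. Second component: the nodes that transmit in round
`t + 1`, namely those that received their first copy in round `t`, from a node that has selected
them as MPR (and the source in the first round). -/
def mprFloodRound {V : Type*} (G : SimpleGraph V) (M : V → Set V) (s : V) : ℕ → Set V × Set V
  | 0 => ({s}, {s})
  | t + 1 =>
    ((mprFloodRound G M s t).1 ∪ {w | ∃ u ∈ (mprFloodRound G M s t).2, G.Adj u w},
     {w | w ∉ (mprFloodRound G M s t).1 ∧
        ∃ u ∈ (mprFloodRound G M s t).2, G.Adj u w ∧ w ∈ M u})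

/-- The MPR flooding CDS: all nodes that transmit the packet, the source included. -/
def mprFloodSet {V : Type*} (G : SimpleGraph V) (M : V → Set V) (s : V) : Set V :=
  ⋃ t, (mprFloodRound G M s t).2

open Classical in
/-- `deg(A)`: the sum of the degrees in `G` of the nodes of `A`. -/
noncomputable def totalDegree {n : ℕ} (G : SimpleGraph (Fin n)) (A : Set (Fin n)) : ℝ :=
  ∑ v : Fin n, if v ∈ A then ((G.neighborSet v).ncard : ℝ) else 0

/-- The law of `n` independent uniform positions on the segment `[0, L]`. -/
noncomputable def positionLaw (L : ℝ) (n : ℕ) : Measure (Fin n → ℝ) :=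
  Measure.pi fun _ => cond volume (Icc 0 L)

/-- The network occupies `[0, L]` and has `n` nodes. Average of the sum of the degrees of those
nodes of `A` (a set determined by the graph) whose position lies in `[a, b]`. -/
noncomputable def avgDegree (L : ℝ) (n : ℕ) (a b : ℝ)
    (A : SimpleGraph (Fin n) → Set (Fin n)) : ℝ :=
  ∫ x, totalDegree (unitDiskGraph x) (A (unitDiskGraph x) ∩ {v | x v ∈ Icc a b})
    ∂(positionLaw L n)

/-- Average degree for the 1999 Wu–Li CDS. -/
noncomputable def avgDegreeWuLi (L : ℝ) (n : ℕ) (a b : ℝ) : ℝ :=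
  avgDegree L n a b wuLiSet

/-- Average degree for the MPR CDS. -/
noncomputable def avgDegreeMPR (M : SelectionRule) (L : ℝ) (n : ℕ) (a b : ℝ) : ℝ :=
  avgDegree L n a b fun G => mprCDS G (M n G)

/-- Average degree for the MPR flooding CDS, the source being a uniformly random node. -/
noncomputable def avgDegreeFlood (M : SelectionRule) (L : ℝ) (n : ℕ) (a b : ℝ) : ℝ :=
  (∑ s : Fin n, avgDegree L n a b fun G => mprFloodSet G (M n G) s) / n

/-! ### Independent uniform positions -/

/-! Outside an event of exponentially small probability, every interval holds its share of the nodes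
up to a small fraction of `n`, so every node at distance at least one from the ends has degree close
to `2λ`, and no degree is much larger. The average total degree is therefore about `2λ` times the
average number of selected nodes, and the theorem reduces to showing that the three sets have `1`,
`3/2` and `2` nodes per unit length (`avgDegree_bounds`).

Two counts rest on one computation. Given the position of node `i`, the `i` nodes of smaller id are
independent and uniform, so a window of length `c` attached to `i` avoids them all with probability
`(1 - c/L)^i`. Summing the geometric series, the average number of nodes of `B` with an empty window
tends to `|B|/c`. When one node `j` of smaller id is prescribed to lie in an interval of length `1`
and the others must avoid a window of length `1`, the series `∑ i r^(i-1)` gives `|B|`.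

MPR CDS: a node has at most one relay on each side, because the farther of two would make the nearer
redundant, and in a dense sample this relay lies almost at distance one. Local minima of the id are
nodes with an empty window of length `2`: density `1/2`. A relay `v` on the right of its smallest-id
neighbour `y` corresponds to a node `y` whose window, about `(x y, x y + 2)`, is empty: density
`1/2`. Relays on the left give `1/2` by reflection.

Wu–Li CDS: up to rare events, a node `i` is selected iff no smaller id lies in the unit window on
its left (density `1`), or the closest such node `j` leaves no other smaller id in `(x j, x j + 1)`,
so that nothing bridges the two sides of `i` (density `1`).

Flooding: the packet runs away from the source `s` along relays, and the transmitters sit close to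
`x s + k` for integers `k`. Averaging over the uniform position of `s` gives density `1`, up to a
relative error `1/L`.

Near the ends, cruder windows bound the number of selected nodes in a strip of length `3` by a
constant, which costs `O(λ)`. -/

instance isProbabilityMeasure_cond_Icc {L : ℝ} [hL : Fact (0 < L)] :
    IsProbabilityMeasure (cond volume (Icc 0 L)) :=
  cond_isProbabilityMeasure_of_finite (by simp [hL.out]) (by simp)

instance isProbabilityMeasure_positionLaw {L : ℝ} [Fact (0 < L)] (n : ℕ) :
    IsProbabilityMeasure (positionLaw L n) := by
  unfold positionLaw; infer_instance

theorem measureReal_cond_Icc {L : ℝ} (hL : 0 < L) (S : Set ℝ) :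
    (cond volume (Icc 0 L)).real S = volume.real (Icc 0 L ∩ S) / L := by
  rw [measureReal_def, cond_apply measurableSet_Icc, ENNReal.toReal_mul, ENNReal.toReal_inv,
    Real.volume_Icc, ENNReal.toReal_ofReal (by linarith), measureReal_def, sub_zero]
  ring

theorem measureReal_cond_Icc_le {L : ℝ} (hL : 0 < L) {c d : ℝ} (h : c ≤ d) {S : Set ℝ}
    (hS : S ⊆ Icc c d) : (cond volume (Icc 0 L)).real S ≤ (d - c) / L := by
  rw [measureReal_cond_Icc hL]
  gcongr
  calc volume.real (Icc 0 L ∩ S) ≤ volume.real (Icc c d) :=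
        measureReal_mono (fun x hx => hS hx.2) (by simp)
    _ = d - c := by simp [h]

theorem le_measureReal_cond_Icc {L : ℝ} (hL : 0 < L) {c d : ℝ} (h : c ≤ d) {S : Set ℝ}
    (hc : 0 ≤ c) (hd : d ≤ L) (hS : Ioo c d ⊆ S) :
    (d - c) / L ≤ (cond volume (Icc 0 L)).real S := by
  rw [measureReal_cond_Icc hL]
  gcongr
  calc d - c = volume.real (Ioo c d) := by simp [h]
    _ ≤ volume.real (Icc 0 L ∩ S) := by
      refine measureReal_mono (fun x hx => ⟨⟨?_, ?_⟩, hS hx⟩)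
        (measure_ne_top_of_subset inter_subset_left (by simp))
      · linarith [hx.1]
      · linarith [hx.2]

theorem iIndepFun_eval {ι : Type*} [Fintype ι] (μ : Measure ℝ) [IsProbabilityMeasure μ] :
    iIndepFun (fun (i : ι) (x : ι → ℝ) => x i) (Measure.pi fun _ : ι => μ) :=
  iIndepFun_pi (X := fun _ : ι => (id : ℝ → ℝ)) (μ := fun _ => μ) (fun _ => aemeasurable_id)

/-! ### Conditioning on some coordinates of a product measure -/

section Independence

variable {ι β : Type*} [Fintype ι] [MeasurableSpace β] {μ : Measure ℝ} [IsProbabilityMeasure μ]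

theorem map_eval_measure_pi (i : ι) : (Measure.pi fun _ : ι => μ).map (fun x => x i) = μ :=
  (measurePreserving_eval (fun _ : ι => μ) i).map_eq

theorem map_restrict_pi (T : Finset ι) :
    (Measure.pi fun _ : ι => μ).map (fun x (k : T) => x k) = Measure.pi fun _ : T => μ := by
  have h := (iIndepFun_iff_map_fun_eq_pi_map (fun k : T => (measurable_pi_apply (k : ι)).aemeasurable)).1
    ((iIndepFun_eval (ι := ι) μ).precomp (g := fun k : T => (k : ι)) Subtype.val_injective)
  rw [h]
  congr
  ext1 k
  exact map_eval_measure_pi (k : ι)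

/-- Given a vector `Z` of coordinates, coordinates independent of it satisfy their constraints
independently of each other. -/
theorem pi_forall_eq_lintegral (T : Finset ι) {Z : (ι → ℝ) → β} (hZ : Measurable Z)
    (hind : IndepFun Z (fun x (k : T) => x k) (Measure.pi fun _ : ι => μ))
    {D : Set β} (hD : MeasurableSet D) {R : Set (β × ℝ)} (hR : MeasurableSet R) :
    (Measure.pi fun _ : ι => μ) {x | Z x ∈ D ∧ ∀ k ∈ T, (Z x, x k) ∈ R} =
      ∫⁻ z in D, μ {y | (z, y) ∈ R} ^ T.card ∂((Measure.pi fun _ : ι => μ).map Z) := by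
  have hT : Measurable (fun (x : ι → ℝ) (k : T) => x k) := by fun_prop
  set E : Set (β × (T → ℝ)) := {w | w.1 ∈ D ∧ ∀ k : T, (w.1, w.2 k) ∈ R} with hE
  have hEm : MeasurableSet E := by
    have : E = (Prod.fst ⁻¹' D) ∩ ⋂ k : T, (fun w : β × (T → ℝ) => (w.1, w.2 k)) ⁻¹' R := by
      ext w; simp [hE]
    rw [this]
    exact (measurable_fst hD).inter (MeasurableSet.iInter fun k =>
      (show Measurable fun w : β × (T → ℝ) => (w.1, w.2 k) by fun_prop) hR)
  have h1 : {x : ι → ℝ | Z x ∈ D ∧ ∀ k ∈ T, (Z x, x k) ∈ R} =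
      (fun x => (Z x, fun k : T => x k)) ⁻¹' E := by
    ext x; simp [hE]
  rw [h1, ← Measure.map_apply (hZ.prodMk hT) hEm,
    (indepFun_iff_map_prod_eq_prod_map_map hZ.aemeasurable hT.aemeasurable).1 hind,
    Measure.prod_apply hEm, map_restrict_pi, ← lintegral_indicator hD]
  congr 1
  ext z
  by_cases hz : z ∈ D
  · have : Prod.mk z ⁻¹' E = Set.pi univ fun _ : T => {y | (z, y) ∈ R} := by
      ext w; simp [hE, hz]
    simp [this, hz, Measure.pi_pi]
  · have : Prod.mk z ⁻¹' E = ∅ := by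
      ext w; simp [hE, hz]
    simp [this, hz]

theorem pi_forall_le (T : Finset ι) {Z : (ι → ℝ) → β} (hZ : Measurable Z)
    (hind : IndepFun Z (fun x (k : T) => x k) (Measure.pi fun _ : ι => μ))
    {D : Set β} (hD : MeasurableSet D) {R : Set (β × ℝ)} (hR : MeasurableSet R) {r : ℝ}
    (hr : 0 ≤ r) (h : ∀ z ∈ D, μ.real {y | (z, y) ∈ R} ≤ r) :
    (Measure.pi fun _ : ι => μ).real {x | Z x ∈ D ∧ ∀ k ∈ T, (Z x, x k) ∈ R} ≤
      (Measure.pi fun _ : ι => μ).real (Z ⁻¹' D) * r ^ T.card := by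
  have key : (Measure.pi fun _ : ι => μ) {x | Z x ∈ D ∧ ∀ k ∈ T, (Z x, x k) ∈ R} ≤
      ENNReal.ofReal r ^ T.card * (Measure.pi fun _ : ι => μ) (Z ⁻¹' D) := by
    rw [pi_forall_eq_lintegral T hZ hind hD hR, ← Measure.map_apply hZ hD, ← setLIntegral_const]
    refine setLIntegral_mono measurable_const fun z hz => ?_
    gcongr
    rw [← ofReal_measureReal (measure_ne_top _ _)]
    exact ENNReal.ofReal_le_ofReal (h z hz)
  have := ENNReal.toReal_mono (by finiteness) key
  rw [ENNReal.toReal_mul, ENNReal.toReal_pow, ENNReal.toReal_ofReal hr, mul_comm] at this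
  exact this

theorem le_pi_forall (T : Finset ι) {Z : (ι → ℝ) → β} (hZ : Measurable Z)
    (hind : IndepFun Z (fun x (k : T) => x k) (Measure.pi fun _ : ι => μ))
    {D : Set β} (hD : MeasurableSet D) {R : Set (β × ℝ)} (hR : MeasurableSet R) {r : ℝ}
    (hr : 0 ≤ r) (h : ∀ z ∈ D, r ≤ μ.real {y | (z, y) ∈ R}) :
    (Measure.pi fun _ : ι => μ).real (Z ⁻¹' D) * r ^ T.card ≤
      (Measure.pi fun _ : ι => μ).real {x | Z x ∈ D ∧ ∀ k ∈ T, (Z x, x k) ∈ R} := by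
  have key : ENNReal.ofReal r ^ T.card * (Measure.pi fun _ : ι => μ) (Z ⁻¹' D) ≤
      (Measure.pi fun _ : ι => μ) {x | Z x ∈ D ∧ ∀ k ∈ T, (Z x, x k) ∈ R} := by
    rw [pi_forall_eq_lintegral T hZ hind hD hR, ← Measure.map_apply hZ hD, ← setLIntegral_const]
    refine setLIntegral_mono' hD fun z hz => ?_
    gcongr
    rw [← ofReal_measureReal (measure_ne_top _ _)]
    exact ENNReal.ofReal_le_ofReal (h z hz)
  have := ENNReal.toReal_mono (by finiteness) key
  rw [ENNReal.toReal_mul, ENNReal.toReal_pow, ENNReal.toReal_ofReal hr, mul_comm] at this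
  exact this

theorem indepFun_eval_restrict {i : ι} {T : Finset ι} (hi : i ∉ T) :
    IndepFun (fun x : ι → ℝ => x i) (fun x (k : T) => x k) (Measure.pi fun _ : ι => μ) := by
  classical
  have h := (iIndepFun_eval (ι := ι) μ).indepFun_finset {i} T (by simpa using hi)
    (fun k => measurable_pi_apply k)
  exact h.comp (φ := fun w : ({i} : Finset ι) → ℝ => w ⟨i, by simp⟩) (ψ := id)
    (measurable_pi_apply _) measurable_id

theorem indepFun_eval_pair_restrict {i j : ι} {T : Finset ι} (hi : i ∉ T) (hj : j ∉ T) :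
    IndepFun (fun x : ι → ℝ => (x i, x j)) (fun x (k : T) => x k)
      (Measure.pi fun _ : ι => μ) := by
  classical
  have h := (iIndepFun_eval (ι := ι) μ).indepFun_finset {i, j} T (by simp [hi, hj])
    (fun k => measurable_pi_apply k)
  exact h.comp (φ := fun w : ({i, j} : Finset ι) → ℝ => (w ⟨i, by simp⟩, w ⟨j, by simp⟩))
    (ψ := id) ((measurable_pi_apply _).prodMk (measurable_pi_apply _)) measurable_id

end Independence

/-! ### Expected numbers of nodes without nodes of smaller id nearby -/

section EmptyNeighborhoods

variable {μ : Measure ℝ} [IsProbabilityMeasure μ] {n : ℕ}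

/-- Node `i` lies in `B` and no node of smaller id lies in `J (x i)`. -/
def loneEvent (B : Set ℝ) (J : ℝ → Set ℝ) (i : Fin n) : Set (Fin n → ℝ) :=
  {x | x i ∈ B ∧ ∀ j < i, x j ∉ J (x i)}

/-- Node `i` lies in `B`, node `j` in `Q (x i)`, and no other node of smaller id than `i` in
`J (x i) (x j)`. -/
def lonePairEvent (B : Set ℝ) (Q : ℝ → Set ℝ) (J : ℝ → ℝ → Set ℝ) (i j : Fin n) :
    Set (Fin n → ℝ) :=
  {x | x i ∈ B ∧ x j ∈ Q (x i) ∧ ∀ k < i, k ≠ j → x k ∉ J (x i) (x j)}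

theorem measurableSet_loneEvent {B : Set ℝ} (hB : MeasurableSet B) {J : ℝ → Set ℝ}
    (hJ : MeasurableSet {w : ℝ × ℝ | w.2 ∈ J w.1}) (i : Fin n) :
    MeasurableSet (loneEvent B J i) := by
  have : loneEvent B J i = (fun x => x i) ⁻¹' B ∩
      ⋂ j : Fin n, ⋂ _ : j < i, ((fun x => (x i, x j)) ⁻¹' {w : ℝ × ℝ | w.2 ∈ J w.1})ᶜ := by
    ext x; simp [loneEvent]
  rw [this]
  exact (measurable_pi_apply i hB).inter <| MeasurableSet.iInter fun j =>
    MeasurableSet.iInter fun _ =>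
      ((measurable_pi_apply i).prodMk (measurable_pi_apply j) hJ).compl

theorem measurableSet_lonePairEvent {B : Set ℝ} (hB : MeasurableSet B) {Q : ℝ → Set ℝ}
    (hQ : MeasurableSet {w : ℝ × ℝ | w.2 ∈ Q w.1}) {J : ℝ → ℝ → Set ℝ}
    (hJ : MeasurableSet {w : (ℝ × ℝ) × ℝ | w.2 ∈ J w.1.1 w.1.2}) (i j : Fin n) :
    MeasurableSet (lonePairEvent B Q J i j) := by
  have : lonePairEvent B Q J i j = (fun x => x i) ⁻¹' B ∩
      ((fun x => (x i, x j)) ⁻¹' {w : ℝ × ℝ | w.2 ∈ Q w.1} ∩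
      ⋂ k : Fin n, ⋂ _ : k < i, ⋂ _ : k ≠ j,
        ((fun x => ((x i, x j), x k)) ⁻¹' {w : (ℝ × ℝ) × ℝ | w.2 ∈ J w.1.1 w.1.2})ᶜ) := by
    ext x; simp [lonePairEvent]
  rw [this]
  exact (measurable_pi_apply i hB).inter <|
    ((measurable_pi_apply i).prodMk (measurable_pi_apply j) hQ).inter <|
    MeasurableSet.iInter fun k => MeasurableSet.iInter fun _ => MeasurableSet.iInter fun _ =>
      (((measurable_pi_apply i).prodMk (measurable_pi_apply j)).prodMk
        (measurable_pi_apply k) hJ).compl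

theorem loneEvent_eq (B : Set ℝ) (J : ℝ → Set ℝ) (i : Fin n) :
    loneEvent B J i =
      {x | x i ∈ B ∧ ∀ j ∈ Finset.Iio i, (x i, x j) ∈ {w : ℝ × ℝ | w.2 ∈ J w.1}ᶜ} := by
  ext x; simp [loneEvent]

theorem lonePairEvent_eq (B : Set ℝ) (Q : ℝ → Set ℝ) (J : ℝ → ℝ → Set ℝ) (i j : Fin n) :
    lonePairEvent B Q J i j =
      {x | (x i, x j) ∈ {w : ℝ × ℝ | w.1 ∈ B ∧ w.2 ∈ Q w.1} ∧ ∀ k ∈ (Finset.Iio i).erase j,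
        ((x i, x j), x k) ∈ {w : (ℝ × ℝ) × ℝ | w.2 ∈ J w.1.1 w.1.2}ᶜ} := by
  ext x; simp only [lonePairEvent, mem_ofPred_eq, mem_compl_iff, Finset.mem_erase, Finset.mem_Iio]
  tauto

theorem measureReal_section_compl {β : Type*} [MeasurableSpace β] {S : Set (β × ℝ)}
    (hS : MeasurableSet S) (z : β) :
    μ.real {y | (z, y) ∈ Sᶜ} = 1 - μ.real {y | (z, y) ∈ S} := by
  have h : MeasurableSet {y | (z, y) ∈ S} := measurable_prodMk_left hS
  exact probReal_compl_eq_one_sub h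

/-- With 0-based ids exactly `i` nodes have a smaller id than `i`; given `x i`, they avoid the
window independently, each with probability at most `1 - c`. -/
theorem measureReal_loneEvent_le {B : Set ℝ} (hB : MeasurableSet B) {J : ℝ → Set ℝ}
    (hJ : MeasurableSet {w : ℝ × ℝ | w.2 ∈ J w.1}) {c : ℝ} (hc : c ≤ 1)
    (h : ∀ p ∈ B, c ≤ μ.real (J p)) (i : Fin n) :
    (Measure.pi fun _ : Fin n => μ).real (loneEvent B J i) ≤ μ.real B * (1 - c) ^ (i : ℕ) := by
  rw [loneEvent_eq]
  refine (pi_forall_le (Finset.Iio i) (measurable_pi_apply i)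
    (indepFun_eval_restrict (by simp)) hB hJ.compl (sub_nonneg.2 hc) fun p hp => ?_).trans_eq ?_
  · rw [measureReal_section_compl hJ]
    have := h p hp
    simp only [mem_ofPred_eq, ofPred_mem_eq]
    linarith
  · rw [Fin.card_Iio, ← map_measureReal_apply (measurable_pi_apply i) hB, map_eval_measure_pi]

theorem le_measureReal_loneEvent {B : Set ℝ} (hB : MeasurableSet B) {J : ℝ → Set ℝ}
    (hJ : MeasurableSet {w : ℝ × ℝ | w.2 ∈ J w.1}) {c : ℝ} (hc : c ≤ 1)
    (h : ∀ p ∈ B, μ.real (J p) ≤ c) (i : Fin n) :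
    μ.real B * (1 - c) ^ (i : ℕ) ≤ (Measure.pi fun _ : Fin n => μ).real (loneEvent B J i) := by
  rw [loneEvent_eq]
  refine Eq.trans_le ?_ (le_pi_forall (Finset.Iio i) (measurable_pi_apply i)
    (indepFun_eval_restrict (by simp)) hB hJ.compl (sub_nonneg.2 hc) fun p hp => ?_)
  · rw [Fin.card_Iio, ← map_measureReal_apply (measurable_pi_apply i) hB, map_eval_measure_pi]
  · rw [measureReal_section_compl hJ]
    have := h p hp
    simp only [mem_ofPred_eq, ofPred_mem_eq]
    linarith

theorem measurableSet_prod_section {B : Set ℝ} (hB : MeasurableSet B) {Q : ℝ → Set ℝ}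
    (hQ : MeasurableSet {w : ℝ × ℝ | w.2 ∈ Q w.1}) :
    MeasurableSet {w : ℝ × ℝ | w.1 ∈ B ∧ w.2 ∈ Q w.1} :=
  (measurable_fst hB).inter hQ

theorem preimage_pair_eq (B : Set ℝ) (Q : ℝ → Set ℝ) (i j : Fin n) :
    (fun x : Fin n → ℝ => (x i, x j)) ⁻¹' {w : ℝ × ℝ | w.1 ∈ B ∧ w.2 ∈ Q w.1} =
      {x | x i ∈ B ∧ ∀ k ∈ ({j} : Finset (Fin n)), (x i, x k) ∈ {w : ℝ × ℝ | w.2 ∈ Q w.1}} := by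
  ext x; simp

/-- Condition on the pair `(x i, x j)`: the remaining `i - 1` nodes of smaller id avoid the window
independently. The subtraction is not truncated since `j < i`. The factor `μ(B) q` comes from
conditioning on `x i` alone. -/
theorem measureReal_lonePairEvent_le {B : Set ℝ} (hB : MeasurableSet B) {Q : ℝ → Set ℝ}
    (hQ : MeasurableSet {w : ℝ × ℝ | w.2 ∈ Q w.1}) {J : ℝ → ℝ → Set ℝ}
    (hJ : MeasurableSet {w : (ℝ × ℝ) × ℝ | w.2 ∈ J w.1.1 w.1.2}) {q c : ℝ} (hq : 0 ≤ q)
    (hc : c ≤ 1) (hQq : ∀ p ∈ B, μ.real (Q p) ≤ q)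
    (h : ∀ p ∈ B, ∀ y ∈ Q p, c ≤ μ.real (J p y)) {i j : Fin n} (hij : j < i) :
    (Measure.pi fun _ : Fin n => μ).real (lonePairEvent B Q J i j) ≤
      μ.real B * q * (1 - c) ^ ((i : ℕ) - 1) := by
  rw [lonePairEvent_eq]
  refine (pi_forall_le ((Finset.Iio i).erase j)
    ((measurable_pi_apply i).prodMk (measurable_pi_apply j))
    (indepFun_eval_pair_restrict (by simp) (by simp)) (measurableSet_prod_section hB hQ)
    hJ.compl (sub_nonneg.2 hc) fun w hw => ?_).trans ?_
  · rw [measureReal_section_compl hJ]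
    have := h w.1 hw.1 w.2 hw.2
    simp only [mem_ofPred_eq, ofPred_mem_eq]
    linarith
  · rw [Finset.card_erase_of_mem (by simpa using hij), Fin.card_Iio, preimage_pair_eq]
    gcongr
    refine (pi_forall_le {j} (measurable_pi_apply i)
      (indepFun_eval_restrict (by simpa using hij.ne')) hB hQ hq fun p hp => ?_).trans_eq ?_
    · simpa using hQq p hp
    · rw [← map_measureReal_apply (measurable_pi_apply i) hB, map_eval_measure_pi]
      simp

theorem le_measureReal_lonePairEvent {B : Set ℝ} (hB : MeasurableSet B) {Q : ℝ → Set ℝ}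
    (hQ : MeasurableSet {w : ℝ × ℝ | w.2 ∈ Q w.1}) {J : ℝ → ℝ → Set ℝ}
    (hJ : MeasurableSet {w : (ℝ × ℝ) × ℝ | w.2 ∈ J w.1.1 w.1.2}) {q c : ℝ} (hq : 0 ≤ q)
    (hc : c ≤ 1) (hQq : ∀ p ∈ B, q ≤ μ.real (Q p))
    (h : ∀ p ∈ B, ∀ y ∈ Q p, μ.real (J p y) ≤ c) {i j : Fin n} (hij : j < i) :
    μ.real B * q * (1 - c) ^ ((i : ℕ) - 1) ≤
      (Measure.pi fun _ : Fin n => μ).real (lonePairEvent B Q J i j) := by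
  rw [lonePairEvent_eq]
  refine LE.le.trans ?_ (le_pi_forall ((Finset.Iio i).erase j)
    ((measurable_pi_apply i).prodMk (measurable_pi_apply j))
    (indepFun_eval_pair_restrict (by simp) (by simp)) (measurableSet_prod_section hB hQ)
    hJ.compl (sub_nonneg.2 hc) fun w hw => ?_)
  · rw [Finset.card_erase_of_mem (by simpa using hij), Fin.card_Iio, preimage_pair_eq]
    gcongr
    refine Eq.trans_le ?_ (le_pi_forall {j} (measurable_pi_apply i)
      (indepFun_eval_restrict (by simpa using hij.ne')) hB hQ hq fun p hp => ?_)
    · rw [← map_measureReal_apply (measurable_pi_apply i) hB, map_eval_measure_pi]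
      simp
    · simpa using hQq p hp
  · rw [measureReal_section_compl hJ]
    have := h w.1 hw.1 w.2 hw.2
    simp only [mem_ofPred_eq, ofPred_mem_eq]
    linarith

/-- A geometric series in the id; the bound does not depend on `n`. For windows of length `c'` on
`[0, L]` it reads `|B| / c'`, the factors `1 / L` cancelling. -/
theorem sum_measureReal_loneEvent_le {B : Set ℝ} (hB : MeasurableSet B) {J : ℝ → Set ℝ}
    (hJ : MeasurableSet {w : ℝ × ℝ | w.2 ∈ J w.1}) {c : ℝ} (hc0 : 0 < c) (hc : c ≤ 1)
    (h : ∀ p ∈ B, c ≤ μ.real (J p)) :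
    ∑ i : Fin n, (Measure.pi fun _ : Fin n => μ).real (loneEvent B J i) ≤ μ.real B / c := by
  calc _ ≤ ∑ i : Fin n, μ.real B * (1 - c) ^ (i : ℕ) :=
        Finset.sum_le_sum fun i _ => measureReal_loneEvent_le hB hJ hc h i
    _ = μ.real B * ((1 - (1 - c) ^ n) / c) := by
      rw [← Finset.mul_sum, Fin.sum_univ_eq_sum_range (fun k => (1 - c) ^ k), geom_sum_eq (by linarith)]
      congr 1
      rw [div_eq_div_iff (by linarith) (by linarith)]
      ring
    _ ≤ μ.real B * (1 / c) := by
      gcongr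
      have := pow_nonneg (sub_nonneg.2 hc) n
      linarith
    _ = _ := by ring

theorem le_sum_measureReal_loneEvent {B : Set ℝ} (hB : MeasurableSet B) {J : ℝ → Set ℝ}
    (hJ : MeasurableSet {w : ℝ × ℝ | w.2 ∈ J w.1}) {c : ℝ} (hc0 : 0 < c) (hc : c ≤ 1)
    (h : ∀ p ∈ B, μ.real (J p) ≤ c) :
    μ.real B * ((1 - (1 - c) ^ n) / c) ≤
      ∑ i : Fin n, (Measure.pi fun _ : Fin n => μ).real (loneEvent B J i) := by
  calc _ = ∑ i : Fin n, μ.real B * (1 - c) ^ (i : ℕ) := by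
        rw [← Finset.mul_sum, Fin.sum_univ_eq_sum_range (fun k => (1 - c) ^ k), geom_sum_eq (by linarith)]
        congr 1
        rw [div_eq_div_iff (by linarith) (by linarith)]
        ring
    _ ≤ _ := Finset.sum_le_sum fun i _ => le_measureReal_loneEvent hB hJ hc h i

theorem hasSum_mul_geometric_pred {r : ℝ} (h0 : 0 ≤ r) (h1 : r < 1) :
    HasSum (fun k : ℕ => (k : ℝ) * r ^ (k - 1)) (1 / (1 - r) ^ 2) := by
  -- The term `k = 0` vanishes; after the shift the truncated exponent `k - 1` disappears and `(k +
  -- 1) r ^ k` splits into two known series.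
  rw [← hasSum_nat_add_iff' 1]
  have h2 : ‖r‖ < 1 := by rwa [Real.norm_of_nonneg h0]
  have h := (hasSum_coe_mul_geometric_of_norm_lt_one h2).add (hasSum_geometric_of_norm_lt_one h2)
  convert! h using 1
  · ext k
    simp
    ring
  · have : 1 - r ≠ 0 := by linarith
    simp
    field_simp
    ring

theorem sum_sum_Iio_const (f : ℕ → ℝ) (s : ℝ) :
    ∑ i : Fin n, ∑ _j ∈ Finset.Iio i, s * f i = s * ∑ k ∈ Finset.range n, (k : ℝ) * f k := by
  rw [Finset.mul_sum, ← Fin.sum_univ_eq_sum_range (fun k => s * ((k : ℝ) * f k))]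
  refine Finset.sum_congr rfl fun i _ => ?_
  simp [Finset.sum_const, Fin.card_Iio]
  ring

/-- Node `i` has `i` candidates for `j`, whence the differentiated geometric series and the square
of `c`. -/
theorem sum_measureReal_lonePairEvent_le {B : Set ℝ} (hB : MeasurableSet B) {Q : ℝ → Set ℝ}
    (hQ : MeasurableSet {w : ℝ × ℝ | w.2 ∈ Q w.1}) {J : ℝ → ℝ → Set ℝ}
    (hJ : MeasurableSet {w : (ℝ × ℝ) × ℝ | w.2 ∈ J w.1.1 w.1.2}) {q c : ℝ} (hq : 0 ≤ q)
    (hc0 : 0 < c) (hc : c ≤ 1) (hQq : ∀ p ∈ B, μ.real (Q p) ≤ q)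
    (h : ∀ p ∈ B, ∀ y ∈ Q p, c ≤ μ.real (J p y)) :
    ∑ i : Fin n, ∑ j ∈ Finset.Iio i,
      (Measure.pi fun _ : Fin n => μ).real (lonePairEvent B Q J i j) ≤
      μ.real B * q / c ^ 2 := by
  calc _ ≤ ∑ i : Fin n, ∑ _j ∈ Finset.Iio i, μ.real B * q * (1 - c) ^ ((i : ℕ) - 1) :=
        Finset.sum_le_sum fun i _ => Finset.sum_le_sum fun j hj =>
          measureReal_lonePairEvent_le hB hQ hJ hq hc hQq h (by simpa using hj)
    _ = μ.real B * q * ∑ k ∈ Finset.range n, (k : ℝ) * (1 - c) ^ (k - 1) :=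
        sum_sum_Iio_const (fun k => (1 - c) ^ (k - 1)) _
    _ ≤ μ.real B * q * (1 / (1 - (1 - c)) ^ 2) := by
      gcongr
      refine sum_le_hasSum _ (fun k _ => ?_)
        (hasSum_mul_geometric_pred (sub_nonneg.2 hc) (by linarith))
      exact mul_nonneg k.cast_nonneg (pow_nonneg (sub_nonneg.2 hc) _)
    _ = _ := by ring

theorem le_sum_measureReal_lonePairEvent {B : Set ℝ} (hB : MeasurableSet B) {Q : ℝ → Set ℝ}
    (hQ : MeasurableSet {w : ℝ × ℝ | w.2 ∈ Q w.1}) {J : ℝ → ℝ → Set ℝ}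
    (hJ : MeasurableSet {w : (ℝ × ℝ) × ℝ | w.2 ∈ J w.1.1 w.1.2}) {q c : ℝ} (hq : 0 ≤ q)
    (hc : c ≤ 1) (hQq : ∀ p ∈ B, q ≤ μ.real (Q p))
    (h : ∀ p ∈ B, ∀ y ∈ Q p, μ.real (J p y) ≤ c) :
    μ.real B * q * ∑ k ∈ Finset.range n, (k : ℝ) * (1 - c) ^ (k - 1) ≤
    ∑ i : Fin n, ∑ j ∈ Finset.Iio i,
      (Measure.pi fun _ : Fin n => μ).real (lonePairEvent B Q J i j) := by
  calc _ = ∑ i : Fin n, ∑ _j ∈ Finset.Iio i, μ.real B * q * (1 - c) ^ ((i : ℕ) - 1) :=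
        (sum_sum_Iio_const (fun k => (1 - c) ^ (k - 1)) _).symm
    _ ≤ _ := Finset.sum_le_sum fun i _ => Finset.sum_le_sum fun j hj =>
          le_measureReal_lonePairEvent hB hQ hJ hq hc hQq h (by simpa using hj)

end EmptyNeighborhoods

/-! ### Regular samples -/

/-- The positions are distinct points of `[0, L]`, and every interval holds its share of the nodes
up to an error `ε n`. -/
structure IsRegularSample {n : ℕ} (L ε : ℝ) (x : Fin n → ℝ) : Prop where
  injective : Function.Injective x
  mem_Icc : ∀ j, x j ∈ Icc 0 L
  ncard_le : ∀ c d, c ≤ d → ({j | x j ∈ Ioo c d}.ncard : ℝ) ≤ n * (d - c) / L + ε * n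
  le_ncard : ∀ c d, 0 ≤ c → c ≤ d → d ≤ L →
    n * (d - c) / L - ε * n ≤ ({j | x j ∈ Ioo c d}.ncard : ℝ)

open Classical in
theorem ncard_eq_sum_ite {n : ℕ} (S : Set (Fin n)) :
    (S.ncard : ℝ) = ∑ j : Fin n, if j ∈ S then (1 : ℝ) else 0 := by
  rw [Set.ncard_eq_toFinset_card', Finset.sum_boole]
  congr 2
  ext j
  simp

theorem ncard_le_natCast {n : ℕ} (S : Set (Fin n)) : (S.ncard : ℝ) ≤ n := by
  have := Set.ncard_le_card S
  simpa using this

/-! ### Regularity of a sample from its counting function on a grid -/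

section Grid

variable {n : ℕ} {L : ℝ} {x : Fin n → ℝ} {q : ℕ}

/-- The counting function is monotone, hence squeezed between its values at the two neighbouring
grid points: `n / q` for the error there and `n / q` for the mesh. -/
theorem abs_ncard_Iic_sub_le (hL : 0 < L) (hq : 0 < q)
    (h : ∀ k ≤ q, |({j | x j ≤ k * L / q}.ncard : ℝ) - n * k / q| ≤ n / q) {t : ℝ} (h0 : 0 ≤ t)
    (h1 : t ≤ L) : |({j | x j ≤ t}.ncard : ℝ) - n * t / L| ≤ 2 * n / q := by
  have hq' : (0 : ℝ) < q := by exact_mod_cast hq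
  have hn : (0 : ℝ) ≤ n := n.cast_nonneg
  have hs0 : 0 ≤ t * q / L := by positivity
  have hs1 : t * q / L ≤ q := by
    rw [div_le_iff₀ hL]; nlinarith
  have hmono : ∀ {s s' : ℝ}, s ≤ s' → ({j | x j ≤ s}.ncard : ℝ) ≤ {j | x j ≤ s'}.ncard := by
    intro s s' hss
    exact_mod_cast Set.ncard_le_ncard (fun j (hj : x j ≤ s) => hj.trans hss)
  have hts : t = (t * q / L) * L / q := by field_simp
  set s := t * q / L
  have e1 := (abs_le.1 (h ⌊s⌋₊ (Nat.floor_le_of_le hs1))).1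
  have e2 := (abs_le.1 (h ⌈s⌉₊ (Nat.ceil_le.2 hs1))).2
  have m1 := hmono (s := ⌊s⌋₊ * L / q) (s' := t) (by
    rw [hts]; gcongr; exact Nat.floor_le hs0)
  have m2 := hmono (s := t) (s' := ⌈s⌉₊ * L / q) (by
    rw [hts]; gcongr; exact Nat.le_ceil s)
  have f1 : n * (s - 1) / q ≤ n * ⌊s⌋₊ / q := by
    gcongr; exact (Nat.sub_one_lt_floor s).le
  have f2 : n * ⌈s⌉₊ / q ≤ n * (s + 1) / q := by
    gcongr; exact (Nat.ceil_lt_add_one hs0).le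
  have g : n * t / L = n * s / q := by rw [hts]; field_simp
  have g1 : n * (s - 1) / q = n * s / q - n / q := by ring
  have g2 : n * (s + 1) / q = n * s / q + n / q := by ring
  have g3 : 2 * (n : ℝ) / q = n / q + n / q := by ring
  rw [abs_le]
  constructor <;> linarith

/-- The number of nodes in an interval is a difference of two values of the counting function, each
known up to `2 n / q`; hence the condition `4 / q ≤ ε`. -/
theorem isRegularSample_of_grid (hL : 0 < L) (hq : 0 < q) {ε : ℝ} (hε : 4 / q ≤ ε)
    (hinj : Function.Injective x) (hmem : ∀ j, x j ∈ Icc 0 L)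
    (h : ∀ k ≤ q, |({j | x j ≤ k * L / q}.ncard : ℝ) - n * k / q| ≤ n / q) :
    IsRegularSample L ε x := by
  have hq' : (0 : ℝ) < q := by exact_mod_cast hq
  have hn : (0 : ℝ) ≤ n := n.cast_nonneg
  have hF := fun {t : ℝ} => abs_ncard_Iic_sub_le (t := t) hL hq h
  have hε' : 2 * n / q + 2 * n / q ≤ ε * n := by
    calc 2 * (n : ℝ) / q + 2 * n / q = 4 / q * n := by ring
      _ ≤ _ := by gcongr
  have hpos : 0 ≤ 2 * (n : ℝ) / q := by positivity
  have hsub : ∀ c d : ℝ, c ≤ d → ({j | x j ∈ Ioc c d}.ncard : ℝ) =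
      {j | x j ≤ d}.ncard - {j | x j ≤ c}.ncard := by
    intro c d hcd
    have h1 : {j | x j ∈ Ioc c d} = {j | x j ≤ d} \ {j | x j ≤ c} := by
      ext j; simp [and_comm]
    rw [h1, eq_sub_iff_add_eq]
    exact_mod_cast Set.ncard_sdiff_add_ncard_of_subset
      (fun j (hj : x j ≤ c) => (hj.trans hcd : x j ≤ d))
  refine ⟨hinj, hmem, fun c d hcd => ?_, fun c d hc hcd hd => ?_⟩
  · by_cases hout : d < 0 ∨ L < c
    · have : {j | x j ∈ Ioo c d} = ∅ := by
        ext j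
        have := hmem j
        simp only [mem_ofPred_eq, mem_Ioo, mem_empty_iff_false, iff_false, not_and]
        intro h1 h2
        rcases hout with h3 | h3 <;> linarith [this.1, this.2]
      rw [this]
      have : 0 ≤ n * (d - c) / L := by
        have : 0 ≤ d - c := by linarith
        positivity
      simp
      linarith
    push Not at hout
    obtain ⟨hd, hc⟩ := hout
    have h1 : ({j | x j ∈ Ioo c d}.ncard : ℝ) ≤ {j | x j ∈ Ioc c d}.ncard := by
      exact_mod_cast Set.ncard_le_ncard (fun j (hj : x j ∈ Ioo c d) => (⟨hj.1, hj.2.le⟩ : x j ∈ Ioc c d))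
    rw [hsub c d hcd] at h1
    have h2 : ({j | x j ≤ d}.ncard : ℝ) ≤ n * d / L + 2 * n / q := by
      by_cases hdL : d ≤ L
      · linarith [(abs_le.1 (hF hd hdL)).2]
      · have : (n : ℝ) ≤ n * d / L := by
          rw [le_div_iff₀ hL]; gcongr; exact (not_le.1 hdL).le
        linarith [ncard_le_natCast {j | x j ≤ d}]
    have h3 : n * c / L - 2 * n / q ≤ ({j | x j ≤ c}.ncard : ℝ) := by
      by_cases hc0 : 0 ≤ c
      · linarith [(abs_le.1 (hF hc0 hc)).1]
      · have : n * c / L ≤ 0 := by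
          apply div_nonpos_of_nonpos_of_nonneg _ hL.le
          exact mul_nonpos_of_nonneg_of_nonpos hn (not_le.1 hc0).le
        have : (0 : ℝ) ≤ ({j | x j ≤ c}.ncard : ℝ) := Nat.cast_nonneg _
        linarith
    have : n * (d - c) / L = n * d / L - n * c / L := by ring
    linarith
  · rcases hcd.eq_or_lt with rfl | hlt
    · have : (0 : ℝ) ≤ ({j | x j ∈ Ioo c c}.ncard : ℝ) := Nat.cast_nonneg _
      simp only [sub_self, mul_zero, zero_div]
      linarith
    -- The counting function controls half-open intervals; the open right end is reached by letting
    -- `s` increase to `d`.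
    have key : ∀ s ∈ Ioo c d, n * (s - c) / L - ε * n ≤ ({j | x j ∈ Ioo c d}.ncard : ℝ) := by
      intro s hs
      have h1 : ({j | x j ∈ Ioc c s}.ncard : ℝ) ≤ {j | x j ∈ Ioo c d}.ncard := by
        exact_mod_cast Set.ncard_le_ncard
          (fun j (hj : x j ∈ Ioc c s) => (⟨hj.1, hj.2.trans_lt hs.2⟩ : x j ∈ Ioo c d))
      rw [hsub c s hs.1.le] at h1
      have h2 := (abs_le.1 (hF (hc.trans hs.1.le) (hs.2.le.trans hd))).1
      have h3 := (abs_le.1 (hF hc (hcd.trans hd))).2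
      have : n * (s - c) / L = n * s / L - n * c / L := by ring
      linarith
    have hcont : Tendsto (fun s : ℝ => n * (s - c) / L - ε * n) (nhdsWithin d (Iio d))
        (nhds (n * (d - c) / L - ε * n)) :=
      (Continuous.tendsto (by fun_prop) d).mono_left nhdsWithin_le_nhds
    refine le_of_tendsto hcont ?_
    filter_upwards [Ioo_mem_nhdsLT hlt] with s hs using key s hs

end Grid

/-! ### Concentration: almost all samples are regular -/

section RegularLaw

variable {L : ℝ} [hL : Fact (0 < L)]

/-- Hoeffding's inequality for the indicators of `x j ≤ t`, independent with mean `t / L`, applied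
to the sum and to its opposite. -/
theorem measureReal_ncard_Iic_deviation_le (n : ℕ) {t δ : ℝ} (h0 : 0 ≤ t) (h1 : t ≤ L)
    (hδ : 0 ≤ δ) :
    (positionLaw L n).real {x | ¬ |({j | x j ≤ t}.ncard : ℝ) - n * t / L| ≤ δ * n} ≤
      2 * Real.exp (-(2 * δ ^ 2) * n) := by
  have hmeas : ∀ j : Fin n, Measurable fun x : Fin n → ℝ => (Iic t).indicator (1 : ℝ → ℝ) (x j) :=
    fun j => (measurable_one.indicator measurableSet_Iic).comp (measurable_pi_apply j)
  have hint : ∀ j : Fin n, ∫ x, (Iic t).indicator (1 : ℝ → ℝ) (x j) ∂(positionLaw L n) = t / L := by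
    intro j
    have h2 := integral_map (μ := positionLaw L n) (φ := fun x : Fin n → ℝ => x j)
      (measurable_pi_apply j).aemeasurable (f := (Iic t).indicator (1 : ℝ → ℝ))
      ((measurable_one.indicator measurableSet_Iic).aestronglyMeasurable)
    rw [← h2]
    unfold positionLaw
    rw [map_eval_measure_pi, integral_indicator_one measurableSet_Iic, measureReal_cond_Icc hL.out]
    have : Icc 0 L ∩ Iic t = Icc 0 t := by
      ext y; simp only [mem_inter_iff, mem_Icc, mem_Iic]
      exact ⟨fun h => ⟨h.1.1, h.2⟩, fun h => ⟨⟨h.1, h.2.trans h1⟩, h.2⟩⟩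
    rw [this]
    simp [h0]
  have hsg : ∀ j : Fin n, HasSubgaussianMGF
      (fun x : Fin n → ℝ => (Iic t).indicator (1 : ℝ → ℝ) (x j) - t / L)
      ((‖(1 : ℝ) - 0‖₊ / 2) ^ 2) (positionLaw L n) := by
    intro j
    have := hasSubgaussianMGF_of_mem_Icc (μ := positionLaw L n)
      (X := fun x : Fin n → ℝ => (Iic t).indicator (1 : ℝ → ℝ) (x j)) (a := 0) (b := 1)
      (hmeas j).aemeasurable (Eventually.of_forall fun x => by
        by_cases h : x j ≤ t <;> simp [h])
    rwa [hint j] at this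
  have hind : iIndepFun (fun (j : Fin n) (x : Fin n → ℝ) =>
      (Iic t).indicator (1 : ℝ → ℝ) (x j) - t / L) (positionLaw L n) :=
    (iIndepFun_eval (ι := Fin n) (cond volume (Icc 0 L))).comp
      (g := fun _ y => (Iic t).indicator (1 : ℝ → ℝ) y - t / L)
      (fun _ => (measurable_one.indicator measurableSet_Iic).sub_const _)
  have hind' : iIndepFun (fun (j : Fin n) (x : Fin n → ℝ) =>
      -((Iic t).indicator (1 : ℝ → ℝ) (x j) - t / L)) (positionLaw L n) :=
    hind.comp (g := fun _ y => -y) (fun _ => measurable_neg)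
  -- Each indicator is sub-Gaussian with parameter `1/4`, so the exponent is `(δ n)² / (2 · n / 4)`.
  -- For `n = 0` both sides are zero.
  have hexp : -(δ * (n : ℝ)) ^ 2 / (2 * ∑ _j : Fin n, (((‖(1 : ℝ) - 0‖₊ / 2) ^ 2 : NNReal) : ℝ)) =
      -(2 * δ ^ 2) * n := by
    rcases Nat.eq_zero_or_pos n with rfl | hn
    · simp
    · have : (n : ℝ) ≠ 0 := by positivity
      simp
      field_simp
  have b1 := HasSubgaussianMGF.measure_sum_ge_le_of_iIndepFun hind (s := Finset.univ) (fun j _ => hsg j)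
    (ε := δ * n) (by positivity)
  have b2 := HasSubgaussianMGF.measure_sum_ge_le_of_iIndepFun hind' (s := Finset.univ) (fun j _ => (hsg j).neg)
    (ε := δ * n) (by positivity)
  push_cast at hexp b1 b2
  rw [hexp] at b1 b2
  suffices hsub : {x : Fin n → ℝ | ¬ |({j | x j ≤ t}.ncard : ℝ) - n * t / L| ≤ δ * n} ⊆
      {x | δ * n ≤ ∑ j, ((Iic t).indicator (1 : ℝ → ℝ) (x j) - t / L)} ∪
      {x | δ * n ≤ ∑ j, -((Iic t).indicator (1 : ℝ → ℝ) (x j) - t / L)} from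
    ((measureReal_mono hsub).trans (measureReal_union_le _ _)).trans (by linarith [b1, b2])
  intro x hx
  have hs : ({j | x j ≤ t}.ncard : ℝ) - n * t / L =
      ∑ j, ((Iic t).indicator (1 : ℝ → ℝ) (x j) - t / L) := by
    rw [ncard_eq_sum_ite, Finset.sum_sub_distrib]
    have : ∑ _j : Fin n, t / L = n * t / L := by simp; ring
    rw [this]
    congr 1
  have hx' : δ * n < |({j | x j ≤ t}.ncard : ℝ) - n * t / L| := not_le.1 hx
  rw [hs, lt_abs] at hx'
  rcases hx' with h | h
  · exact Or.inl h.le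
  · refine Or.inr ?_
    simp only [mem_ofPred_eq, Finset.sum_neg_distrib]
    exact h.le

theorem measure_eval_eq_eq_zero {n : ℕ} {i j : Fin n} (hij : i ≠ j) :
    (positionLaw L n).real {x | x i = x j} = 0 := by
  have h := pi_forall_le (μ := cond volume (Icc 0 L)) (ι := Fin n) {j} (measurable_pi_apply i)
    (indepFun_eval_restrict (by simpa using hij)) MeasurableSet.univ
    (R := {w : ℝ × ℝ | w.1 = w.2}) measurableSet_diagonal le_rfl (fun p _ => by
      refine (measureReal_cond_Icc_le hL.out (le_refl p) (S := {y | (p, y) ∈ {w : ℝ × ℝ | w.1 = w.2}})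
        (fun y (hy : p = y) => by simp [hy])).trans (by simp))
  refine le_antisymm ?_ measureReal_nonneg
  simpa [positionLaw] using h

theorem measure_eval_notMem_eq_zero {n : ℕ} (i : Fin n) :
    (positionLaw L n).real {x | x i ∉ Icc 0 L} = 0 := by
  have : {x : Fin n → ℝ | x i ∉ Icc 0 L} = (fun x => x i) ⁻¹' (Icc 0 L)ᶜ := rfl
  rw [this, ← map_measureReal_apply (measurable_pi_apply i) measurableSet_Icc.compl]
  unfold positionLaw
  rw [map_eval_measure_pi, measureReal_cond_Icc hL.out]
  simp

/-- Ties and positions outside `[0, L]` are null events; what remains is a union bound over the `q +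
1` grid points. -/
theorem measureReal_not_isRegularSample_le (n : ℕ) {ε : ℝ} {q : ℕ} (hq : 0 < q)
    (hε : 4 / q ≤ ε) :
    (positionLaw L n).real {x | ¬ IsRegularSample L ε x} ≤
      (q + 1) * (2 * Real.exp (-(2 * (1 / q) ^ 2) * n)) := by
  have hq' : (0 : ℝ) < q := by exact_mod_cast hq
  have hsub : {x : Fin n → ℝ | ¬ IsRegularSample L ε x} ⊆
      (⋃ i : Fin n, ⋃ j ∈ {j | i ≠ j}, {x | x i = x j}) ∪ ((⋃ i : Fin n, {x | x i ∉ Icc 0 L}) ∪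
      ⋃ k ∈ Finset.range (q + 1), {x : Fin n → ℝ |
        ¬ |({j | x j ≤ k * L / q}.ncard : ℝ) - n * (k * L / q) / L| ≤ 1 / q * n}) := by
    intro x hx
    by_contra hcon
    simp only [mem_union, mem_iUnion, not_or, not_exists, mem_ofPred_eq, not_not,
      Finset.mem_range] at hcon
    obtain ⟨h1, h2, h3⟩ := hcon
    refine hx (isRegularSample_of_grid hL.out hq hε (fun i j hij => ?_) h2 fun k hk => ?_)
    · by_contra hne
      exact h1 i j hne hij
    · have := h3 k (by omega)
      convert this using 1
      · congr 2
        have := hL.out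
        field_simp
      · ring
  refine (measureReal_mono hsub).trans ((measureReal_union_le _ _).trans ?_)
  have e1 : (positionLaw L n).real (⋃ i : Fin n, ⋃ j ∈ {j | i ≠ j}, {x | x i = x j}) = 0 := by
    refine (measureReal_eq_zero_iff).2 (measure_iUnion_null fun i =>
      (measure_biUnion_null_iff (to_countable _)).2 fun j hj => ?_)
    exact (measureReal_eq_zero_iff).1 (measure_eval_eq_eq_zero hj)
  have e2 : (positionLaw L n).real (⋃ i : Fin n, {x | x i ∉ Icc 0 L}) = 0 :=
    (measureReal_eq_zero_iff).2 (measure_iUnion_null fun i =>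
      (measureReal_eq_zero_iff).1 (measure_eval_notMem_eq_zero i))
  rw [e1, zero_add]
  refine (measureReal_union_le _ _).trans ?_
  rw [e2, zero_add]
  refine (measureReal_biUnion_finset_le _ _).trans ?_
  refine (Finset.sum_le_card_nsmul _ _ (2 * Real.exp (-(2 * (1 / q) ^ 2) * n)) fun k hk => ?_).trans_eq ?_
  · have hk' : (k : ℝ) ≤ q := by exact_mod_cast Nat.lt_succ_iff.1 (Finset.mem_range.1 hk)
    have := hL.out
    refine measureReal_ncard_Iic_deviation_le n (by positivity) ?_ (by positivity)
    rw [div_le_iff₀ hq']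
    nlinarith
  · simp

/-- Up to an event of probability `o(n⁻²)` the sample is regular. -/
theorem exists_regular_event {ε : ℝ} (hε : 0 < ε) :
    ∃ Ω : ∀ n : ℕ, Set (Fin n → ℝ), (∀ n, MeasurableSet (Ω n)) ∧
      (∀ n, ∀ x ∈ Ω n, IsRegularSample L ε x) ∧
      Tendsto (fun n : ℕ => (n : ℝ) ^ 2 * (positionLaw L n).real (Ω n)ᶜ) atTop (nhds 0) := by
  obtain ⟨q, hq⟩ := exists_nat_gt (4 / ε)
  have hq' : (0 : ℝ) < q := (by positivity : 0 < 4 / ε).trans hq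
  have hqε : 4 / q ≤ ε := by
    rw [div_le_iff₀ hq']
    rw [div_lt_iff₀ hε] at hq
    linarith
  -- The irregular samples are enclosed in a measurable set of the same measure, which avoids
  -- proving that regularity is measurable. The weight `n²` in the limit matches the trivial bound
  -- on a total degree.
  refine ⟨fun n => (toMeasurable (positionLaw L n) {x | ¬ IsRegularSample L ε x})ᶜ,
    fun n => (measurableSet_toMeasurable _ _).compl, fun n x hx => ?_, ?_⟩
  · by_contra hcon
    exact hx (subset_toMeasurable _ _ hcon)
  · have hb : (0 : ℝ) < 2 * (1 / q) ^ 2 := by positivity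
    have hlim := ((tendsto_rpow_mul_exp_neg_mul_atTop_nhds_zero 2 _ hb).comp
      tendsto_natCast_atTop_atTop).const_mul ((q + 1 : ℝ) * 2)
    rw [mul_zero] at hlim
    refine squeeze_zero (fun n => by positivity) (fun n => ?_) hlim
    rw [compl_compl, measureReal_def, measure_toMeasurable, ← measureReal_def]
    have := measureReal_not_isRegularSample_le (L := L) n (by exact_mod_cast hq') hqε
    calc _ ≤ (n : ℝ) ^ 2 * ((q + 1) * (2 * Real.exp (-(2 * (1 / q) ^ 2) * n))) := by gcongr
      _ = _ := by
        simp only [Function.comp, Real.rpow_two]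
        ring

end RegularLaw

/-! ### From numbers of nodes to total degrees -/

section GraphFunctionals

variable {n : ℕ}

/-- The selection rule is arbitrary, so measurability can only come from finiteness: the graph is
determined by finitely many adjacency events, and every function of a finite set of relations is
measurable. -/
theorem measurable_comp_unitDiskGraph (F : SimpleGraph (Fin n) → ℝ) :
    Measurable fun x : Fin n → ℝ => F (unitDiskGraph x) := by
  have h1 : Measurable fun (x : Fin n → ℝ) (u v : Fin n) => (unitDiskGraph x).Adj u v := by
    refine measurable_pi_lambda _ fun u => measurable_pi_lambda _ fun v => ?_
    refine measurable_to_prop ?_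
    have : (fun x : Fin n → ℝ => (unitDiskGraph x).Adj u v) ⁻¹' {True} =
        {x | u ≠ v} ∩ {x | |x u - x v| < 1} := by
      ext x; simp [unitDiskGraph]
    rw [this]
    exact (MeasurableSet.const _).inter (measurableSet_lt (by fun_prop) measurable_const)
  have h2 : Measurable fun r : Fin n → Fin n → Prop => F (SimpleGraph.fromRel r) :=
    measurable_of_finite _
  convert h2.comp h1 using 2 with x
  simp only [Function.comp]
  congr 1
  ext u v
  simp only [SimpleGraph.fromRel_adj]
  exact ⟨fun h => ⟨h.ne, Or.inl h⟩, fun h => h.2.elim id fun h' => h'.symm⟩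

theorem measurableSet_mem_unitDiskGraph (A : SimpleGraph (Fin n) → Set (Fin n)) (v : Fin n) :
    MeasurableSet {x : Fin n → ℝ | v ∈ A (unitDiskGraph x)} := by
  classical
  have := measurable_comp_unitDiskGraph (fun G => if v ∈ A G then 1 else 0)
    (measurableSet_singleton 1)
  convert this using 1
  ext x
  simp

/-- The nodes of `A` with position in `[a, b]`. -/
def nodesIn (a b : ℝ) (A : SimpleGraph (Fin n) → Set (Fin n)) (x : Fin n → ℝ) : Set (Fin n) :=
  A (unitDiskGraph x) ∩ {v | x v ∈ Icc a b}

theorem measurableSet_mem_nodesIn (a b : ℝ) (A : SimpleGraph (Fin n) → Set (Fin n)) (v : Fin n) :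
    MeasurableSet {x | v ∈ nodesIn a b A x} :=
  (measurableSet_mem_unitDiskGraph A v).inter (measurable_pi_apply v measurableSet_Icc)

theorem measurable_ncard_nodes {S : (Fin n → ℝ) → Set (Fin n)}
    (hS : ∀ v, MeasurableSet {x | v ∈ S x}) : Measurable fun x => ((S x).ncard : ℝ) := by
  classical
  simp only [ncard_eq_sum_ite]
  exact Finset.measurable_sum _ fun v _ => Measurable.ite (hS v) measurable_const measurable_const

theorem measurable_totalDegree (a b : ℝ) (A : SimpleGraph (Fin n) → Set (Fin n)) :
    Measurable fun x => totalDegree (unitDiskGraph x) (nodesIn a b A x) := by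
  classical
  unfold totalDegree
  exact Finset.measurable_sum _ fun v _ => Measurable.ite (measurableSet_mem_nodesIn a b A v)
    (measurable_comp_unitDiskGraph fun G => ((G.neighborSet v).ncard : ℝ)) measurable_const

theorem totalDegree_nonneg (G : SimpleGraph (Fin n)) (A : Set (Fin n)) : 0 ≤ totalDegree G A := by
  classical
  exact Finset.sum_nonneg fun v _ => by split_ifs <;> positivity

theorem totalDegree_le_mul {G : SimpleGraph (Fin n)} {A : Set (Fin n)} {d : ℝ}
    (h : ∀ v ∈ A, ((G.neighborSet v).ncard : ℝ) ≤ d) : totalDegree G A ≤ d * A.ncard := by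
  classical
  unfold totalDegree
  rw [ncard_eq_sum_ite, Finset.mul_sum]
  refine Finset.sum_le_sum fun v _ => ?_
  split_ifs with hv
  · simpa using h v hv
  · simp

theorem mul_le_totalDegree {G : SimpleGraph (Fin n)} {A : Set (Fin n)} {d : ℝ}
    (h : ∀ v ∈ A, d ≤ ((G.neighborSet v).ncard : ℝ)) : d * A.ncard ≤ totalDegree G A := by
  classical
  unfold totalDegree
  rw [ncard_eq_sum_ite, Finset.mul_sum]
  refine Finset.sum_le_sum fun v _ => ?_
  split_ifs with hv
  · simpa using h v hv
  · simp

theorem totalDegree_le_sq (G : SimpleGraph (Fin n)) (A : Set (Fin n)) :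
    totalDegree G A ≤ (n : ℝ) ^ 2 := by
  refine (totalDegree_le_mul fun v _ => ncard_le_natCast _).trans ?_
  have := ncard_le_natCast A
  have : (0 : ℝ) ≤ n := n.cast_nonneg
  nlinarith

theorem ncard_neighborSet_unitDiskGraph (x : Fin n → ℝ) (v : Fin n) :
    (((unitDiskGraph x).neighborSet v).ncard : ℝ) =
      {j | x j ∈ Ioo (x v - 1) (x v + 1)}.ncard - 1 := by
  have h : (unitDiskGraph x).neighborSet v = {j | x j ∈ Ioo (x v - 1) (x v + 1)} \ {v} := by
    ext j
    simp only [SimpleGraph.mem_neighborSet, unitDiskGraph, Set.mem_sdiff, mem_ofPred_eq, mem_Ioo,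
      mem_singleton_iff, abs_lt]
    constructor
    · rintro ⟨h1, h2, h3⟩
      exact ⟨⟨by linarith, by linarith⟩, fun h => h1 h.symm⟩
    · rintro ⟨⟨h2, h3⟩, h1⟩
      exact ⟨fun h => h1 h.symm, by linarith, by linarith⟩
  rw [h, eq_sub_iff_add_eq]
  exact_mod_cast Set.ncard_sdiff_singleton_add_one (by simp)

end GraphFunctionals

/-! ### Average total degree against average number of nodes -/

section Expectations

theorem avgDegree_nonneg {n : ℕ} {L : ℝ} (a b : ℝ) (A : SimpleGraph (Fin n) → Set (Fin n)) :
    0 ≤ avgDegree L n a b A :=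
  integral_nonneg fun _ => totalDegree_nonneg _ _

variable {L : ℝ} [hL : Fact (0 < L)] {n : ℕ}

/-- Average number of nodes of `A` with position in `[a, b]`. -/
noncomputable def avgCount (L : ℝ) (n : ℕ) (a b : ℝ)
    (A : SimpleGraph (Fin n) → Set (Fin n)) : ℝ :=
  ∫ x, ((nodesIn a b A x).ncard : ℝ) ∂(positionLaw L n)

theorem integrable_of_bound {f : (Fin n → ℝ) → ℝ} (hf : Measurable f) {K : ℝ}
    (h0 : ∀ x, 0 ≤ f x) (hK : ∀ x, f x ≤ K) : Integrable f (positionLaw L n) :=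
  Integrable.of_bound hf.aestronglyMeasurable K (Eventually.of_forall fun x => by
    rw [Real.norm_of_nonneg (h0 x)]; exact hK x)

theorem integrable_ncard {S : (Fin n → ℝ) → Set (Fin n)}
    (hS : ∀ v, MeasurableSet {x | v ∈ S x}) :
    Integrable (fun x => ((S x).ncard : ℝ)) (positionLaw L n) :=
  integrable_of_bound (measurable_ncard_nodes hS) (fun _ => Nat.cast_nonneg _)
    (fun _ => ncard_le_natCast _)

/-- The transfer principle used for all averages: a comparison valid on the good event `Ω` passes to
expectations at the price of a crude bound `K` times the probability of the bad event. -/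
theorem integral_le_integral_add {f g : (Fin n → ℝ) → ℝ}
    (hf : Integrable f (positionLaw L n)) (hg : Integrable g (positionLaw L n))
    {Ω : Set (Fin n → ℝ)} (hΩ : MeasurableSet Ω) {K : ℝ} (h : ∀ x ∈ Ω, f x ≤ g x)
    (hK : ∀ x, f x ≤ g x + K) :
    ∫ x, f x ∂(positionLaw L n) ≤
      ∫ x, g x ∂(positionLaw L n) + K * (positionLaw L n).real Ωᶜ := by
  have hi : Integrable (Ωᶜ.indicator fun _ => K) (positionLaw L n) :=
    (integrable_const K).indicator hΩ.compl
  calc _ ≤ ∫ x, (g x + Ωᶜ.indicator (fun _ => K) x) ∂(positionLaw L n) := by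
        refine integral_mono hf (hg.add hi) fun x => ?_
        by_cases hx : x ∈ Ω
        · simpa [hx] using h x hx
        · simpa [hx] using hK x
    _ = _ := by
        rw [integral_add hg hi, integral_indicator_const _ hΩ.compl, smul_eq_mul, mul_comm]

theorem integral_ncard_le_add {S : (Fin n → ℝ) → Set (Fin n)}
    (hS : ∀ v, MeasurableSet {x | v ∈ S x}) {g : (Fin n → ℝ) → ℝ}
    (hg : Integrable g (positionLaw L n)) (hg0 : ∀ x, 0 ≤ g x)
    {Ω : Set (Fin n → ℝ)} (hΩ : MeasurableSet Ω)
    (h : ∀ x ∈ Ω, ((S x).ncard : ℝ) ≤ g x) :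
    ∫ x, ((S x).ncard : ℝ) ∂(positionLaw L n) ≤
      ∫ x, g x ∂(positionLaw L n) + n * (positionLaw L n).real Ωᶜ :=
  integral_le_integral_add (integrable_ncard hS) hg hΩ h fun x => by
    linarith [hg0 x, ncard_le_natCast (S x)]

/-- In a regular sample degrees are at most `(2 + ε) n / L`, and at least `(2 - ε) n / L` when the
window of radius one stays inside `[0, L]`. The threshold on `n` is uniform in `A`, which lets all
sources of the flooding be treated together. -/
theorem avgDegree_bounds {ε : ℝ} (hε : 0 < ε) :
    ∀ᶠ n : ℕ in atTop, ∀ (A : SimpleGraph (Fin n) → Set (Fin n)) (a b : ℝ),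
      avgDegree L n a b A ≤ n / L * ((2 + ε) * avgCount L n a b A + ε) ∧
      (1 ≤ a → b ≤ L - 1 → n / L * ((2 - ε) * avgCount L n a b A - ε) ≤ avgDegree L n a b A) := by
  have hL0 := hL.out
  obtain ⟨Ω, hΩm, hΩ, hlim⟩ := exists_regular_event (L := L) (ε := ε / (2 * L)) (by positivity)
  -- The threshold makes both bad-event costs, `n² p` for the upper bound and `(2 n / L) n p` for
  -- the lower one, at most `ε n / L`.
  have ev1 : ∀ᶠ n : ℕ in atTop, (n : ℝ) ^ 2 * (positionLaw L n).real (Ω n)ᶜ < ε / L / (1 + 2 / L) :=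
    (tendsto_order.1 hlim).2 _ (by positivity)
  -- For such `n` the `-1` in the degree is absorbed by `n / L * (ε / 2)`.
  have ev2 : ∀ᶠ n : ℕ in atTop, 2 * L / ε ≤ (n : ℝ) :=
    tendsto_natCast_atTop_atTop.eventually_ge_atTop _
  filter_upwards [ev1, ev2, eventually_ge_atTop 1] with n h1 h2 hn A a b
  have hn' : (1 : ℝ) ≤ n := by exact_mod_cast hn
  set p := (positionLaw L n).real (Ω n)ᶜ with hp
  have hp0 : 0 ≤ p := measureReal_nonneg
  rw [lt_div_iff₀ (by positivity)] at h1
  have hsm : n ^ 2 * p * (1 + 2 / L) ≤ n / L * ε := by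
    refine h1.le.trans ?_
    calc ε / L = 1 / L * ε := by ring
      _ ≤ n / L * ε := by gcongr
  have hDm := measurable_totalDegree a b A
  have hD : Integrable (fun x => totalDegree (unitDiskGraph x) (nodesIn a b A x))
      (positionLaw L n) :=
    integrable_of_bound hDm (fun _ => totalDegree_nonneg _ _) (fun _ => totalDegree_le_sq _ _)
  have hN : Integrable (fun x => ((nodesIn a b A x).ncard : ℝ)) (positionLaw L n) :=
    integrable_ncard (measurableSet_mem_nodesIn a b A)
  have hsm1 : n ^ 2 * p ≤ n / L * ε := by
    refine le_trans ?_ hsm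
    have : 0 ≤ n ^ 2 * p * (2 / L) := by positivity
    linarith
  have hsm2 : 2 * n / L * n * p ≤ n / L * ε := by
    refine le_trans ?_ hsm
    have : 0 ≤ n ^ 2 * p := by positivity
    calc 2 * n / L * n * p = n ^ 2 * p * (2 / L) := by ring
      _ ≤ _ := by gcongr; linarith
  constructor
  · have key := integral_le_integral_add hD (hN.const_mul (n / L * (2 + ε))) (hΩm n)
      (K := (n : ℝ) ^ 2) (fun x hx => ?_) (fun x => ?_)
    · rw [integral_const_mul] at key
      have e : avgDegree L n a b A ≤ n / L * (2 + ε) * avgCount L n a b A + n ^ 2 * p := key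
      linarith
    · refine totalDegree_le_mul fun v hv => ?_
      rw [ncard_neighborSet_unitDiskGraph]
      have := (hΩ n x hx).ncard_le (x v - 1) (x v + 1) (by linarith)
      have e : n * (x v + 1 - (x v - 1)) / L + ε / (2 * L) * n = n / L * (2 + ε / 2) := by
        field_simp; ring
      rw [e] at this
      have : n / L * (2 + ε / 2) ≤ n / L * (2 + ε) := by gcongr; linarith
      linarith
    · have : 0 ≤ n / L * (2 + ε) * ((nodesIn a b A x).ncard : ℝ) := by positivity
      linarith [totalDegree_le_sq (unitDiskGraph x) (nodesIn a b A x)]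
  · intro ha hb
    have key := integral_le_integral_add (hN.const_mul (n / L * (2 - ε))) hD (hΩm n)
      (K := 2 * n / L * n) (fun x hx => ?_) (fun x => ?_)
    · rw [integral_const_mul] at key
      have e : n / L * (2 - ε) * avgCount L n a b A ≤ avgDegree L n a b A + 2 * n / L * n * p := key
      linarith
    · refine mul_le_totalDegree fun v hv => ?_
      rw [ncard_neighborSet_unitDiskGraph]
      have hv' : x v ∈ Icc a b := hv.2
      have := (hΩ n x hx).le_ncard (x v - 1) (x v + 1) (by linarith [hv'.1]) (by linarith)
        (by linarith [hv'.2])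
      have e : n * (x v + 1 - (x v - 1)) / L - ε / (2 * L) * n = n / L * (2 - ε / 2) := by
        field_simp; ring
      rw [e] at this
      have : 1 ≤ n / L * (ε / 2) := by
        rw [div_le_iff₀ hε] at h2
        rw [div_mul_div_comm, le_div_iff₀ (by positivity)]
        linarith
      linarith
    · have h3 := totalDegree_nonneg (unitDiskGraph x) (nodesIn a b A x)
      have h4 : n / L * (2 - ε) * ((nodesIn a b A x).ncard : ℝ) ≤ n / L * 2 * n := by
        have := ncard_le_natCast (nodesIn a b A x)
        calc _ ≤ n / L * 2 * ((nodesIn a b A x).ncard : ℝ) := by gcongr; linarith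
          _ ≤ _ := by gcongr
      have : n / L * 2 * n = 2 * n / L * n := by ring
      linarith

theorem avgDegree_mono {a b a' b' : ℝ} (ha : a' ≤ a) (hb : b ≤ b')
    (A : SimpleGraph (Fin n) → Set (Fin n)) : avgDegree L n a b A ≤ avgDegree L n a' b' A := by
  classical
  refine integral_mono
    (integrable_of_bound (measurable_totalDegree a b A) (fun _ => totalDegree_nonneg _ _)
      (fun _ => totalDegree_le_sq _ _))
    (integrable_of_bound (measurable_totalDegree a' b' A) (fun _ => totalDegree_nonneg _ _)
      (fun _ => totalDegree_le_sq _ _)) fun x => Finset.sum_le_sum fun v _ => ?_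
  by_cases h : v ∈ A (unitDiskGraph x) ∩ {v | x v ∈ Icc a b}
  · have h' : v ∈ A (unitDiskGraph x) ∩ {v | x v ∈ Icc a' b'} :=
      ⟨h.1, Icc_subset_Icc ha hb h.2⟩
    rw [if_pos h, if_pos h']
  · rw [if_neg h]
    split_ifs <;> positivity

theorem avgCount_le_add (a b c : ℝ) (A : SimpleGraph (Fin n) → Set (Fin n)) :
    avgCount L n a c A ≤ avgCount L n a b A + avgCount L n b c A := by
  have hm := fun a b => integrable_ncard (L := L) (measurableSet_mem_nodesIn a b A)
  unfold avgCount
  rw [← integral_add (hm a b) (hm b c)]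
  refine integral_mono (hm a c) ((hm a b).add (hm b c)) fun x => ?_
  have : nodesIn a c A x ⊆ nodesIn a b A x ∪ nodesIn b c A x := by
    rintro v ⟨h1, h2, h3⟩
    rcases le_total (x v) b with h | h
    · exact Or.inl ⟨h1, h2, h⟩
    · exact Or.inr ⟨h1, h, h3⟩
  have := (Set.ncard_le_ncard this).trans (Set.ncard_union_le _ _)
  change _ ≤ ((nodesIn a b A x).ncard : ℝ) + (nodesIn b c A x).ncard
  exact_mod_cast this

end Expectations

/-! ### Multipoint relays in one dimension -/

section Relays

variable {n : ℕ} {x : Fin n → ℝ} {u v w y : Fin n} {K : Set (Fin n)}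

theorem unitDiskGraph_adj : (unitDiskGraph x).Adj u v ↔ u ≠ v ∧ |x u - x v| < 1 := Iff.rfl

/-- Since the graph is unchanged, so are the selected relays, and every statement about the right
side yields its mirror image. -/
theorem unitDiskGraph_reflect (L : ℝ) (x : Fin n → ℝ) :
    (unitDiskGraph fun i => L - x i) = unitDiskGraph x := by
  ext u v
  rw [unitDiskGraph_adj, unitDiskGraph_adj, abs_sub_comm (x u)]
  simp

theorem IsMPRSet.adj (hK : IsMPRSet (unitDiskGraph x) v K) (hu : u ∈ K) :
    (unitDiskGraph x).Adj v u := hK.prop.1 hu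

theorem IsMPRSet.abs_sub_lt (hK : IsMPRSet (unitDiskGraph x) v K) (hu : u ∈ K) :
    |x v - x u| < 1 := (hK.adj hu).2

theorem IsMPRSet.not_covers_diff (hK : IsMPRSet (unitDiskGraph x) v K) (hu : u ∈ K) :
    ¬ CoversTwoHop (unitDiskGraph x) v (K \ {u}) := fun h =>
  (hK.le_of_le h (fun _ hz => hz.1) hu).2 rfl

/-- A relay has a private two-hop node. -/
theorem IsMPRSet.exists_private (hK : IsMPRSet (unitDiskGraph x) v K) (hu : u ∈ K) :
    ∃ w, w ≠ v ∧ ¬ (unitDiskGraph x).Adj v w ∧ (unitDiskGraph x).Adj u w ∧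
      ∀ u' ∈ K, (unitDiskGraph x).Adj u' w → u' = u := by
  by_contra! hcon
  refine hK.not_covers_diff hu ⟨fun z hz => hK.prop.1 hz.1, fun w hwv hvw hex => ?_⟩
  obtain ⟨u', hu', hadj⟩ := hK.prop.2 w hwv hvw hex
  by_cases h : u' = u
  · subst h
    obtain ⟨z, hz, hzw, hne⟩ := hcon w hwv hvw hadj
    exact ⟨z, ⟨hz, hne⟩, hzw⟩
  · exact ⟨u', ⟨hu', h⟩, hadj⟩

/-- A node within distance one of `u` lies to the right of `x v - 1`; if it were also to the left of
`x v + 1` it would be a neighbour of `v`. So the private two-hop node of a right relay is beyond `x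
v + 1`. -/
theorem IsMPRSet.exists_private_right (hK : IsMPRSet (unitDiskGraph x) v K) (hu : u ∈ K)
    (hvu : x v < x u) :
    ∃ w, x v + 1 ≤ x w ∧ x w < x u + 1 ∧ ∀ u' ∈ K, (unitDiskGraph x).Adj u' w → u' = u := by
  obtain ⟨w, hwv, hvw, huw, hpriv⟩ := hK.exists_private hu
  refine ⟨w, ?_, ?_, hpriv⟩
  · by_contra! hlt
    refine hvw ⟨hwv.symm, ?_⟩
    have := abs_lt.1 huw.2
    rw [abs_lt]
    constructor <;> linarith
  · have := abs_lt.1 huw.2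
    linarith

/-- The farther of two right relays also reaches the private node of the nearer one, which lies
between `x v + 1` and `x u + 1`. -/
theorem IsMPRSet.right_unique (hK : IsMPRSet (unitDiskGraph x) v K) {u' : Fin n} (hu : u ∈ K)
    (hu' : u' ∈ K) (hvu : x v < x u) (hvu' : x v < x u') : u = u' := by
  wlog hle : x u ≤ x u' generalizing u u'
  · exact (this hu' hu hvu' hvu (le_of_not_ge hle)).symm
  obtain ⟨w, hw1, hw2, hpriv⟩ := hK.exists_private_right hu hvu
  have h := abs_lt.1 (hK.abs_sub_lt hu')
  refine (hpriv u' hu' ⟨fun h' => ?_, ?_⟩).symm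
  · rw [h'] at h; linarith
  · rw [abs_lt]
    constructor <;> linarith

theorem IsMPRSet.exists_right_of_twoHop (hK : IsMPRSet (unitDiskGraph x) v K)
    (hvw : x v + 1 ≤ x w) (hvu : (unitDiskGraph x).Adj v u) (huw : (unitDiskGraph x).Adj u w) :
    ∃ u' ∈ K, x v < x u' ∧ x w - 1 < x u' := by
  obtain ⟨u', hu', hadj⟩ := hK.prop.2 w (fun h => by rw [h] at hvw; linarith)
    (fun h => by have := abs_lt.1 h.2; linarith) ⟨u, hvu, huw⟩
  have := abs_lt.1 hadj.2
  exact ⟨u', hu', by linarith, by linarith⟩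

/-- Distinct positions in `[0, L]` that leave no gap of length `η`. -/
structure IsDenseSample (L η : ℝ) (x : Fin n → ℝ) : Prop where
  injective : Function.Injective x
  mem_Icc : ∀ j, x j ∈ Icc 0 L
  exists_mem : ∀ c d, 0 ≤ c → d ≤ L → η ≤ d - c → ∃ j, x j ∈ Ioo c d

theorem IsRegularSample.isDenseSample {L ε η : ℝ} (h : IsRegularSample L ε x) (hL : 0 < L)
    (hε : ε * L < η) (hε0 : 0 < ε) (hn : 0 < n) : IsDenseSample L η x := by
  have hn' : (0 : ℝ) < n := by exact_mod_cast hn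
  refine ⟨h.injective, h.mem_Icc, fun c d hc hd hcd => ?_⟩
  have h1 := h.le_ncard c d hc (by nlinarith) hd
  have h2 : 0 < n * (d - c) / L - ε * n := by
    have : ε < (d - c) / L := by rw [lt_div_iff₀ hL]; linarith
    have : n * ε < n * ((d - c) / L) := by gcongr
    have e : n * (d - c) / L = n * ((d - c) / L) := by ring
    linarith
  have h3 : 0 < {j | x j ∈ Ioo c d}.ncard := by exact_mod_cast h2.trans_le h1
  exact (Set.ncard_pos (Set.toFinite _)).1 h3

theorem IsDenseSample.reflect {L η : ℝ} (h : IsDenseSample L η x) :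
    IsDenseSample L η fun i => L - x i := by
  refine ⟨fun i j hij => h.injective (by simpa using hij), fun j => ?_, fun c d hc hd hcd => ?_⟩
  · have := h.mem_Icc j
    exact ⟨by linarith [this.2], by linarith [this.1]⟩
  · obtain ⟨j, hj⟩ := h.exists_mem (L - d) (L - c) (by linarith) (by linarith) (by linarith)
    exact ⟨j, by linarith [hj.2], by linarith [hj.1]⟩

/-- In a dense sample the relay of `v` to the right lies almost at distance one. -/
theorem IsMPRSet.exists_right {L η : ℝ} (hx : IsDenseSample L η x)
    (hK : IsMPRSet (unitDiskGraph x) v K) (hη0 : 0 < η) (hη : 3 * η ≤ 1) (hv : x v ≤ L - 2) :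
    ∃ u ∈ K, x v < x u ∧ x v + 1 - 3 * η < x u ∧ x u < x v + 1 := by
  have hv0 := (hx.mem_Icc v).1
  -- The margins are such that `w` is at distance at least one from `v` (here `3 η ≤ 1` enters) and
  -- less than one from `j`. A relay covering `w` must lie beyond `x w - 1 > x v + 1 - 3 η`.
  obtain ⟨j, hj1, hj2⟩ := hx.exists_mem (x v + 1 - η) (x v + 1) (by linarith) (by linarith)
    (by linarith)
  obtain ⟨w, hw1, hw2⟩ := hx.exists_mem (x v + 2 - 3 * η) (x v + 2 - 2 * η) (by linarith)
    (by linarith) (by linarith)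
  obtain ⟨u, hu, h1, h2⟩ := hK.exists_right_of_twoHop (w := w) (u := j) (by linarith)
    ⟨fun h => by rw [h] at hj1; linarith, by rw [abs_lt]; constructor <;> linarith⟩
    ⟨fun h => by rw [h] at hj2; linarith, by rw [abs_lt]; constructor <;> linarith⟩
  have := abs_lt.1 (hK.abs_sub_lt hu)
  exact ⟨u, hu, h1, by linarith, by linarith⟩

theorem IsMPRSet.lt_of_right {L η : ℝ} (hx : IsDenseSample L η x)
    (hK : IsMPRSet (unitDiskGraph x) v K) (hη0 : 0 < η) (hη : 3 * η ≤ 1) (hv : x v ≤ L - 2)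
    (hu : u ∈ K) (hvu : x v < x u) : x v + 1 - 3 * η < x u := by
  obtain ⟨u', hu', h1, h2, _⟩ := hK.exists_right hx hη0 hη hv
  rwa [hK.right_unique hu hu' hvu h1]

end Relays

/-! ### The MPR CDS -/

section MPRCDS

variable {n : ℕ}

/-- Nodes that enter the MPR CDS as relays of a node to their left. -/
def rightRelays (K : SimpleGraph (Fin n) → Fin n → Set (Fin n)) (x : Fin n → ℝ) : Set (Fin n) :=
  {v | ∃ y, ((unitDiskGraph x).Adj v y ∧ (∀ u, (unitDiskGraph x).Adj v u → y ≤ u) ∧ y < v ∧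
    v ∈ K (unitDiskGraph x) y) ∧ x y < x v}

/-- Nodes of smaller id than their neighbours. -/
def localMinima (G : SimpleGraph (Fin n)) : Set (Fin n) := {v | ∀ u, G.Adj v u → v < u}

theorem measurableSet_mem_rightRelays (K : SimpleGraph (Fin n) → Fin n → Set (Fin n))
    (v : Fin n) : MeasurableSet {x | v ∈ rightRelays K x} := by
  let A (y : Fin n) (G : SimpleGraph (Fin n)) : Set (Fin n) :=
    {v | G.Adj v y ∧ (∀ u, G.Adj v u → y ≤ u) ∧ y < v ∧ v ∈ K G y}
  have : {x : Fin n → ℝ | v ∈ rightRelays K x} =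
      ⋃ y, {x | v ∈ A y (unitDiskGraph x)} ∩ {x | x y < x v} := by
    ext x; simp [rightRelays, A]
  rw [this]
  exact MeasurableSet.iUnion fun y => (measurableSet_mem_unitDiskGraph (A y) v).inter
    (measurableSet_lt (measurable_pi_apply y) (measurable_pi_apply v))

variable {x : Fin n → ℝ} {K : SimpleGraph (Fin n) → Fin n → Set (Fin n)}

theorem mem_rightRelays_reflect (L : ℝ) {v : Fin n} :
    v ∈ rightRelays K (fun i => L - x i) ↔ ∃ y, ((unitDiskGraph x).Adj v y ∧
      (∀ u, (unitDiskGraph x).Adj v u → y ≤ u) ∧ y < v ∧ v ∈ K (unitDiskGraph x) y) ∧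
      x v < x y := by
  simp only [rightRelays, unitDiskGraph_reflect, mem_ofPred_eq, sub_lt_sub_iff_left]

theorem mprCDS_eq_union (hx : Function.Injective x) (L : ℝ) :
    mprCDS (unitDiskGraph x) (K (unitDiskGraph x)) = localMinima (unitDiskGraph x) ∪
      (rightRelays K x ∪ rightRelays K fun i => L - x i) := by
  ext v
  simp only [mem_union, mem_rightRelays_reflect]
  constructor
  · rintro (h | ⟨y, h1, h2, h3, h4⟩)
    · exact Or.inl h
    · rcases lt_or_gt_of_ne (fun h => h3.ne (hx h) : x y ≠ x v) with h | h
      · exact Or.inr (Or.inl ⟨y, ⟨h1, h2, h3, h4⟩, h⟩)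
      · exact Or.inr (Or.inr ⟨y, ⟨h1, h2, h3, h4⟩, h⟩)
  · rintro (h | ⟨y, h, -⟩ | ⟨y, h, -⟩)
    · exact Or.inl h
    · exact Or.inr ⟨y, h⟩
    · exact Or.inr ⟨y, h⟩

theorem disjoint_localMinima_rightRelays (L : ℝ) :
    Disjoint (localMinima (unitDiskGraph x))
      (rightRelays K x ∪ rightRelays K fun i => L - x i) := by
  rw [Set.disjoint_left]
  intro v hv hv'
  simp only [mem_union, mem_rightRelays_reflect] at hv'
  rcases hv' with ⟨y, ⟨h1, -, h3, -⟩, -⟩ | ⟨y, ⟨h1, -, h3, -⟩, -⟩ <;> exact (hv y h1).not_gt h3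

/-- The neighbour of smallest id is unique, so it cannot lie on both sides of `v`. -/
theorem disjoint_rightRelays_reflect (L : ℝ) :
    Disjoint (rightRelays K x) (rightRelays K fun i => L - x i) := by
  rw [Set.disjoint_left]
  intro v hv hv'
  rw [mem_rightRelays_reflect] at hv'
  obtain ⟨y, ⟨h1, h2, -, -⟩, h3⟩ := hv
  obtain ⟨z, ⟨h4, h5, -, -⟩, h6⟩ := hv'
  have := le_antisymm (h2 z h4) (h5 y h1)
  subst this
  exact h3.not_gt h6

theorem mem_localMinima_iff {v : Fin n} :
    v ∈ localMinima (unitDiskGraph x) ↔ ∀ j < v, x j ∉ Ioo (x v - 1) (x v + 1) := by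
  constructor
  · intro h j hj hx
    refine (h j ⟨hj.ne', ?_⟩).not_gt hj
    rw [abs_lt]
    constructor <;> linarith [hx.1, hx.2]
  · intro h u hu
    by_contra hcon
    have := abs_lt.1 hu.2
    exact h u (lt_of_le_of_ne (not_lt.1 hcon) hu.1.symm) ⟨by linarith, by linarith⟩

/-- A family of nodes that injects into another one because its members are the right relays of
distinct nodes. -/
theorem ncard_rightRelays_le (hK : ∀ v, IsMPRSet (unitDiskGraph x) v (K (unitDiskGraph x) v))
    {S T : Set (Fin n)} (hS : S ⊆ rightRelays K x)
    (h : ∀ v ∈ S, ∀ y, (∀ u, (unitDiskGraph x).Adj v u → y ≤ u) → y < v →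
      v ∈ K (unitDiskGraph x) y → x y < x v → y ∈ T) : S.ncard ≤ T.ncard := by
  classical
  have hex : ∀ v : Fin n, ∃ y, v ∈ S → ((∀ u, (unitDiskGraph x).Adj v u → y ≤ u) ∧ y < v ∧
      v ∈ K (unitDiskGraph x) y ∧ x y < x v) := by
    intro v
    by_cases hv : v ∈ S
    · obtain ⟨y, ⟨-, h2, h3, h4⟩, h5⟩ := hS hv
      exact ⟨y, fun _ => ⟨h2, h3, h4, h5⟩⟩
    · exact ⟨v, fun h => absurd h hv⟩
  choose f hf using hex
  refine Set.ncard_le_ncard_of_injOn f (fun v hv => ?_) (fun v hv v' hv' heq => ?_)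
  · obtain ⟨h1, h2, h3, h4⟩ := hf v hv
    exact h v hv _ h1 h2 h3 h4
  · obtain ⟨-, -, h3, h4⟩ := hf v hv
    obtain ⟨-, -, h3', h4'⟩ := hf v' hv'
    rw [← heq] at h3' h4'
    exact (hK (f v)).right_unique h3 h3' h4 h4'

/-- A bound valid up to the ends, without density. The interval `(x y, x y + 1)` is within reach of
the relay `v`, so `y` has no smaller id there; the private node beyond `x y + 1` forces this unit
window to fit into `[0, L]`. -/
theorem ncard_rightRelays_le_lone {L c d : ℝ} (hmem : ∀ j, x j ∈ Icc 0 L)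
    (hK : ∀ v, IsMPRSet (unitDiskGraph x) v (K (unitDiskGraph x) v)) :
    (rightRelays K x ∩ {v | x v ∈ Icc c d}).ncard ≤
      {y | x ∈ loneEvent (Icc (c - 1) d ∩ Icc 0 (L - 1)) (fun p => Ioo p (p + 1)) y}.ncard := by
  refine ncard_rightRelays_le hK inter_subset_left fun v hv y hmin hyv hvK hlt => ?_
  obtain ⟨w, hw, -⟩ := (hK y).exists_private_right hvK hlt
  have h1 := abs_lt.1 ((hK y).abs_sub_lt hvK)
  have h2 : x v ∈ Icc c d := hv.2
  refine ⟨⟨⟨by linarith [h2.1], by linarith [h2.2]⟩, (hmem y).1, by linarith [(hmem w).2]⟩,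
    fun j hj hxj => ?_⟩
  refine (hmin j ⟨fun h => ?_, ?_⟩).not_gt hj
  · exact (h ▸ hyv).not_gt hj
  · rw [abs_lt]
    constructor <;> linarith [hxj.1, hxj.2]

/-- Since `v` lies beyond `x y + 1 - 3 η`, its neighbourhood contains `(x y, x y + 2 - 3 η)`, and
`y` has the smallest id in it. -/
theorem ncard_rightRelays_le_lone_of_dense {L η a b : ℝ} (hx : IsDenseSample L η x)
    (hη0 : 0 < η) (hη : 3 * η ≤ 1) (hb : b ≤ L - 2)
    (hK : ∀ v, IsMPRSet (unitDiskGraph x) v (K (unitDiskGraph x) v)) :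
    (rightRelays K x ∩ {v | x v ∈ Icc a b}).ncard ≤
      {y | x ∈ loneEvent (Icc (a - 1) (b - 1 + 3 * η))
        (fun p => Ioo p (p + (2 - 3 * η))) y}.ncard := by
  refine ncard_rightRelays_le hK inter_subset_left fun v hv y hmin hyv hvK hlt => ?_
  have h1 := abs_lt.1 ((hK y).abs_sub_lt hvK)
  have h2 : x v ∈ Icc a b := hv.2
  have h3 := (hK y).lt_of_right hx hη0 hη (by linarith [h2.2]) hvK hlt
  refine ⟨⟨by linarith [h2.1], by linarith [h2.2]⟩, fun j hj hxj => ?_⟩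
  refine (hmin j ⟨fun h => ?_, ?_⟩).not_gt hj
  · exact (h ▸ hyv).not_gt hj
  · rw [abs_lt]
    constructor <;> linarith [hxj.1, hxj.2]

/-- The right relay of `y` has its whole neighbourhood inside `(x y - 3 η, x y + 2)`, so `y` is its
neighbour of smallest id. This also recovers `y` from the relay, whence injectivity. -/
theorem ncard_lone_le_rightRelays_of_dense {L η a b : ℝ} (hx : IsDenseSample L η x)
    (hη0 : 0 < η) (hη : 3 * η ≤ 1) (hb : b ≤ L - 2)
    (hK : ∀ v, IsMPRSet (unitDiskGraph x) v (K (unitDiskGraph x) v)) :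
    {y | x ∈ loneEvent (Icc (a - 1 + 3 * η) (b - 1))
        (fun p => Ioo (p - 3 * η) (p + 2)) y}.ncard ≤
      (rightRelays K x ∩ {v | x v ∈ Icc a b}).ncard := by
  classical
  set S := {y | x ∈ loneEvent (Icc (a - 1 + 3 * η) (b - 1))
        (fun p => Ioo (p - 3 * η) (p + 2)) y}
  have hex : ∀ y : Fin n, ∃ v, y ∈ S → ((unitDiskGraph x).Adj v y ∧
      (∀ u, (unitDiskGraph x).Adj v u → y ≤ u) ∧ y < v ∧
      v ∈ K (unitDiskGraph x) y) ∧ x y < x v ∧ x v ∈ Icc a b := by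
    intro y
    by_cases hy : y ∈ S
    · obtain ⟨⟨hya, hyb⟩, hlone⟩ := hy
      obtain ⟨v, hv, h1, h2, h3⟩ := (hK y).exists_right hx hη0 hη (by linarith)
      have hyv : y ≤ v := not_lt.1 fun h => hlone v h ⟨by linarith, by linarith⟩
      refine ⟨v, fun _ => ⟨⟨((hK y).adj hv).symm, fun u hu => not_lt.1 fun h => ?_,
        hyv.lt_of_ne fun h => ?_, hv⟩, h1, by linarith, by linarith⟩⟩
      · have := abs_lt.1 hu.2
        exact hlone u h ⟨by linarith, by linarith⟩
      · rw [h] at h1; exact lt_irrefl _ h1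
    · exact ⟨y, fun h => absurd h hy⟩
  choose f hf using hex
  refine Set.ncard_le_ncard_of_injOn f (fun y hy => ?_) (fun y hy y' hy' heq => ?_)
  · obtain ⟨h1, h2, h3⟩ := hf y hy
    exact ⟨⟨y, h1, h2⟩, h3⟩
  · obtain ⟨⟨h1, h2, -⟩, -⟩ := hf y hy
    obtain ⟨⟨h1', h2', -⟩, -⟩ := hf y' hy'
    rw [← heq] at h1' h2'
    exact le_antisymm (h2 y' h1') (h2' y h1)

end MPRCDS

/-! ### Average number of nodes of the MPR CDS -/

section Averages

variable {L : ℝ} [hL : Fact (0 < L)] {n : ℕ}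

theorem measurePreserving_reflect (n : ℕ) :
    MeasurePreserving (fun (x : Fin n → ℝ) i => L - x i) (positionLaw L n) (positionLaw L n) := by
  have h0 : MeasurePreserving (fun y : ℝ => L - y) (cond volume (Icc 0 L))
      (cond volume (Icc 0 L)) := by
    refine ⟨by fun_prop, ?_⟩
    ext S hS
    rw [Measure.map_apply (by fun_prop) hS, cond_apply measurableSet_Icc,
      cond_apply measurableSet_Icc]
    congr 1
    have h1 : Icc 0 L ∩ (fun y => L - y) ⁻¹' S = (fun y => L - y) ⁻¹' (Icc 0 L ∩ S) := by
      ext y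
      simp only [mem_inter_iff, mem_Icc, mem_preimage, sub_nonneg, sub_le_self_iff]
      tauto
    rw [h1]
    exact (Measure.measurePreserving_sub_left volume L).measure_preimage
      (measurableSet_Icc.inter hS).nullMeasurableSet
  exact measurePreserving_pi (fun _ => cond volume (Icc 0 L)) (fun _ => cond volume (Icc 0 L))
    fun _ => h0

theorem integral_reflect {f : (Fin n → ℝ) → ℝ} (hf : Measurable f) :
    ∫ x, f (fun i => L - x i) ∂(positionLaw L n) = ∫ x, f x ∂(positionLaw L n) := by
  have h := measurePreserving_reflect (L := L) n
  have := integral_map (μ := positionLaw L n) h.measurable.aemeasurable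
    (f := f) hf.aestronglyMeasurable
  rw [h.map_eq] at this
  exact this.symm

theorem integral_ncard_setOf {E : Fin n → Set (Fin n → ℝ)} (hE : ∀ v, MeasurableSet (E v)) :
    ∫ x, ({v | x ∈ E v}.ncard : ℝ) ∂(positionLaw L n) = ∑ v, (positionLaw L n).real (E v) := by
  classical
  have h : ∀ v ∈ Finset.univ, Integrable (fun x => (E v).indicator (1 : (Fin n → ℝ) → ℝ) x)
      (positionLaw L n) :=
    fun v _ => (integrable_const (1 : ℝ)).indicator (hE v)
  calc _ = ∫ x, ∑ v, (E v).indicator (1 : (Fin n → ℝ) → ℝ) x ∂(positionLaw L n) := by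
        refine integral_congr_ae (Eventually.of_forall fun x => ?_)
        simp only [ncard_eq_sum_ite, Set.indicator_apply, mem_ofPred_eq, Pi.one_apply]
    _ = _ := by
        rw [integral_finsetSum _ h]
        exact Finset.sum_congr rfl fun v _ => integral_indicator_one (hE v)

/-- Up to an event of probability `o(n⁻²)` the sample is dense. -/
theorem exists_dense_event {η : ℝ} (hη : 0 < η) :
    ∃ Ω : ∀ n : ℕ, Set (Fin n → ℝ), (∀ n, MeasurableSet (Ω n)) ∧
      (∀ n, 0 < n → ∀ x ∈ Ω n, IsDenseSample L η x) ∧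
      Tendsto (fun n : ℕ => (n : ℝ) * (positionLaw L n).real (Ω n)ᶜ) atTop (nhds 0) ∧
      Tendsto (fun n : ℕ => (n : ℝ) ^ 2 * (positionLaw L n).real (Ω n)ᶜ) atTop (nhds 0) := by
  have hL0 := hL.out
  obtain ⟨Ω, h1, h2, h3⟩ := exists_regular_event (L := L) (ε := η / (2 * L)) (by positivity)
  refine ⟨Ω, h1, fun n hn x hx => (h2 n x hx).isDenseSample hL0 ?_ (by positivity) hn, ?_, h3⟩
  · field_simp; norm_num
  · refine squeeze_zero (fun n => by positivity) (fun n => ?_) h3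
    gcongr
    rcases Nat.eq_zero_or_pos n with rfl | hn
    · simp
    · have : (1 : ℝ) ≤ n := by exact_mod_cast hn
      nlinarith

theorem measurableSet_mem_Ioo {β : Type*} [MeasurableSpace β] {f g h : β → ℝ} (hf : Measurable f)
    (hg : Measurable g) (hh : Measurable h) : MeasurableSet {w | h w ∈ Ioo (f w) (g w)} :=
  (measurableSet_lt hf hh).inter (measurableSet_lt hh hg)

theorem sum_loneEvent_le {B : Set ℝ} (hB : MeasurableSet B) {J : ℝ → Set ℝ}
    (hJ : MeasurableSet {w : ℝ × ℝ | w.2 ∈ J w.1}) {b c : ℝ} (hc0 : 0 < c) (hc : c ≤ L)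
    (hBb : (cond volume (Icc 0 L)).real B ≤ b / L)
    (h : ∀ p ∈ B, c / L ≤ (cond volume (Icc 0 L)).real (J p)) :
    ∑ i : Fin n, (positionLaw L n).real (loneEvent B J i) ≤ b / c := by
  have hL0 := hL.out
  refine (sum_measureReal_loneEvent_le hB hJ (by positivity : 0 < c / L)
    ((div_le_one hL0).2 hc) h).trans ?_
  calc _ ≤ b / L / (c / L) := by gcongr
    _ = b / c := by field_simp

theorem tendsto_one_sub_pow_div {c : ℝ} (hc0 : 0 < c) (hc : c ≤ L) (b : ℝ) :
    Tendsto (fun n : ℕ => b / L * ((1 - (1 - c / L) ^ n) / (c / L))) atTop (nhds (b / c)) := by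
  have hL0 := hL.out
  have h1 : c / L ≤ 1 := (div_le_one hL0).2 hc
  have h2 : 0 < c / L := by positivity
  have := ((tendsto_pow_atTop_nhds_zero_of_lt_one (sub_nonneg.2 h1) (by linarith)).const_sub
    1).div_const (c / L) |>.const_mul (b / L)
  convert this using 2
  field_simp
  simp

theorem eventually_le_sum_loneEvent {B : Set ℝ} (hB : MeasurableSet B) {J : ℝ → Set ℝ}
    (hJ : MeasurableSet {w : ℝ × ℝ | w.2 ∈ J w.1}) {b c : ℝ} (hc0 : 0 < c) (hc : c ≤ L)
    (hBb : b / L ≤ (cond volume (Icc 0 L)).real B)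
    (h : ∀ p ∈ B, (cond volume (Icc 0 L)).real (J p) ≤ c / L) {δ : ℝ} (hδ : 0 < δ) :
    ∀ᶠ n : ℕ in atTop, b / c - δ ≤ ∑ i : Fin n, (positionLaw L n).real (loneEvent B J i) := by
  have hL0 := hL.out
  have h1 : c / L ≤ 1 := (div_le_one hL0).2 hc
  filter_upwards [(tendsto_order.1 (tendsto_one_sub_pow_div hc0 hc b)).1 _ (sub_lt_self _ hδ)]
    with n hn
  refine hn.le.trans (le_trans ?_ (le_sum_measureReal_loneEvent hB hJ (by positivity) h1 h))
  gcongr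
  have : (1 - c / L) ^ n ≤ 1 := pow_le_one₀ (sub_nonneg.2 h1)
    (sub_le_self _ (by positivity))
  have : 0 ≤ 1 - (1 - c / L) ^ n := sub_nonneg.2 this
  positivity

theorem sub_div_le_measureReal_Icc {c d : ℝ} (hc : 0 ≤ c) (hd : d ≤ L) :
    (d - c) / L ≤ (cond volume (Icc 0 L)).real (Icc c d) := by
  rcases le_total c d with h | h
  · exact le_measureReal_cond_Icc hL.out h hc hd Ioo_subset_Icc_self
  · exact (div_nonpos_of_nonpos_of_nonneg (by linarith) hL.out.le).trans measureReal_nonneg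

/-! ### Densities of local minima and of relays -/

section MPR

theorem measurableSet_mem_rightRelays_inter (K : SimpleGraph (Fin n) → Fin n → Set (Fin n))
    (c d : ℝ) (v : Fin n) :
    MeasurableSet {x | v ∈ rightRelays K x ∩ {v | x v ∈ Icc c d}} :=
  (measurableSet_mem_rightRelays K v).inter (measurable_pi_apply v measurableSet_Icc)

theorem integrable_ncard_rightRelays (K : SimpleGraph (Fin n) → Fin n → Set (Fin n)) (c d : ℝ) :
    Integrable (fun x => ((rightRelays K x ∩ {v | x v ∈ Icc c d}).ncard : ℝ))
      (positionLaw L n) :=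
  integrable_ncard (measurableSet_mem_rightRelays_inter K c d)

theorem integral_ncard_rightRelays_reflect (K : SimpleGraph (Fin n) → Fin n → Set (Fin n))
    (c d : ℝ) :
    ∫ x, (((rightRelays K fun i => L - x i) ∩ {v | x v ∈ Icc c d}).ncard : ℝ)
      ∂(positionLaw L n) =
    ∫ x, ((rightRelays K x ∩ {v | x v ∈ Icc (L - d) (L - c)}).ncard : ℝ) ∂(positionLaw L n) := by
  rw [← integral_reflect (measurable_ncard_nodes
    (measurableSet_mem_rightRelays_inter K (L - d) (L - c)))]
  refine integral_congr_ae (Eventually.of_forall fun x => ?_)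
  have : {v | x v ∈ Icc c d} = {v | L - x v ∈ Icc (L - d) (L - c)} := by
    ext v
    simp only [mem_ofPred_eq, mem_Icc]
    constructor <;> rintro ⟨h1, h2⟩ <;> constructor <;> linarith
  simp only [this]

theorem integrable_ncard_rightRelays_reflect (K : SimpleGraph (Fin n) → Fin n → Set (Fin n))
    (c d : ℝ) :
    Integrable (fun x => (((rightRelays K fun i => L - x i) ∩ {v | x v ∈ Icc c d}).ncard : ℝ))
      (positionLaw L n) :=
  integrable_ncard fun v => ((measurePreserving_reflect n).measurable
    (measurableSet_mem_rightRelays K v)).inter (measurable_pi_apply v measurableSet_Icc)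

theorem integrable_ncard_lone {B : Set ℝ} (hB : MeasurableSet B) {J : ℝ → Set ℝ}
    (hJ : MeasurableSet {w : ℝ × ℝ | w.2 ∈ J w.1}) :
    Integrable (fun x => ({v : Fin n | x ∈ loneEvent B J v}.ncard : ℝ)) (positionLaw L n) :=
  integrable_ncard fun v => measurableSet_loneEvent hB hJ v

variable {M : SelectionRule}

/-- The relays of `[a, b]` inject into the nodes of an interval of length `b - a + 3 η` with an
empty window of length `2 - 3 η`; the ratio tends to `(b - a) / 2` with `η`. -/
theorem eventually_integral_rightRelays_le (hM : IsMPRRule M) {a b : ℝ} (ha : 1 ≤ a) (hab : a ≤ b)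
    (hb : b ≤ L - 2) {δ : ℝ} (hδ : 0 < δ) :
    ∀ᶠ n : ℕ in atTop,
      ∫ x, ((rightRelays (M n) x ∩ {v | x v ∈ Icc a b}).ncard : ℝ) ∂(positionLaw L n) ≤
        (b - a) / 2 + δ := by
  have hL0 := hL.out
  obtain ⟨η, hη0, hη1, hη2⟩ : ∃ η : ℝ, 0 < η ∧ 3 * η ≤ 1 ∧
      (b - a + 3 * η) / (2 - 3 * η) < (b - a) / 2 + δ / 2 := by
    have hc : ContinuousAt (fun η : ℝ => (b - a + 3 * η) / (2 - 3 * η)) 0 :=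
      ContinuousAt.div (by fun_prop) (by fun_prop) (by norm_num)
    have h1 : ∀ᶠ η in nhdsWithin (0 : ℝ) (Ioi 0),
        (b - a + 3 * η) / (2 - 3 * η) < (b - a) / 2 + δ / 2 :=
      nhdsWithin_le_nhds (hc.eventually_lt continuousAt_const (by simp; linarith))
    obtain ⟨η, h2, h3⟩ := (h1.and (Ioo_mem_nhdsGT (by norm_num : (0 : ℝ) < 1 / 3))).exists
    exact ⟨η, h3.1, by linarith [h3.2], h2⟩
  obtain ⟨Ω, hΩm, hΩ, hlim, -⟩ := exists_dense_event (L := L) hη0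
  filter_upwards [(tendsto_order.1 hlim).2 (δ / 2) (by positivity), eventually_gt_atTop 0]
    with n hn hn0
  have hB : MeasurableSet (Icc (a - 1) (b - 1 + 3 * η)) := measurableSet_Icc
  have hJ : MeasurableSet {w : ℝ × ℝ | w.2 ∈ Ioo w.1 (w.1 + (2 - 3 * η))} :=
    measurableSet_mem_Ioo (by fun_prop) (by fun_prop) (by fun_prop)
  have h1 := integral_ncard_le_add
    (measurableSet_mem_rightRelays_inter (M n) a b)
    (integrable_ncard_lone (L := L) hB hJ) (fun _ => Nat.cast_nonneg _) (hΩm n)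
    (fun x hx => by
      exact_mod_cast ncard_rightRelays_le_lone_of_dense (hΩ n hn0 x hx) hη0 hη1 hb (hM n x))
  rw [integral_ncard_setOf fun v => measurableSet_loneEvent hB hJ v] at h1
  have h2 := sum_loneEvent_le (L := L) (n := n) hB hJ (b := b - a + 3 * η) (c := 2 - 3 * η)
    (by linarith) (by linarith)
    ((measureReal_cond_Icc_le hL0 (by linarith) subset_rfl).trans_eq (by ring_nf))
    (fun p hp => by
      refine le_trans (le_of_eq ?_) (le_measureReal_cond_Icc hL0 (c := p) (d := p + (2 - 3 * η))
        (by linarith) (by linarith [hp.1]) (by linarith [hp.2]) subset_rfl)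
      ring_nf)
  linarith

theorem eventually_le_integral_rightRelays (hM : IsMPRRule M) {a b : ℝ} (ha : 1 ≤ a)
    (hb : b ≤ L - 2) {δ : ℝ} (hδ : 0 < δ) :
    ∀ᶠ n : ℕ in atTop, (b - a) / 2 - δ ≤
      ∫ x, ((rightRelays (M n) x ∩ {v | x v ∈ Icc a b}).ncard : ℝ) ∂(positionLaw L n) := by
  have hL0 := hL.out
  by_cases hab : b < a
  · refine Eventually.of_forall fun n => le_trans ?_ (integral_nonneg fun _ => Nat.cast_nonneg _)
    linarith
  push Not at hab
  obtain ⟨η, hη0, hη1, hη2⟩ : ∃ η : ℝ, 0 < η ∧ 3 * η ≤ 1 ∧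
      (b - a) / 2 - δ / 3 < (b - a - 3 * η) / (2 + 3 * η) := by
    have hc : ContinuousAt (fun η : ℝ => (b - a - 3 * η) / (2 + 3 * η)) 0 :=
      ContinuousAt.div (by fun_prop) (by fun_prop) (by norm_num)
    have h1 : ∀ᶠ η in nhdsWithin (0 : ℝ) (Ioi 0),
        (b - a) / 2 - δ / 3 < (b - a - 3 * η) / (2 + 3 * η) :=
      nhdsWithin_le_nhds (continuousAt_const.eventually_lt hc (by simp; linarith))
    obtain ⟨η, h2, h3⟩ := (h1.and (Ioo_mem_nhdsGT (by norm_num : (0 : ℝ) < 1 / 3))).exists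
    exact ⟨η, h3.1, by linarith [h3.2], h2⟩
  obtain ⟨Ω, hΩm, hΩ, hlim, -⟩ := exists_dense_event (L := L) hη0
  have hB : MeasurableSet (Icc (a - 1 + 3 * η) (b - 1)) := measurableSet_Icc
  have hJ : MeasurableSet {w : ℝ × ℝ | w.2 ∈ Ioo (w.1 - 3 * η) (w.1 + 2)} :=
    measurableSet_mem_Ioo (by fun_prop) (by fun_prop) (by fun_prop)
  have h2 := eventually_le_sum_loneEvent (L := L) hB hJ (b := b - a - 3 * η) (c := 2 + 3 * η)
    (by linarith) (by linarith)
    (le_trans (le_of_eq (by ring_nf)) (sub_div_le_measureReal_Icc (by linarith) (by linarith)))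
    (fun p hp => (measureReal_cond_Icc_le hL0 (c := p - 3 * η) (d := p + 2)
        (by linarith) Ioo_subset_Icc_self).trans_eq (by ring_nf)) (δ := δ / 3) (by positivity)
  filter_upwards [(tendsto_order.1 hlim).2 (δ / 3) (by positivity), eventually_gt_atTop 0, h2]
    with n hn hn0 h2
  have h1 := integral_ncard_le_add (L := L)
    (S := fun x => {y | x ∈ loneEvent (Icc (a - 1 + 3 * η) (b - 1))
      (fun p => Ioo (p - 3 * η) (p + 2)) y})
    (fun v => by simpa using measurableSet_loneEvent hB hJ v)
    (integrable_ncard_rightRelays (L := L) (M n) a b) (fun _ => Nat.cast_nonneg _) (hΩm n)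
    (fun x hx => by
      exact_mod_cast ncard_lone_le_rightRelays_of_dense (hΩ n hn0 x hx) hη0 hη1 hb (hM n x))
  rw [integral_ncard_setOf fun v => measurableSet_loneEvent hB hJ v] at h1
  linarith

/-- Windows of length one suffice here: they give `d - c + 1`, and the bad event adds at most `1`.
-/
theorem eventually_integral_rightRelays_le_border (hM : IsMPRRule M) (h1L : 1 < L) {c d : ℝ}
    (hcd : c ≤ d) :
    ∀ᶠ n : ℕ in atTop,
      ∫ x, ((rightRelays (M n) x ∩ {v | x v ∈ Icc c d}).ncard : ℝ) ∂(positionLaw L n) ≤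
        d - c + 2 := by
  have hL0 := hL.out
  obtain ⟨Ω, hΩm, hΩ, hlim, -⟩ := exists_dense_event (L := L) one_pos
  filter_upwards [(tendsto_order.1 hlim).2 1 one_pos, eventually_gt_atTop 0] with n hn hn0
  have hB : MeasurableSet (Icc (c - 1) d ∩ Icc 0 (L - 1)) := measurableSet_Icc.inter measurableSet_Icc
  have hJ : MeasurableSet {w : ℝ × ℝ | w.2 ∈ Ioo w.1 (w.1 + 1)} :=
    measurableSet_mem_Ioo (by fun_prop) (by fun_prop) (by fun_prop)
  have h1 := integral_ncard_le_add
    (measurableSet_mem_rightRelays_inter (M n) c d)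
    (integrable_ncard_lone (L := L) hB hJ) (fun _ => Nat.cast_nonneg _) (hΩm n)
    (fun x hx => by
      exact_mod_cast ncard_rightRelays_le_lone (hΩ n hn0 x hx).mem_Icc (hM n x))
  rw [integral_ncard_setOf fun v => measurableSet_loneEvent hB hJ v] at h1
  have h2 := sum_loneEvent_le (L := L) (n := n) hB hJ (b := d - c + 1) (c := 1)
    one_pos h1L.le
    ((measureReal_cond_Icc_le hL0 (by linarith) inter_subset_left).trans_eq (by ring_nf))
    (fun p hp => by
      refine le_trans (le_of_eq ?_) (le_measureReal_cond_Icc hL0 (c := p) (d := p + 1)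
        (by linarith) hp.2.1 (by linarith [hp.2.2]) subset_rfl)
      ring_nf)
  linarith

theorem nodesIn_localMinima (a b : ℝ) (x : Fin n → ℝ) :
    nodesIn a b localMinima x =
      {v | x ∈ loneEvent (Icc a b) (fun p => Ioo (p - 1) (p + 1)) v} := by
  ext v
  rw [nodesIn, mem_inter_iff, mem_localMinima_iff]
  exact and_comm

theorem measurableSet_mem_Ioo_one : MeasurableSet {w : ℝ × ℝ | w.2 ∈ Ioo (w.1 - 1) (w.1 + 1)} :=
  measurableSet_mem_Ioo (by fun_prop) (by fun_prop) (by fun_prop)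

theorem avgCount_localMinima (a b : ℝ) :
    avgCount L n a b localMinima = ∑ v : Fin n,
      (positionLaw L n).real (loneEvent (Icc a b) (fun p => Ioo (p - 1) (p + 1)) v) := by
  rw [← integral_ncard_setOf fun v => measurableSet_loneEvent measurableSet_Icc measurableSet_mem_Ioo_one v]
  simp only [avgCount, nodesIn_localMinima]

theorem avgCount_localMinima_le {a b : ℝ} (ha : 1 ≤ a) (hab : a ≤ b) (hb : b ≤ L - 1) :
    avgCount L n a b localMinima ≤ (b - a) / 2 := by
  have hL0 := hL.out
  rw [avgCount_localMinima]
  refine sum_loneEvent_le measurableSet_Icc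
    measurableSet_mem_Ioo_one two_pos (by linarith)
    (measureReal_cond_Icc_le hL0 hab subset_rfl) fun p hp => ?_
  refine le_trans (le_of_eq ?_) (le_measureReal_cond_Icc hL0 (c := p - 1) (d := p + 1)
        (by linarith) (by linarith [hp.1]) (by linarith [hp.2]) subset_rfl)
  ring_nf

theorem eventually_le_avgCount_localMinima {a b : ℝ} (ha : 1 ≤ a) (hab : a ≤ b) (hb : b ≤ L - 1)
    {δ : ℝ} (hδ : 0 < δ) :
    ∀ᶠ n : ℕ in atTop, (b - a) / 2 - δ ≤ avgCount L n a b localMinima := by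
  have hL0 := hL.out
  simp only [avgCount_localMinima]
  exact eventually_le_sum_loneEvent measurableSet_Icc
    measurableSet_mem_Ioo_one two_pos (by linarith)
    (sub_div_le_measureReal_Icc (by linarith) (by linarith))
    (fun p hp => (measureReal_cond_Icc_le hL0 (c := p - 1) (d := p + 1)
        (by linarith) Ioo_subset_Icc_self).trans_eq (by ring_nf)) hδ

theorem avgCount_localMinima_le_border (h1L : 1 < L) {c d : ℝ} (hcd : c ≤ d) (hc : 0 ≤ c)
    (hd : d ≤ L) : avgCount L n c d localMinima ≤ d - c := by
  have hL0 := hL.out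
  rw [avgCount_localMinima]
  refine (sum_loneEvent_le measurableSet_Icc
    measurableSet_mem_Ioo_one one_pos h1L.le
    (measureReal_cond_Icc_le hL0 hcd subset_rfl) fun p hp => ?_).trans_eq (by simp)
  -- One unit interval of the window always lies in `[0, L]`: the right half of the window, or `(L -
  -- 1, L)` when `p` is close to the right end.
  rcases le_total p (L - 1) with h | h
  · refine le_trans (le_of_eq ?_) (le_measureReal_cond_Icc hL0 (c := p) (d := p + 1)
        (by linarith) (by linarith [hp.1]) (by linarith) (Ioo_subset_Ioo_left (by linarith)))
    ring_nf
  · refine le_trans (le_of_eq ?_) (le_measureReal_cond_Icc hL0 (c := L - 1) (d := L)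
        (by linarith) (by linarith) le_rfl (Ioo_subset_Ioo (by linarith [hp.2]) (by linarith)))
    ring_nf

theorem ncard_nodesIn_mprCDS {x : Fin n → ℝ} (hx : Function.Injective x) (L a b : ℝ)
    (K : SimpleGraph (Fin n) → Fin n → Set (Fin n)) :
    ((nodesIn a b (fun G => mprCDS G (K G)) x).ncard : ℝ) =
      (nodesIn a b localMinima x).ncard + ((rightRelays K x ∩ {v | x v ∈ Icc a b}).ncard +
        ((rightRelays K fun i => L - x i) ∩ {v | x v ∈ Icc a b}).ncard) := by
  have h1 : nodesIn a b (fun G => mprCDS G (K G)) x = nodesIn a b localMinima x ∪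
      ((rightRelays K x ∩ {v | x v ∈ Icc a b}) ∪
        ((rightRelays K fun i => L - x i) ∩ {v | x v ∈ Icc a b})) := by
    rw [nodesIn, mprCDS_eq_union hx L, union_inter_distrib_right, union_inter_distrib_right]
    rfl
  rw [h1, Set.ncard_union_eq, Set.ncard_union_eq]
  · push_cast; rfl
  · exact (disjoint_rightRelays_reflect L).mono inter_subset_left inter_subset_left
  · rw [← union_inter_distrib_right]
    exact (disjoint_localMinima_rightRelays L).mono inter_subset_left inter_subset_left

/-- Positions are almost surely distinct, so the set splits into local minima, right relays and left
relays; reflection rewrites the average of the last ones as that of right relays in the mirror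
interval. -/
theorem avgCount_mprCDS_eq (K : SimpleGraph (Fin n) → Fin n → Set (Fin n)) (a b : ℝ) :
    avgCount L n a b (fun G => mprCDS G (K G)) = avgCount L n a b localMinima +
      (∫ x, ((rightRelays K x ∩ {v | x v ∈ Icc a b}).ncard : ℝ) ∂(positionLaw L n) +
       ∫ x, ((rightRelays K x ∩ {v | x v ∈ Icc (L - b) (L - a)}).ncard : ℝ)
        ∂(positionLaw L n)) := by
  rw [← integral_ncard_rightRelays_reflect, ← integral_add
    (integrable_ncard_rightRelays K a b) (integrable_ncard_rightRelays_reflect K a b)]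
  refine Eq.trans ?_ (integral_add (integrable_ncard (measurableSet_mem_nodesIn a b localMinima))
    ((integrable_ncard_rightRelays K a b).add (integrable_ncard_rightRelays_reflect K a b)))
  refine integral_congr_ae ?_
  have hinj : ∀ᵐ x ∂(positionLaw L n), Function.Injective x := by
    have : ∀ i j : Fin n, i ≠ j → ∀ᵐ x ∂(positionLaw L n), x i ≠ x j := fun i j hij => by
      rw [ae_iff]
      simpa using (measureReal_eq_zero_iff).1 (measure_eval_eq_eq_zero (L := L) hij)
    have h2 : ∀ᵐ x ∂(positionLaw L n), ∀ i j : Fin n, i ≠ j → x i ≠ x j :=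
      ae_all_iff.2 fun i => ae_all_iff.2 fun j => by
        by_cases hij : i = j
        · simp [hij]
        · filter_upwards [this i j hij] with x hx _ using hx
    filter_upwards [h2] with x hx i j hij
    by_contra hne
    exact hx i j hne hij
  filter_upwards [hinj] with x hx
  exact ncard_nodesIn_mprCDS hx L a b K

theorem eventually_avgCount_mprCDS_le (hM : IsMPRRule M) {a b : ℝ} (ha : 2 ≤ a) (hab : a ≤ b)
    (hb : b ≤ L - 2) {δ : ℝ} (hδ : 0 < δ) :
    ∀ᶠ n : ℕ in atTop, avgCount L n a b (fun G => mprCDS G (M n G)) ≤ 3 / 2 * (b - a) + δ := by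
  filter_upwards [eventually_integral_rightRelays_le (L := L) hM (by linarith) hab hb
      (half_pos hδ),
    eventually_integral_rightRelays_le (L := L) hM (a := L - b) (b := L - a) (by linarith)
      (by linarith) (by linarith) (half_pos hδ)] with n h1 h2
  rw [avgCount_mprCDS_eq]
  have := avgCount_localMinima_le (L := L) (n := n) (a := a) (b := b) (by linarith) hab
    (by linarith)
  linarith

theorem eventually_le_avgCount_mprCDS (hM : IsMPRRule M) {a b : ℝ} (ha : 2 ≤ a) (hab : a ≤ b)
    (hb : b ≤ L - 2) {δ : ℝ} (hδ : 0 < δ) :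
    ∀ᶠ n : ℕ in atTop, 3 / 2 * (b - a) - δ ≤ avgCount L n a b (fun G => mprCDS G (M n G)) := by
  have hδ3 : 0 < δ / 3 := by positivity
  filter_upwards [eventually_le_integral_rightRelays (L := L) hM (a := a) (b := b)
      (by linarith) hb hδ3,
    eventually_le_integral_rightRelays (L := L) hM (a := L - b) (b := L - a) (by linarith)
      (by linarith) hδ3,
    eventually_le_avgCount_localMinima (L := L) (a := a) (b := b) (by linarith) hab
      (by linarith) hδ3] with n h1 h2 h3
  rw [avgCount_mprCDS_eq]
  linarith

theorem eventually_avgCount_mprCDS_le_border (hM : IsMPRRule M) (h1L : 1 < L) {c d : ℝ}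
    (hc : 0 ≤ c) (hcd : c ≤ d) (hd : d ≤ L) :
    ∀ᶠ n : ℕ in atTop, avgCount L n c d (fun G => mprCDS G (M n G)) ≤ 3 * (d - c) + 4 := by
  filter_upwards [eventually_integral_rightRelays_le_border (L := L) hM h1L hcd,
    eventually_integral_rightRelays_le_border (L := L) hM h1L (c := L - d) (d := L - c)
      (by linarith)] with n h1 h2
  rw [avgCount_mprCDS_eq]
  have := avgCount_localMinima_le_border (L := L) (n := n) h1L hcd hc hd
  linarith

end MPR

end Averages

/-! ### The 1999 Wu–Li CDS -/

section WuLi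

/-- Two equal or adjacent hubs whose closed neighbourhoods cover `T` dominate `T` and, as `S ⊆ T`,
connect `S`. -/
theorem isCDSOf_of_pair {V : Type*} {G : SimpleGraph V} {S T : Set V} (hST : S ⊆ T) {j k : V}
    (hj : j ∈ S) (hk : k ∈ S) (hjk : j = k ∨ G.Adj j k)
    (h : ∀ w ∈ T, w = j ∨ w = k ∨ G.Adj j w ∨ G.Adj k w) : IsCDSOf G S T := by
  refine ⟨hST, fun w hw => ?_, ?_⟩
  · rcases h w hw with rfl | rfl | h | h
    · exact Or.inl hj
    · exact Or.inl hk
    · exact Or.inr ⟨j, hj, h⟩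
    · exact Or.inr ⟨k, hk, h⟩
  · rw [SimpleGraph.connected_iff_exists_forall_reachable]
    have hr : (G.induce S).Reachable ⟨j, hj⟩ ⟨k, hk⟩ := by
      rcases hjk with rfl | h
      · exact SimpleGraph.Reachable.refl _
      · exact SimpleGraph.Adj.reachable (by simpa using h)
    refine ⟨⟨j, hj⟩, fun ⟨w, hw⟩ => ?_⟩
    rcases h w (hST hw) with rfl | rfl | h | h
    · exact SimpleGraph.Reachable.refl _
    · exact hr
    · exact SimpleGraph.Adj.reachable (by simpa using h)
    · exact hr.trans (SimpleGraph.Adj.reachable (by simpa using h))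

theorem SimpleGraph.Reachable.induct {V : Type*} {G : SimpleGraph V} {P : V → Prop}
    (hP : ∀ u v, G.Adj u v → P u → P v) {u v : V} (h : G.Reachable u v) (hu : P u) : P v := by
  obtain ⟨p⟩ := h
  induction p with
  | nil => exact hu
  | cons hadj _ ih => exact ih (hP _ _ hadj hu)

variable {n : ℕ} {x : Fin n → ℝ} {i j k : Fin n}

theorem unitDiskGraph_adj_of_lt {u v : Fin n} (hne : u ≠ v) (h1 : x u - x v < 1)
    (h2 : x v - x u < 1) : (unitDiskGraph x).Adj u v :=
  ⟨hne, abs_lt.2 ⟨by linarith, h1⟩⟩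

theorem notMem_wuLiSet_of_pair (hj : j < i) (hk : k < i) (hji : (unitDiskGraph x).Adj i j)
    (hki : (unitDiskGraph x).Adj i k) (hjk : j = k ∨ (unitDiskGraph x).Adj j k)
    (h : ∀ w, (unitDiskGraph x).Adj i w → |x j - x w| < 1 ∨ |x k - x w| < 1) :
    i ∉ wuLiSet (unitDiskGraph x) := by
  have hcds : IsCDSOf (unitDiskGraph x) {u | (unitDiskGraph x).Adj i u ∧ u < i}
      ((unitDiskGraph x).neighborSet i) := by
    refine isCDSOf_of_pair (fun u hu => hu.1) (j := j) (k := k) ⟨hji, hj⟩ ⟨hki, hk⟩ hjk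
      fun w hw => ?_
    by_cases h1 : w = j
    · exact Or.inl h1
    by_cases h2 : w = k
    · exact Or.inr (Or.inl h2)
    rcases h w hw with h | h
    · exact Or.inr (Or.inr (Or.inl ⟨fun h' => h1 h'.symm, h⟩))
    · exact Or.inr (Or.inr (Or.inr ⟨fun h' => h2 h'.symm, h⟩))
  rintro (hmin | hn)
  · exact (hmin j hji).not_gt hj
  · exact hn hcds

/-- The hub `j` reaches all neighbours of `i` on the left of `i`, the hub `k` all those on the
right. -/
theorem notMem_wuLiSet_of_bridge (hj : j < i) (hk : k < i) (hxj : x j ∈ Ioo (x i - 1) (x i))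
    (hxk : x k ∈ Ioo (x i) (x i + 1)) (hjk : x k - x j < 1) : i ∉ wuLiSet (unitDiskGraph x) := by
  have h1 := hxj.1
  have h2 := hxj.2
  have h3 := hxk.1
  have h4 := hxk.2
  refine notMem_wuLiSet_of_pair hj hk (unitDiskGraph_adj_of_lt hj.ne' (by linarith) (by linarith))
    (unitDiskGraph_adj_of_lt hk.ne' (by linarith) (by linarith))
    (Or.inr (unitDiskGraph_adj_of_lt (fun h => by rw [h] at h2; linarith) (by linarith)
      (by linarith))) fun w hw => ?_
  have := abs_lt.1 hw.2
  rcases le_total (x w) (x i) with h | h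
  · left
    rw [abs_lt]; constructor <;> linarith
  · right
    rw [abs_lt]; constructor <;> linarith

/-- If some smaller id lies in the left window, take for `j` the closest one. Another smaller id in
`(x j, x j + 1)` would contradict this choice if on the left of `i`, and would form a bridge with
`j` if on the right. -/
theorem wuLiSet_subset_lone (hx : Function.Injective x) {B : Set ℝ} (hB : x i ∈ B)
    (hi : i ∈ wuLiSet (unitDiskGraph x)) :
    x ∈ loneEvent B (fun p => Ioo (p - 1) p) i ∨
      ∃ j < i, x ∈ lonePairEvent B (fun p => Ioo (p - 1) p) (fun _ y => Ioo y (y + 1)) i j := by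
  classical
  by_cases hlone : ∀ j < i, x j ∉ Ioo (x i - 1) (x i)
  · exact Or.inl ⟨hB, hlone⟩
  right
  push Not at hlone
  obtain ⟨j0, hj0, hj0'⟩ := hlone
  obtain ⟨j, hj, hmax⟩ := Finset.exists_max_image
    (Finset.univ.filter fun j => j < i ∧ x j ∈ Ioo (x i - 1) (x i)) x ⟨j0, by simpa using ⟨hj0, hj0'⟩⟩
  simp only [Finset.mem_filter, Finset.mem_univ, true_and] at hj hmax
  refine ⟨j, hj.1, hB, hj.2, fun k hk hkj hxk => ?_⟩
  have h1 := hj.2.1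
  have h2 := hj.2.2
  have h3 := hxk.1
  have h4 := hxk.2
  rcases lt_trichotomy (x k) (x i) with h | h | h
  · have := hmax k ⟨hk, by constructor <;> linarith⟩
    linarith
  · exact hk.ne (hx h)
  · exact notMem_wuLiSet_of_bridge hj.1 hk hj.2 ⟨h, by linarith⟩ (by linarith) hi

/-- Dense samples: a node without node of smaller id on its left is in the Wu–Li set, except when
a node of smaller id lies within `η` on its right. -/
theorem mem_wuLiSet_of_lone {L η : ℝ} (hx : IsDenseSample L η x) (hη : η ≤ 1)
    (hi : 1 ≤ x i) {B : Set ℝ} (hlone : x ∈ loneEvent B (fun p => Ioo (p - 1) p) i) :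
    i ∈ wuLiSet (unitDiskGraph x) ∨
      ∃ j < i, x ∈ lonePairEvent B (fun p => Ioo p (p + η)) (fun p _ => Ioo (p - 1) p) i j := by
  by_contra! hcon
  obtain ⟨hA, hX⟩ := hcon
  have hcds : IsCDSOf (unitDiskGraph x) {u | (unitDiskGraph x).Adj i u ∧ u < i}
      ((unitDiskGraph x).neighborSet i) := by
    by_contra h
    exact hA (Or.inr h)
  have hright : ∀ u, (unitDiskGraph x).Adj i u → u < i → x i < x u := by
    intro u hu hui
    by_contra hle
    have := abs_lt.1 hu.2
    rcases (not_lt.1 hle).eq_or_lt with h | h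
    · exact hui.ne (hx.injective h)
    · exact hlone.2 u hui ⟨by linarith, h⟩
  -- A neighbour at the far left end can be dominated from the right of `i` only by a node within
  -- `η` of `i`.
  obtain ⟨w, hw1, hw2⟩ := hx.exists_mem (x i - 1) (x i - 1 + η) (by linarith)
    (by linarith [(hx.mem_Icc i).2]) (by linarith)
  have hiw : (unitDiskGraph x).Adj i w :=
    unitDiskGraph_adj_of_lt (fun h => by rw [h] at hw2; linarith) (by linarith) (by linarith)
  rcases hcds.2.1 w hiw with ⟨h1, h2⟩ | ⟨u, ⟨hu1, hu2⟩, huw⟩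
  · linarith [hright w h1 h2]
  · have h1 := hright u hu1 hu2
    have h2 := abs_lt.1 huw.2
    exact hX u hu2 ⟨hlone.1, ⟨h1, by linarith⟩, fun k hk _ => hlone.2 k hk⟩

/-- The smaller ids around `i` avoid `(x j, x j + 1)`, a gap that no edge crosses. If they were
connected they would all lie on the left of `i`, with `j`; dominating a neighbour close to `x i + 1`
would then require one of them within `η` of `i`, the rare exception. -/
theorem mem_wuLiSet_of_lonePair {L η : ℝ} (hx : IsDenseSample L η x) (hη : η ≤ 1)
    (hi : x i ≤ L - 1) {B : Set ℝ} (hji : j < i)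
    (hpair : x ∈ lonePairEvent B (fun p => Ioo (p - 1) p) (fun _ y => Ioo y (y + 1)) i j) :
    i ∈ wuLiSet (unitDiskGraph x) ∨
      ∃ j < i, x ∈ lonePairEvent B (fun p => Ioo (p - η) p) (fun p _ => Ioo p (p + 1)) i j := by
  by_contra! hcon
  obtain ⟨hA, hX⟩ := hcon
  have hcds : IsCDSOf (unitDiskGraph x) {u | (unitDiskGraph x).Adj i u ∧ u < i}
      ((unitDiskGraph x).neighborSet i) := by
    by_contra h
    exact hA (Or.inr h)
  obtain ⟨hB, ⟨hj1, hj2⟩, hpair⟩ := hpair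
  have hleft : ∀ u, (unitDiskGraph x).Adj i u → u < i → x u < x i := by
    have hadj : (unitDiskGraph x).Adj i j :=
      unitDiskGraph_adj_of_lt hji.ne' (by linarith) (by linarith)
    intro u hu hui
    -- Being on the left of `i` propagates along edges: an edge leaving this side would go from at
    -- most `x j` to at least `x j + 1`.
    refine (hcds.2.2.preconnected ⟨j, hadj, hji⟩ ⟨u, hu, hui⟩).induct
      (P := fun z => x z.1 < x i) ?_ hj2
    rintro ⟨y, hy1, hy2⟩ ⟨z, hz1, hz2⟩ hyz hlt
    by_contra hle
    have hyz' : (unitDiskGraph x).Adj y z := hyz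
    have h1 := abs_lt.1 hyz'.2
    have h2 := abs_lt.1 hz1.2
    have hne : ∀ w, w ≠ j → w < i → x w ≤ x j ∨ x j + 1 ≤ x w := by
      intro w hw hwi
      by_contra! h
      exact hpair w hwi hw h
    have hzj : x j + 1 ≤ x z := (hne z (fun h => hle (by show x z < x i; rw [h]; exact hj2)) hz2).resolve_left
      (fun h => hle (by show x z < x i; linarith))
    have hyj : x y ≤ x j := by
      by_cases h : y = j
      · rw [h]
      · exact (hne y h hy2).resolve_right fun h => by
          have : x y < x i := hlt
          linarith
    linarith
  have hpos := hx.mem_Icc i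
  obtain ⟨w, hw1, hw2⟩ := hx.exists_mem (x i + 1 - η) (x i + 1) (by linarith [hpos.1])
    (by linarith) (by linarith)
  have hiw : (unitDiskGraph x).Adj i w :=
    unitDiskGraph_adj_of_lt (fun h => by rw [h] at hw1; linarith) (by linarith) (by linarith)
  rcases hcds.2.1 w hiw with ⟨h1, h2⟩ | ⟨u, ⟨hu1, hu2⟩, huw⟩
  · linarith [hleft w h1 h2]
  · have h1 := hleft u hu1 hu2
    have h2 := abs_lt.1 huw.2
    refine hX u hu2 ⟨hB, ⟨by linarith, h1⟩, fun k hk _ hxk => ?_⟩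
    have := hleft k (unitDiskGraph_adj_of_lt hk.ne' (by linarith [hxk.1]) (by linarith [hxk.2])) hk
    linarith [hxk.1]

/-- Valid up to the ends. Smaller ids within `1/2` on both sides form a bridge. Within `1/2` of an
end, a single smaller id on the inner side already dominates all neighbours of `i`. -/
theorem wuLiSet_subset_half {L : ℝ} (hmem : ∀ j, x j ∈ Icc 0 L) (hL : 1 < L) {B : Set ℝ}
    (hB : x i ∈ B) (hi : i ∈ wuLiSet (unitDiskGraph x)) :
    x ∈ loneEvent (B ∩ Icc 0 (L - 1 / 2)) (fun p => Ioo p (p + 1 / 2)) i ∨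
      x ∈ loneEvent (B ∩ Icc (1 / 2) L) (fun p => Ioo (p - 1 / 2) p) i := by
  by_contra! hcon
  obtain ⟨hr, hl⟩ := hcon
  have hr' : x i ≤ L - 1 / 2 → ∃ k < i, x k ∈ Ioo (x i) (x i + 1 / 2) := by
    intro h
    by_contra! h'
    exact hr ⟨⟨hB, (hmem i).1, h⟩, h'⟩
  have hl' : 1 / 2 ≤ x i → ∃ j < i, x j ∈ Ioo (x i - 1 / 2) (x i) := by
    intro h
    by_contra! h'
    exact hl ⟨⟨hB, h, (hmem i).2⟩, h'⟩
  rcases lt_or_ge (x i) (1 / 2) with h | h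
  · obtain ⟨k, hk, hk1, hk2⟩ := hr' (by linarith)
    have hadj := unitDiskGraph_adj_of_lt (x := x) hk.ne' (by linarith) (by linarith)
    refine notMem_wuLiSet_of_pair hk hk hadj hadj (Or.inl rfl) (fun w hw => Or.inl ?_) hi
    have h1 := abs_lt.1 hw.2
    have := (hmem w).1
    rw [abs_lt]; constructor <;> linarith
  · obtain ⟨j, hj, hj1, hj2⟩ := hl' h
    rcases le_or_gt (x i) (L - 1 / 2) with h' | h'
    · obtain ⟨k, hk, hk1, hk2⟩ := hr' h'
      exact notMem_wuLiSet_of_bridge hj hk ⟨by linarith, hj2⟩ ⟨hk1, by linarith⟩ (by linarith) hi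
    · have hadj := unitDiskGraph_adj_of_lt (x := x) hj.ne' (by linarith) (by linarith)
      refine notMem_wuLiSet_of_pair hj hj hadj hadj (Or.inl rfl) (fun w hw => Or.inl ?_) hi
      have h1 := abs_lt.1 hw.2
      have := (hmem w).2
      rw [abs_lt]; constructor <;> linarith

end WuLi

/-! ### Density of the Wu–Li CDS -/

section WuLiCounts

variable {n : ℕ} {x : Fin n → ℝ}

theorem le_sum_indicator {E : Fin n → Set (Fin n → ℝ)} {i : Fin n}
    (h : ∃ j < i, x ∈ E j) : 1 ≤ ∑ j ∈ Finset.Iio i, (E j).indicator (1 : (Fin n → ℝ) → ℝ) x := by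
  obtain ⟨j, hj, hx⟩ := h
  have : (E j).indicator (1 : (Fin n → ℝ) → ℝ) x = 1 := by simp [hx]
  rw [← this]
  exact Finset.single_le_sum (f := fun j => (E j).indicator (1 : (Fin n → ℝ) → ℝ) x)
    (fun k _ => Set.indicator_nonneg (fun _ _ => zero_le_one) _) (by simpa using hj)

theorem sum_indicator_nonneg (E : Fin n → Set (Fin n → ℝ)) (i : Fin n) :
    0 ≤ ∑ j ∈ Finset.Iio i, (E j).indicator (1 : (Fin n → ℝ) → ℝ) x :=
  Finset.sum_nonneg fun _ _ => Set.indicator_nonneg (fun _ _ => zero_le_one) _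

theorem ncard_nodesIn_wuLiSet_le (hx : Function.Injective x) (a b : ℝ) :
    ((nodesIn a b wuLiSet x).ncard : ℝ) ≤
      {i | x ∈ loneEvent (Icc a b) (fun p => Ioo (p - 1) p) i}.ncard +
      ∑ i, ∑ j ∈ Finset.Iio i, (lonePairEvent (Icc a b) (fun p => Ioo (p - 1) p)
        (fun _ y => Ioo y (y + 1)) i j).indicator (1 : (Fin n → ℝ) → ℝ) x := by
  classical
  rw [ncard_eq_sum_ite, ncard_eq_sum_ite, ← Finset.sum_add_distrib]
  refine Finset.sum_le_sum fun i _ => ?_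
  have hnn := sum_indicator_nonneg (x := x) (fun j => lonePairEvent (Icc a b)
    (fun p => Ioo (p - 1) p) (fun _ y => Ioo y (y + 1)) i j) i
  by_cases hi : i ∈ nodesIn a b wuLiSet x
  · rw [if_pos hi]
    rcases wuLiSet_subset_lone hx (B := Icc a b) hi.2 hi.1 with h | h
    · have : i ∈ {i | x ∈ loneEvent (Icc a b) (fun p => Ioo (p - 1) p) i} := h
      rw [if_pos this]
      linarith
    · have := le_sum_indicator h
      split_ifs <;> linarith
  · rw [if_neg hi]
    split_ifs <;> linarith

/-- The events on the left are mutually exclusive for a given `i`, so each `i` counts at most once;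
it is then selected or charged to one of the two rare events where a smaller id lies within `η`. -/
theorem ncard_lone_le_nodesIn_wuLiSet {L η : ℝ} (hx : IsDenseSample L η x) (hη : η ≤ 1)
    {a b : ℝ} (ha : 1 ≤ a) (hb : b ≤ L - 1) :
    ({i | x ∈ loneEvent (Icc a b) (fun p => Ioo (p - 1) p) i}.ncard : ℝ) +
      ∑ i, ∑ j ∈ Finset.Iio i, (lonePairEvent (Icc a b) (fun p => Ioo (p - 1) p)
        (fun _ y => Ioo y (y + 1)) i j).indicator (1 : (Fin n → ℝ) → ℝ) x ≤
    (nodesIn a b wuLiSet x).ncard +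
      (∑ i, ∑ j ∈ Finset.Iio i, (lonePairEvent (Icc a b) (fun p => Ioo p (p + η))
        (fun p _ => Ioo (p - 1) p) i j).indicator (1 : (Fin n → ℝ) → ℝ) x +
      ∑ i, ∑ j ∈ Finset.Iio i, (lonePairEvent (Icc a b) (fun p => Ioo (p - η) p)
        (fun p _ => Ioo p (p + 1)) i j).indicator (1 : (Fin n → ℝ) → ℝ) x) := by
  classical
  rw [ncard_eq_sum_ite, ncard_eq_sum_ite, ← Finset.sum_add_distrib, ← Finset.sum_add_distrib,
    ← Finset.sum_add_distrib]
  refine Finset.sum_le_sum fun i _ => ?_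
  have hnn := sum_indicator_nonneg (x := x) (fun j => lonePairEvent (Icc a b)
    (fun p => Ioo p (p + η)) (fun p _ => Ioo (p - 1) p) i j) i
  have hnn' := sum_indicator_nonneg (x := x) (fun j => lonePairEvent (Icc a b)
    (fun p => Ioo (p - η) p) (fun p _ => Ioo p (p + 1)) i j) i
  have hmemA : ∀ {h : x i ∈ Icc a b}, i ∈ wuLiSet (unitDiskGraph x) →
    i ∈ nodesIn a b wuLiSet x := fun {h} h' => ⟨h', h⟩
  by_cases hlone : i ∈ {i | x ∈ loneEvent (Icc a b) (fun p => Ioo (p - 1) p) i}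
  · have hl : x ∈ loneEvent (Icc a b) (fun p => Ioo (p - 1) p) i := hlone
    have h0 : ∑ j ∈ Finset.Iio i, (lonePairEvent (Icc a b) (fun p => Ioo (p - 1) p)
        (fun _ y => Ioo y (y + 1)) i j).indicator (1 : (Fin n → ℝ) → ℝ) x = 0 := by
      refine Finset.sum_eq_zero fun j hj => Set.indicator_of_notMem (fun h => ?_) _
      exact hl.2 j (by simpa using hj) h.2.1
    rw [if_pos hlone, h0]
    rcases mem_wuLiSet_of_lone hx hη (ha.trans hl.1.1) hl with h | h
    · rw [if_pos (hmemA (h := hl.1) h)]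
      linarith
    · have := le_sum_indicator h
      split_ifs <;> linarith
  · rw [if_neg hlone]
    by_cases hpair : ∃ j < i, x ∈ lonePairEvent (Icc a b) (fun p => Ioo (p - 1) p)
        (fun _ y => Ioo y (y + 1)) i j
    · obtain ⟨j, hji, hj⟩ := hpair
      -- Uniqueness of `j`: of two candidates, the one on the right would lie in the forbidden
      -- window of the other.
      have h1 : ∑ j ∈ Finset.Iio i, (lonePairEvent (Icc a b) (fun p => Ioo (p - 1) p)
        (fun _ y => Ioo y (y + 1)) i j).indicator (1 : (Fin n → ℝ) → ℝ) x = 1 := by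
        rw [Finset.sum_eq_single_of_mem j (by simpa using hji) fun k hk hkj =>
          Set.indicator_of_notMem (fun h => ?_) _]
        · simp [hj]
        · have hki : k < i := by simpa using hk
          have h1 := hj.2.1
          have h2 := h.2.1
          rcases lt_trichotomy (x k) (x j) with h3 | h3 | h3
          · exact h.2.2 j hji hkj.symm ⟨h3, by linarith [h1.2, h2.1]⟩
          · exact hkj (hx.injective h3)
          · exact hj.2.2 k hki hkj ⟨h3, by linarith [h1.1, h2.2]⟩
      rw [h1]
      rcases mem_wuLiSet_of_lonePair hx hη (hj.1.2.trans hb) hji hj with h | h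
      · rw [if_pos (hmemA (h := hj.1) h)]
        linarith
      · have := le_sum_indicator h
        split_ifs <;> linarith
    · have h0 : ∑ j ∈ Finset.Iio i, (lonePairEvent (Icc a b) (fun p => Ioo (p - 1) p)
        (fun _ y => Ioo y (y + 1)) i j).indicator (1 : (Fin n → ℝ) → ℝ) x = 0 := by
        refine Finset.sum_eq_zero fun j hj => Set.indicator_of_notMem (fun h => ?_) _
        exact hpair ⟨j, by simpa using hj, h⟩
      rw [h0]
      split_ifs <;> linarith

theorem ncard_nodesIn_wuLiSet_le_half {L : ℝ} (hmem : ∀ j, x j ∈ Icc 0 L) (hL : 1 < L)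
    (a b : ℝ) :
    (nodesIn a b wuLiSet x).ncard ≤
      {i | x ∈ loneEvent (Icc a b ∩ Icc 0 (L - 1 / 2)) (fun p => Ioo p (p + 1 / 2)) i}.ncard +
      {i | x ∈ loneEvent (Icc a b ∩ Icc (1 / 2) L) (fun p => Ioo (p - 1 / 2) p) i}.ncard :=
  (Set.ncard_le_ncard fun _ hi => wuLiSet_subset_half hmem hL hi.2 hi.1).trans
    (Set.ncard_union_le _ _)

variable {L : ℝ} [hL : Fact (0 < L)]

theorem integrable_sum_sum_indicator {E : Fin n → Fin n → Set (Fin n → ℝ)}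
    (hE : ∀ i j, MeasurableSet (E i j)) :
    Integrable (fun x => ∑ i, ∑ j ∈ Finset.Iio i, (E i j).indicator (1 : (Fin n → ℝ) → ℝ) x)
      (positionLaw L n) :=
  integrable_finsetSum _ fun i _ => integrable_finsetSum _ fun j _ =>
    (integrable_const (1 : ℝ)).indicator (hE i j)

theorem integral_sum_sum_indicator {E : Fin n → Fin n → Set (Fin n → ℝ)}
    (hE : ∀ i j, MeasurableSet (E i j)) :
    ∫ x, ∑ i, ∑ j ∈ Finset.Iio i, (E i j).indicator (1 : (Fin n → ℝ) → ℝ) x ∂(positionLaw L n) =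
      ∑ i, ∑ j ∈ Finset.Iio i, (positionLaw L n).real (E i j) := by
  have h : ∀ i j, Integrable ((E i j).indicator (1 : (Fin n → ℝ) → ℝ)) (positionLaw L n) :=
    fun i j => (integrable_const (1 : ℝ)).indicator (hE i j)
  rw [integral_finsetSum _ fun i _ => integrable_finsetSum _ fun j _ => h i j]
  refine Finset.sum_congr rfl fun i _ => ?_
  rw [integral_finsetSum _ fun j _ => h i j]
  exact Finset.sum_congr rfl fun j _ => integral_indicator_one (hE i j)

theorem sum_lonePairEvent_le {B : Set ℝ} (hB : MeasurableSet B) {Q : ℝ → Set ℝ}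
    (hQ : MeasurableSet {w : ℝ × ℝ | w.2 ∈ Q w.1}) {J : ℝ → ℝ → Set ℝ}
    (hJ : MeasurableSet {w : (ℝ × ℝ) × ℝ | w.2 ∈ J w.1.1 w.1.2}) {b q : ℝ} (hq0 : 0 ≤ q)
    (h1L : 1 ≤ L) (hBb : (cond volume (Icc 0 L)).real B ≤ b / L)
    (hQq : ∀ p ∈ B, (cond volume (Icc 0 L)).real (Q p) ≤ q / L)
    (h : ∀ p ∈ B, ∀ y ∈ Q p, 1 / L ≤ (cond volume (Icc 0 L)).real (J p y)) :
    ∑ i : Fin n, ∑ j ∈ Finset.Iio i, (positionLaw L n).real (lonePairEvent B Q J i j) ≤ b * q := by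
  have hL0 := hL.out
  refine (sum_measureReal_lonePairEvent_le hB hQ hJ (by positivity : 0 ≤ q / L)
    (by positivity : 0 < 1 / L) ((div_le_one hL0).2 h1L) hQq h).trans ?_
  calc _ ≤ b / L * (q / L) / (1 / L) ^ 2 := by gcongr
    _ = b * q := by field_simp

theorem eventually_le_sum_lonePairEvent {B : Set ℝ} (hB : MeasurableSet B) {Q : ℝ → Set ℝ}
    (hQ : MeasurableSet {w : ℝ × ℝ | w.2 ∈ Q w.1}) {J : ℝ → ℝ → Set ℝ}
    (hJ : MeasurableSet {w : (ℝ × ℝ) × ℝ | w.2 ∈ J w.1.1 w.1.2}) {b : ℝ}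
    (h1L : 1 ≤ L) (hBb : b / L ≤ (cond volume (Icc 0 L)).real B)
    (hQq : ∀ p ∈ B, 1 / L ≤ (cond volume (Icc 0 L)).real (Q p))
    (h : ∀ p ∈ B, ∀ y ∈ Q p, (cond volume (Icc 0 L)).real (J p y) ≤ 1 / L) {δ : ℝ} (hδ : 0 < δ) :
    ∀ᶠ n : ℕ in atTop, b - δ ≤
      ∑ i : Fin n, ∑ j ∈ Finset.Iio i, (positionLaw L n).real (lonePairEvent B Q J i j) := by
  have hL0 := hL.out
  have hc1 : 1 / L ≤ 1 := (div_le_one hL0).2 h1L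
  have hc0 : 0 < 1 / L := by positivity
  have hlim := (hasSum_mul_geometric_pred (sub_nonneg.2 hc1) (by linarith)).tendsto_sum_nat.const_mul
    (b / L * (1 / L))
  have e : b / L * (1 / L) * (1 / (1 - (1 - 1 / L)) ^ 2) = b := by
    rw [sub_sub_cancel]
    field_simp
  rw [e] at hlim
  filter_upwards [(tendsto_order.1 hlim).1 _ (sub_lt_self _ hδ)] with n hn
  refine hn.le.trans (le_trans ?_
    (le_sum_measureReal_lonePairEvent hB hQ hJ hc0.le hc1 hQq h))
  gcongr

theorem measurableSet_lone_left (c : ℝ) : MeasurableSet {w : ℝ × ℝ | w.2 ∈ Ioo (w.1 - c) w.1} :=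
  measurableSet_mem_Ioo (by fun_prop) (by fun_prop) (by fun_prop)

theorem measurableSet_lone_right (c : ℝ) : MeasurableSet {w : ℝ × ℝ | w.2 ∈ Ioo w.1 (w.1 + c)} :=
  measurableSet_mem_Ioo (by fun_prop) (by fun_prop) (by fun_prop)

/-- Each of the two kinds of events contributes `b - a`; `δ` pays for the bad event. -/
theorem eventually_avgCount_wuLiSet_le {a b : ℝ} (ha : 1 ≤ a) (hab : a ≤ b) (hb : b ≤ L - 1)
    {δ : ℝ} (hδ : 0 < δ) :
    ∀ᶠ n : ℕ in atTop, avgCount L n a b wuLiSet ≤ 2 * (b - a) + δ := by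
  have hL0 := hL.out
  obtain ⟨Ω, hΩm, hΩ, hlim, -⟩ := exists_dense_event (L := L) one_pos
  filter_upwards [(tendsto_order.1 hlim).2 δ hδ, eventually_gt_atTop 0] with n hn hn0
  have hJ : MeasurableSet {w : (ℝ × ℝ) × ℝ | w.2 ∈ Ioo w.1.2 (w.1.2 + 1)} :=
    measurableSet_mem_Ioo (by fun_prop) (by fun_prop) (by fun_prop)
  have hE1 : ∀ i : Fin n, MeasurableSet (loneEvent (Icc a b) (fun p => Ioo (p - 1) p) i) :=
    fun i => measurableSet_loneEvent measurableSet_Icc (measurableSet_lone_left 1) i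
  have hE2 : ∀ i j : Fin n, MeasurableSet (lonePairEvent (Icc a b) (fun p => Ioo (p - 1) p)
      (fun _ y => Ioo y (y + 1)) i j) := fun i j =>
    measurableSet_lonePairEvent measurableSet_Icc (measurableSet_lone_left 1) hJ i j
  have i1 := integrable_ncard_lone (L := L) (n := n) (measurableSet_Icc (a := a) (b := b))
    (J := fun p => Ioo (p - 1) p) (measurableSet_lone_left 1)
  have i2 := integrable_sum_sum_indicator (L := L) hE2
  have h1 := integral_ncard_le_add (measurableSet_mem_nodesIn a b wuLiSet) (i1.add i2)
    (fun x => add_nonneg (Nat.cast_nonneg _) (Finset.sum_nonneg fun i _ =>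
      sum_indicator_nonneg _ i)) (hΩm n)
    (fun x hx => ncard_nodesIn_wuLiSet_le (hΩ n hn0 x hx).injective a b)
  have h2 := integral_add i1 i2
  rw [integral_ncard_setOf hE1, integral_sum_sum_indicator hE2] at h2
  have h3 := sum_loneEvent_le (L := L) (n := n) (measurableSet_Icc (a := a) (b := b))
    (measurableSet_lone_left 1) (b := b - a) (c := 1) one_pos (by linarith)
    (measureReal_cond_Icc_le hL0 hab subset_rfl)
    (fun p hp => by
      refine le_trans (le_of_eq ?_) (le_measureReal_cond_Icc hL0 (c := p - 1) (d := p)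
        (by linarith) (by linarith [hp.1]) (by linarith [hp.2]) subset_rfl)
      ring_nf)
  have h4 := sum_lonePairEvent_le (L := L) (n := n) (measurableSet_Icc (a := a) (b := b))
    (measurableSet_lone_left 1) hJ (b := b - a) (q := 1) zero_le_one (by linarith)
    (measureReal_cond_Icc_le hL0 hab subset_rfl)
    (fun p hp => (measureReal_cond_Icc_le hL0 (c := p - 1) (d := p) (by linarith)
      Ioo_subset_Icc_self).trans_eq (by ring_nf))
    (fun p hp y hy => by
      refine le_trans (le_of_eq ?_) (le_measureReal_cond_Icc hL0 (c := y) (d := y + 1)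
        (by linarith) (by linarith [hp.1, hy.1]) (by linarith [hp.2, hy.2]) subset_rfl)
      ring_nf)
  have h5 : avgCount L n a b wuLiSet ≤ _ := h1
  simp only [Pi.add_apply] at h5
  rw [h2] at h5
  linarith

theorem eventually_le_avgCount_wuLiSet {a b : ℝ} (ha : 2 ≤ a) (hab : a ≤ b) (hb : b ≤ L - 2)
    {δ : ℝ} (hδ : 0 < δ) :
    ∀ᶠ n : ℕ in atTop, 2 * (b - a) - δ ≤ avgCount L n a b wuLiSet := by
  have hL0 := hL.out
  -- Each rare event has average at most `(b - a) η`, so the two together cost a quarter of `δ`.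
  obtain ⟨η, hη0, hη1, hη2⟩ : ∃ η : ℝ, 0 < η ∧ η ≤ 1 ∧ 2 * ((b - a) * η) ≤ δ / 4 := by
    refine ⟨min 1 (δ / 8 / (b - a + 1)), ?_, min_le_left _ _, ?_⟩
    · have : 0 < b - a + 1 := by linarith
      positivity
    · have h1 : 0 < b - a + 1 := by linarith
      have h2 : (b - a) * min 1 (δ / 8 / (b - a + 1)) ≤ (b - a + 1) * (δ / 8 / (b - a + 1)) := by
        gcongr
        · linarith
        · exact min_le_right _ _
      rw [mul_div_cancel₀ _ h1.ne'] at h2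
      linarith
  obtain ⟨Ω, hΩm, hΩ, -, hlim⟩ := exists_dense_event (L := L) hη0
  have hJ : MeasurableSet {w : (ℝ × ℝ) × ℝ | w.2 ∈ Ioo w.1.2 (w.1.2 + 1)} :=
    measurableSet_mem_Ioo (by fun_prop) (by fun_prop) (by fun_prop)
  have hJl : MeasurableSet {w : (ℝ × ℝ) × ℝ | w.2 ∈ Ioo (w.1.1 - 1) w.1.1} :=
    measurableSet_mem_Ioo (by fun_prop) (by fun_prop) (by fun_prop)
  have hJr : MeasurableSet {w : (ℝ × ℝ) × ℝ | w.2 ∈ Ioo w.1.1 (w.1.1 + 1)} :=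
    measurableSet_mem_Ioo (by fun_prop) (by fun_prop) (by fun_prop)
  have hδ4 : 0 < δ / 4 := by positivity
  have h1L : 1 ≤ L := by linarith
  have ev1 := eventually_le_sum_loneEvent (L := L) (measurableSet_Icc (a := a) (b := b))
    (measurableSet_lone_left 1) (b := b - a) (c := 1) one_pos h1L
    (sub_div_le_measureReal_Icc (by linarith) (by linarith))
    (fun p hp => (measureReal_cond_Icc_le hL0 (c := p - 1) (d := p) (by linarith)
      Ioo_subset_Icc_self).trans_eq (by ring_nf)) hδ4
  have ev2 := eventually_le_sum_lonePairEvent (L := L) (measurableSet_Icc (a := a) (b := b))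
    (measurableSet_lone_left 1) hJ (b := b - a) h1L
    (sub_div_le_measureReal_Icc (by linarith) (by linarith))
    (fun p hp => by
      refine le_trans (le_of_eq ?_) (le_measureReal_cond_Icc hL0 (c := p - 1) (d := p)
        (by linarith) (by linarith [hp.1]) (by linarith [hp.2]) subset_rfl)
      ring_nf)
    (fun p hp y hy => (measureReal_cond_Icc_le hL0 (c := y) (d := y + 1) (by linarith)
      Ioo_subset_Icc_self).trans_eq (by ring_nf)) hδ4
  filter_upwards [(tendsto_order.1 hlim).2 (δ / 8) (by positivity), eventually_gt_atTop 0, ev1, ev2]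
    with n hn hn0 h3 h4
  have hE1 : ∀ i : Fin n, MeasurableSet (loneEvent (Icc a b) (fun p => Ioo (p - 1) p) i) :=
    fun i => measurableSet_loneEvent measurableSet_Icc (measurableSet_lone_left 1) i
  have hE2 : ∀ i j : Fin n, MeasurableSet (lonePairEvent (Icc a b) (fun p => Ioo (p - 1) p)
      (fun _ y => Ioo y (y + 1)) i j) := fun i j =>
    measurableSet_lonePairEvent measurableSet_Icc (measurableSet_lone_left 1) hJ i j
  have hE3 : ∀ i j : Fin n, MeasurableSet (lonePairEvent (Icc a b) (fun p => Ioo p (p + η))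
      (fun p _ => Ioo (p - 1) p) i j) := fun i j =>
    measurableSet_lonePairEvent measurableSet_Icc (measurableSet_lone_right η) hJl i j
  have hE4 : ∀ i j : Fin n, MeasurableSet (lonePairEvent (Icc a b) (fun p => Ioo (p - η) p)
      (fun p _ => Ioo p (p + 1)) i j) := fun i j =>
    measurableSet_lonePairEvent measurableSet_Icc (measurableSet_lone_left η) hJr i j
  have i1 := integrable_ncard_lone (L := L) (n := n) (measurableSet_Icc (a := a) (b := b))
    (J := fun p => Ioo (p - 1) p) (measurableSet_lone_left 1)
  have i2 := integrable_sum_sum_indicator (L := L) hE2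
  have i3 := integrable_sum_sum_indicator (L := L) hE3
  have i4 := integrable_sum_sum_indicator (L := L) hE4
  have iA := integrable_ncard (L := L) (measurableSet_mem_nodesIn (n := n) a b wuLiSet)
  have s3 := sum_lonePairEvent_le (L := L) (n := n) (measurableSet_Icc (a := a) (b := b))
    (measurableSet_lone_right η) hJl (b := b - a) (q := η) hη0.le h1L
    (measureReal_cond_Icc_le hL0 hab subset_rfl)
    (fun p hp => (measureReal_cond_Icc_le hL0 (c := p) (d := p + η) (by linarith)
      Ioo_subset_Icc_self).trans_eq (by ring_nf))
    (fun p hp y hy => by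
      refine le_trans (le_of_eq ?_) (le_measureReal_cond_Icc hL0 (c := p - 1) (d := p)
        (by linarith) (by linarith [hp.1]) (by linarith [hp.2]) subset_rfl)
      ring_nf)
  have s4 := sum_lonePairEvent_le (L := L) (n := n) (measurableSet_Icc (a := a) (b := b))
    (measurableSet_lone_left η) hJr (b := b - a) (q := η) hη0.le h1L
    (measureReal_cond_Icc_le hL0 hab subset_rfl)
    (fun p hp => (measureReal_cond_Icc_le hL0 (c := p - η) (d := p) (by linarith)
      Ioo_subset_Icc_self).trans_eq (by ring_nf))
    (fun p hp y hy => by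
      refine le_trans (le_of_eq ?_) (le_measureReal_cond_Icc hL0 (c := p) (d := p + 1)
        (by linarith) (by linarith [hp.1]) (by linarith [hp.2]) subset_rfl)
      ring_nf)
  have hn1 : (1 : ℝ) ≤ n := by exact_mod_cast hn0
  have key := integral_le_integral_add (i1.add i2) (iA.add (i3.add i4)) (hΩm n)
    -- On the bad event the double sum over pairs is only bounded by `n²`, so the probability must
    -- be `o(n⁻²)` here.
    (K := 2 * (n : ℝ) ^ 2)
    (fun x hx => ncard_lone_le_nodesIn_wuLiSet (hΩ n hn0 x hx) hη1 (by linarith) (by linarith))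
    (fun x => by
      have e1 := ncard_le_natCast {i | x ∈ loneEvent (Icc a b) (fun p => Ioo (p - 1) p) i}
      have e2 : ∑ i, ∑ j ∈ Finset.Iio i, (lonePairEvent (Icc a b) (fun p => Ioo (p - 1) p)
          (fun _ y => Ioo y (y + 1)) i j).indicator (1 : (Fin n → ℝ) → ℝ) x ≤ (n : ℝ) ^ 2 := by
        calc _ ≤ ∑ _i : Fin n, (n : ℝ) := by
              refine Finset.sum_le_sum fun i _ => ?_
              refine (Finset.sum_le_card_nsmul _ _ 1 fun j _ =>
                Set.indicator_le_self' (fun _ _ => zero_le_one) _).trans ?_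
              simp [Fin.card_Iio, i.2.le]
          _ = _ := by simp; ring
      have e3 := add_nonneg (Nat.cast_nonneg (nodesIn a b wuLiSet x).ncard : (0 : ℝ) ≤ _)
        (add_nonneg
          (Finset.sum_nonneg (s := Finset.univ) fun i _ => sum_indicator_nonneg (x := x) (fun j =>
            lonePairEvent (Icc a b) (fun p => Ioo p (p + η)) (fun p _ => Ioo (p - 1) p) i j) i)
          (Finset.sum_nonneg (s := Finset.univ) fun i _ => sum_indicator_nonneg (x := x) (fun j =>
            lonePairEvent (Icc a b) (fun p => Ioo (p - η) p) (fun p _ => Ioo p (p + 1)) i j) i))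
      simp only [Pi.add_apply]
      nlinarith)
  have k1 := integral_add i1 i2
  have k2 := integral_add iA (i3.add i4)
  have k3 := integral_add i3 i4
  rw [integral_ncard_setOf hE1, integral_sum_sum_indicator hE2] at k1
  rw [integral_sum_sum_indicator hE3, integral_sum_sum_indicator hE4] at k3
  simp only [Pi.add_apply] at key k2
  rw [k1, k2, k3] at key
  have : avgCount L n a b wuLiSet = ∫ x, ((nodesIn a b wuLiSet x).ncard : ℝ) ∂(positionLaw L n) :=
    rfl
  linarith

/-- Two families of windows of length `1/2` contribute `2 (d - c)` each. -/
theorem eventually_avgCount_wuLiSet_le_border (h1L : 1 < L) {c d : ℝ} (hcd : c ≤ d) :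
    ∀ᶠ n : ℕ in atTop, avgCount L n c d wuLiSet ≤ 4 * (d - c) + 1 := by
  have hL0 := hL.out
  obtain ⟨Ω, hΩm, hΩ, hlim, -⟩ := exists_dense_event (L := L) one_pos
  filter_upwards [(tendsto_order.1 hlim).2 1 one_pos, eventually_gt_atTop 0] with n hn hn0
  have hB1 : MeasurableSet (Icc c d ∩ Icc 0 (L - 1 / 2)) := measurableSet_Icc.inter measurableSet_Icc
  have hB2 : MeasurableSet (Icc c d ∩ Icc (1 / 2) L) := measurableSet_Icc.inter measurableSet_Icc
  have i1 := integrable_ncard_lone (L := L) (n := n) hB1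
    (J := fun p => Ioo p (p + 1 / 2)) (measurableSet_lone_right _)
  have i2 := integrable_ncard_lone (L := L) (n := n) hB2
    (J := fun p => Ioo (p - 1 / 2) p) (measurableSet_lone_left _)
  have h1 := integral_ncard_le_add (measurableSet_mem_nodesIn c d wuLiSet) (i1.add i2)
    (fun x => add_nonneg (Nat.cast_nonneg _) (Nat.cast_nonneg _)) (hΩm n)
    (fun x hx => by
      simp only [Pi.add_apply]
      exact_mod_cast ncard_nodesIn_wuLiSet_le_half (hΩ n hn0 x hx).mem_Icc h1L c d)
  have k := integral_add i1 i2
  rw [integral_ncard_setOf fun i => measurableSet_loneEvent hB1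
      (J := fun p => Ioo p (p + 1 / 2)) (measurableSet_lone_right _) i,
    integral_ncard_setOf fun i => measurableSet_loneEvent hB2
      (J := fun p => Ioo (p - 1 / 2) p) (measurableSet_lone_left _) i] at k
  have h3 := sum_loneEvent_le (L := L) (n := n) hB1
    (measurableSet_lone_right (1 / 2)) (b := d - c) (c := 1 / 2) (by norm_num) (by linarith)
    (measureReal_cond_Icc_le hL0 hcd inter_subset_left)
    (fun p hp => by
      refine le_trans (le_of_eq ?_) (le_measureReal_cond_Icc hL0 (c := p) (d := p + 1 / 2)
        (by linarith) hp.2.1 (by linarith [hp.2.2]) subset_rfl)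
      ring_nf)
  have h4 := sum_loneEvent_le (L := L) (n := n) hB2
    (measurableSet_lone_left (1 / 2)) (b := d - c) (c := 1 / 2) (by norm_num) (by linarith)
    (measureReal_cond_Icc_le hL0 hcd inter_subset_left)
    (fun p hp => by
      refine le_trans (le_of_eq ?_) (le_measureReal_cond_Icc hL0 (c := p - 1 / 2) (d := p)
        (by linarith) (by linarith [hp.2.1]) hp.2.2 subset_rfl)
      ring_nf)
  have h5 : avgCount L n c d wuLiSet ≤ _ := h1
  simp only [Pi.add_apply] at h5
  rw [k] at h5
  linarith

end WuLiCounts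

/-! ### MPR flooding -/

section Flooding

variable {n : ℕ}

/-- The nodes reached from `s` in `t` hops, each hop from a node to one of its relays on its
right. -/
def rightChain (x : Fin n → ℝ) (K : Fin n → Set (Fin n)) (s : Fin n) : ℕ → Set (Fin n)
  | 0 => {s}
  | t + 1 => {v | ∃ u ∈ rightChain x K s t, v ∈ K u ∧ x u < x v}

/-- The chain of relays to the right, indexed by the nonnegative integers, and to the left, indexed
by the negative ones. -/
def relayChain (L : ℝ) (x : Fin n → ℝ) (K : Fin n → Set (Fin n)) (s : Fin n) : ℤ → Set (Fin n)
  | Int.ofNat t => rightChain x K s t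
  | Int.negSucc t => rightChain (fun i => L - x i) K s (t + 1)

variable {L : ℝ} {x : Fin n → ℝ} {K : Fin n → Set (Fin n)} {s : Fin n}

theorem rightChain_subsingleton (hK : ∀ v, IsMPRSet (unitDiskGraph x) v (K v)) (t : ℕ) :
    (rightChain x K s t).Subsingleton := by
  induction t with
  | zero => exact Set.subsingleton_singleton
  | succ t ih =>
    rintro v ⟨u, hu, huv, hlt⟩ v' ⟨u', hu', huv', hlt'⟩
    have := ih hu hu'
    subst this
    exact (hK u).right_unique huv huv' hlt hlt'

theorem isMPRSet_reflect (L : ℝ) (hK : ∀ v, IsMPRSet (unitDiskGraph x) v (K v)) (v : Fin n) :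
    IsMPRSet (unitDiskGraph fun i => L - x i) v (K v) := by
  rw [unitDiskGraph_reflect]
  exact hK v

theorem relayChain_subsingleton (hK : ∀ v, IsMPRSet (unitDiskGraph x) v (K v)) (k : ℤ) :
    (relayChain L x K s k).Subsingleton := by
  cases k with
  | ofNat t => exact rightChain_subsingleton hK t
  | negSucc t => exact rightChain_subsingleton (isMPRSet_reflect L hK) (t + 1)

theorem rightChain_le (hK : ∀ v, IsMPRSet (unitDiskGraph x) v (K v)) {t : ℕ} {v : Fin n}
    (hv : v ∈ rightChain x K s t) : x v ≤ x s + t := by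
  induction t generalizing v with
  | zero => rw [show v = s from hv]; simp
  | succ t ih =>
    obtain ⟨u, hu, huv, hlt⟩ := hv
    have := ih hu
    have := abs_lt.1 ((hK u).abs_sub_lt huv)
    push_cast
    linarith

theorem le_rightChain {t : ℕ} {v : Fin n} (hv : v ∈ rightChain x K s t) : x s ≤ x v := by
  induction t generalizing v with
  | zero => rw [show v = s from hv]
  | succ t ih =>
    obtain ⟨u, hu, -, hlt⟩ := hv
    exact (ih hu).trans hlt.le

theorem rightChain_lt (hK : ∀ v, IsMPRSet (unitDiskGraph x) v (K v)) {t t' : ℕ} {v v' : Fin n}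
    (hv : v ∈ rightChain x K s t) (hv' : v' ∈ rightChain x K s t') (h : t < t') : x v < x v' := by
  induction t' generalizing v' with
  | zero => omega
  | succ t' ih =>
    obtain ⟨u, hu, -, hlt⟩ := hv'
    rcases (Nat.lt_succ_iff.1 h).eq_or_lt with rfl | h'
    · rwa [rightChain_subsingleton hK t hv hu]
    · exact (ih hu h').trans hlt

theorem le_rightChain_of_dense {η : ℝ} (hx : IsDenseSample L η x) (hη0 : 0 < η) (hη : 3 * η ≤ 1)
    (hK : ∀ v, IsMPRSet (unitDiskGraph x) v (K v)) {t : ℕ} {v : Fin n}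
    (hv : v ∈ rightChain x K s t) (hvL : x v ≤ L - 2) : x s + t - 3 * η * t ≤ x v := by
  induction t generalizing v with
  | zero => rw [show v = s from hv]; simp
  | succ t ih =>
    obtain ⟨u, hu, huv, hlt⟩ := hv
    have h1 := ih hu (by linarith)
    have h2 := (hK u).lt_of_right hx hη0 hη (by linarith) huv hlt
    push_cast
    linarith

theorem mprFloodRound_subset {V : Type*} {G : SimpleGraph V} {M : V → Set V} {s : V} (t : ℕ) :
    (mprFloodRound G M s t).2 ⊆ (mprFloodRound G M s t).1 := by
  cases t with
  | zero => exact subset_rfl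
  | succ t =>
    rintro w ⟨-, u, hu, huw, -⟩
    exact Or.inr ⟨u, hu, huw⟩

theorem mprFloodRound_mono {V : Type*} {G : SimpleGraph V} {M : V → Set V} {s : V} {t t' : ℕ}
    (h : t ≤ t') : (mprFloodRound G M s t).1 ⊆ (mprFloodRound G M s t').1 := by
  induction h with
  | refl => exact subset_rfl
  | step _ ih => exact ih.trans fun w hw => Or.inl hw

/-- The packet moves away from the source: a node that transmits received it from a node on the
side of the source. -/
theorem exists_parent (hx : Function.Injective x)
    (hK : ∀ v, IsMPRSet (unitDiskGraph x) v (K v)) (L : ℝ) (t : ℕ) {v : Fin n}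
    (hv : v ∈ (mprFloodRound (unitDiskGraph x) K s (t + 1)).2) :
    (∃ u ∈ (mprFloodRound (unitDiskGraph x) K s t).2, u ∈ rightChain x K s t ∧ v ∈ K u ∧
      x u < x v) ∨
    ∃ u ∈ (mprFloodRound (unitDiskGraph x) K s t).2, u ∈ rightChain (fun i => L - x i) K s t ∧
      v ∈ K u ∧ x v < x u := by
  induction t generalizing v with
  | zero =>
    obtain ⟨-, u, hu, huv, hvK⟩ := hv
    have hus : u = s := hu
    subst hus
    rcases lt_or_gt_of_ne (fun h => huv.1 (hx h) : x u ≠ x v) with h | h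
    · exact Or.inl ⟨u, hu, rfl, hvK, h⟩
    · exact Or.inr ⟨u, hu, rfl, hvK, h⟩
  | succ t ih =>
    obtain ⟨hnew, u, hu, huv, hvK⟩ := hv
    -- The node `v` is reached for the first time, so it is out of range of the transmitters of the
    -- preceding round.
    have hfar : ∀ u' ∈ (mprFloodRound (unitDiskGraph x) K s t).2, ¬ |x u' - x v| < 1 := by
      intro u' hu' h
      by_cases hne : u' = v
      · exact hnew (Or.inl (hne ▸ mprFloodRound_subset t hu'))
      · exact hnew (Or.inr ⟨u', hu', hne, h⟩)
    have huv1 := abs_lt.1 huv.2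
    have hne : x u ≠ x v := fun h => huv.1 (hx h)
    rcases ih hu with ⟨u', hu', hchain, huK, hlt⟩ | ⟨u', hu', hchain, huK, hlt⟩
    · refine Or.inl ⟨u, hu, ⟨u', hchain, huK, hlt⟩, hvK, ?_⟩
      -- If the packet turned back at `u`, then `v` would lie within distance one of `u'`, the node
      -- from which `u` was selected.
      by_contra hle
      have h := abs_lt.1 ((hK u').abs_sub_lt huK)
      have hlt' := lt_of_le_of_ne (not_lt.1 hle) hne.symm
      exact hfar u' hu' (abs_lt.2 ⟨by linarith, by linarith⟩)
    · refine Or.inr ⟨u, hu, ⟨u', hchain, huK, by simpa using hlt⟩, hvK, ?_⟩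
      by_contra hle
      have h := abs_lt.1 ((hK u').abs_sub_lt huK)
      have hlt' := lt_of_le_of_ne (not_lt.1 hle) hne
      exact hfar u' hu' (abs_lt.2 ⟨by linarith, by linarith⟩)

theorem mem_rightChain_of_mem_round (hx : Function.Injective x)
    (hK : ∀ v, IsMPRSet (unitDiskGraph x) v (K v)) (L : ℝ) {t : ℕ} {v : Fin n}
    (hv : v ∈ (mprFloodRound (unitDiskGraph x) K s t).2) :
    v ∈ rightChain x K s t ∨ v ∈ rightChain (fun i => L - x i) K s t := by
  cases t with
  | zero => exact Or.inl hv
  | succ t =>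
    rcases exists_parent hx hK L t hv with ⟨u, -, hu, huK, hlt⟩ | ⟨u, -, hu, huK, hlt⟩
    · exact Or.inl ⟨u, hu, huK, hlt⟩
    · exact Or.inr ⟨u, hu, huK, by simpa using hlt⟩

theorem le_of_mem_round (hx : Function.Injective x)
    (hK : ∀ v, IsMPRSet (unitDiskGraph x) v (K v)) {t : ℕ} {v : Fin n}
    (hv : v ∈ (mprFloodRound (unitDiskGraph x) K s t).2) : x v ≤ x s + t := by
  rcases mem_rightChain_of_mem_round hx hK 0 hv with h | h
  · exact rightChain_le hK h
  · have h1 := le_rightChain h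
    have : (0 : ℝ) ≤ t := t.cast_nonneg
    linarith

/-- The packet advances by less than one unit per round. -/
theorem le_of_mem_received (hx : Function.Injective x)
    (hK : ∀ v, IsMPRSet (unitDiskGraph x) v (K v)) {t : ℕ} {v : Fin n}
    (hv : v ∈ (mprFloodRound (unitDiskGraph x) K s t).1) : x v ≤ x s + t := by
  induction t generalizing v with
  | zero => rw [show v = s from hv]; simp
  | succ t ih =>
    push_cast
    rcases hv with hv | ⟨u, hu, huv⟩
    · linarith [ih hv]
    · have := le_of_mem_round hx hK hu
      have := abs_lt.1 huv.2
      linarith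

/-- The next relay lies beyond `x s + t` as long as the accumulated lag `3 η (t + 1)` is below one,
whereas the packet has not passed `x s + t` after `t` rounds. So this relay is newly reached and
transmits. -/
theorem exists_mem_round_rightChain {η : ℝ} (hx : IsDenseSample L η x) (hη0 : 0 < η)
    (hK : ∀ v, IsMPRSet (unitDiskGraph x) v (K v)) {t : ℕ} (ht : 3 * η * t < 1)
    (hη : 3 * η ≤ 1) (hs : x s + t ≤ L - 1) :
    ∃ v ∈ (mprFloodRound (unitDiskGraph x) K s t).2,
      v ∈ rightChain x K s t ∧ x s + t - 3 * η * t ≤ x v := by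
  induction t with
  | zero => exact ⟨s, rfl, rfl, by simp⟩
  | succ t ih =>
    push_cast at ht hs
    obtain ⟨v, hv, hvc, hvx⟩ := ih (by linarith) (by linarith)
    have hle := rightChain_le hK hvc
    obtain ⟨u, hu, h1, h2, h3⟩ := (hK v).exists_right hx hη0 hη (by linarith)
    refine ⟨u, ⟨fun hrec => ?_, v, hv, (hK v).adj hu, hu⟩, ⟨v, hvc, hu, h1⟩, ?_⟩
    · have := le_of_mem_received hx.injective hK hrec
      linarith
    · push_cast
      linarith

/-- All neighbours of `v` hold the packet by round `t + 1`, too early to transmit in round `t'` of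
the recursion. -/
theorem add_one_le_of_mem_round (hK : ∀ v, IsMPRSet (unitDiskGraph x) v (K v)) {t t' : ℕ}
    {v v' : Fin n} (hv : v ∈ (mprFloodRound (unitDiskGraph x) K s t).2)
    (hvc : v ∈ rightChain x K s t) (hv' : v' ∈ (mprFloodRound (unitDiskGraph x) K s t').2)
    (hvc' : v' ∈ rightChain x K s t') (h : t + 2 ≤ t') : x v + 1 ≤ x v' := by
  have hlt := rightChain_lt hK hvc hvc' (by omega)
  by_contra! hcon
  obtain ⟨t', rfl⟩ : ∃ r, t' = r + 1 := ⟨t' - 1, by omega⟩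
  refine hv'.1 (mprFloodRound_mono (by omega : t + 1 ≤ t') (Or.inr ⟨v, hv, ?_⟩))
  exact unitDiskGraph_adj_of_lt (fun h => by rw [h] at hlt; exact lt_irrefl _ hlt) (by linarith)
    (by linarith)

/-- Each hop advances by at least `1 - 3 η ≥ 1/2`, so at most `2 L ≤ N` hops are made, and the total
drift from integer steps is at most `3 η N ≤ θ`. -/
theorem mem_relayChain_of_mem_mprFloodSet {η θ : ℝ} {N : ℕ} (hx : IsDenseSample L η x)
    (hη0 : 0 < η) (hη : 6 * η ≤ 1) (hN : 2 * L ≤ N) (hθ : 3 * η * N ≤ θ)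
    (hK : ∀ v, IsMPRSet (unitDiskGraph x) v (K v)) {v : Fin n}
    (hv : v ∈ mprFloodSet (unitDiskGraph x) K s) (h2 : 2 ≤ x v) (hL2 : x v ≤ L - 2) :
    ∃ k ∈ Finset.Icc (-N : ℤ) N, v ∈ relayChain L x K s k ∧ |x v - (x s + k)| ≤ θ := by
  obtain ⟨t, ht⟩ := mem_iUnion.1 hv
  have key : ∀ {y : Fin n → ℝ}, IsDenseSample L η y →
      (∀ v, IsMPRSet (unitDiskGraph y) v (K v)) → v ∈ rightChain y K s t → y v ≤ L - 2 →
      t ≤ N ∧ |y v - (y s + t)| ≤ θ := by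
    intro y hy hKy hvy hyL
    have h3 := le_rightChain_of_dense hy hη0 (by linarith) hKy hvy hyL
    have h4 := rightChain_le hKy hvy
    have h5 := (hy.mem_Icc s).1
    have h6 : 3 * η * t ≤ 1 / 2 * t := by gcongr; linarith
    have htN : (t : ℝ) ≤ N := by linarith
    have h7 : 3 * η * t ≤ 3 * η * N := by gcongr
    exact ⟨by exact_mod_cast htN, abs_le.2 ⟨by linarith, by linarith⟩⟩
  rcases mem_rightChain_of_mem_round hx.injective hK L ht with h | h
  · obtain ⟨h3, h4⟩ := key hx hK h hL2
    exact ⟨(t : ℤ), by rw [Finset.mem_Icc]; omega, h, by simpa using h4⟩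
  · obtain ⟨h3, h4⟩ := key hx.reflect (isMPRSet_reflect L hK) h (by linarith)
    refine ⟨-(t : ℤ), by rw [Finset.mem_Icc]; omega, ?_, ?_⟩
    · cases t with
      | zero => exact h
      | succ t => exact h
    · rw [← abs_neg]
      push_cast
      convert h4 using 2
      ring

theorem exists_mem_mprFloodSet {η θ : ℝ} {N : ℕ} (hx : IsDenseSample L η x)
    (hη0 : 0 < η) (hη : 6 * η ≤ 1) (hθ : 3 * η * N ≤ θ) (hθ1 : θ < 1)
    (hK : ∀ v, IsMPRSet (unitDiskGraph x) v (K v)) {k : ℤ} (hk : k ∈ Finset.Icc (-N : ℤ) N)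
    (h1 : 1 ≤ x s + k) (hL1 : x s + k ≤ L - 1) :
    ∃ v ∈ mprFloodSet (unitDiskGraph x) K s, |x v - (x s + k)| ≤ θ := by
  have key : ∀ {y : Fin n → ℝ} {t : ℕ}, IsDenseSample L η y →
      (∀ v, IsMPRSet (unitDiskGraph y) v (K v)) → t ≤ N → y s + t ≤ L - 1 →
      ∃ v ∈ mprFloodSet (unitDiskGraph y) K s, |y v - (y s + t)| ≤ θ := by
    intro y t hy hKy htN hyL
    have htN' : (t : ℝ) ≤ N := by exact_mod_cast htN
    have h7 : 3 * η * t ≤ 3 * η * N := by gcongr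
    obtain ⟨v, hv, hvc, hvx⟩ := exists_mem_round_rightChain hy hη0 hKy (t := t) (by linarith)
      (by linarith) hyL
    have h4 := rightChain_le hKy hvc
    exact ⟨v, mem_iUnion.2 ⟨t, hv⟩, abs_le.2 ⟨by linarith, by linarith⟩⟩
  rw [Finset.mem_Icc] at hk
  obtain ⟨t, rfl | rfl⟩ := k.eq_nat_or_neg
  · simpa using key hx hK (t := t) (by omega) (by simpa using hL1)
  · obtain ⟨v, hv, hvx⟩ := key hx.reflect (isMPRSet_reflect L hK) (t := t) (by omega)
      (by push_cast at h1; linarith)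
    rw [unitDiskGraph_reflect] at hv
    refine ⟨v, hv, ?_⟩
    rw [← abs_neg]
    push_cast
    convert hvx using 2
    ring

open Classical in
-- The signed hop number determines the node, so the transmitters inject into the integers.
theorem ncard_nodesIn_mprFloodSet_le {η θ a b : ℝ} {N : ℕ}
    {K : SimpleGraph (Fin n) → Fin n → Set (Fin n)} (hx : IsDenseSample L η x)
    (hη0 : 0 < η) (hη : 6 * η ≤ 1) (hN : 2 * L ≤ N) (hθ : 3 * η * N ≤ θ)
    (hK : ∀ v, IsMPRSet (unitDiskGraph x) v (K (unitDiskGraph x) v)) (ha : 2 ≤ a)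
    (hb : b ≤ L - 2) :
    (nodesIn a b (fun G => mprFloodSet G (K G) s) x).ncard ≤
      ((Finset.Icc (-N : ℤ) N).filter fun k : ℤ => x s + k ∈ Icc (a - θ) (b + θ)).card := by
  have hex : ∀ v : Fin n, ∃ k : ℤ, v ∈ nodesIn a b (fun G => mprFloodSet G (K G) s) x →
      k ∈ Finset.Icc (-N : ℤ) N ∧ v ∈ relayChain L x (K (unitDiskGraph x)) s k ∧
        |x v - (x s + k)| ≤ θ := by
    intro v
    by_cases hv : v ∈ nodesIn a b (fun G => mprFloodSet G (K G) s) x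
    · obtain ⟨hv1, hv2, hv3⟩ := hv
      obtain ⟨k, hk⟩ := mem_relayChain_of_mem_mprFloodSet hx hη0 hη hN hθ hK hv1
        (ha.trans hv2) (hv3.trans hb)
      exact ⟨k, fun _ => hk⟩
    · exact ⟨0, fun h => absurd h hv⟩
  choose f hf using hex
  rw [← Set.ncard_coe_finset]
  refine Set.ncard_le_ncard_of_injOn f (fun v hv => ?_) (fun v hv v' hv' heq => ?_)
    (Finset.finite_toSet _)
  · obtain ⟨h1, -, h3⟩ := hf v hv
    have h4 := abs_le.1 h3
    have h5 : x v ∈ Icc a b := hv.2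
    rw [Finset.mem_coe, Finset.mem_filter]
    exact ⟨h1, by linarith [h5.1], by linarith [h5.2]⟩
  · have h1 := (hf v hv).2.1
    have h2 := (hf v' hv').2.1
    rw [← heq] at h2
    exact relayChain_subsingleton hK _ h1 h2

open Classical in
-- Conversely, nodes within `θ < 1/2` of `x s + k` differ for different `k`.
theorem card_le_ncard_nodesIn_mprFloodSet {η θ a b : ℝ} {N : ℕ}
    {K : SimpleGraph (Fin n) → Fin n → Set (Fin n)} (hx : IsDenseSample L η x)
    (hη0 : 0 < η) (hη : 6 * η ≤ 1) (hθ : 3 * η * N ≤ θ) (hθ0 : 0 ≤ θ) (hθ1 : 2 * θ < 1)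
    (hK : ∀ v, IsMPRSet (unitDiskGraph x) v (K (unitDiskGraph x) v)) (ha : 1 ≤ a)
    (hb : b ≤ L - 1) :
    ((Finset.Icc (-N : ℤ) N).filter fun k : ℤ => x s + k ∈ Icc (a + θ) (b - θ)).card ≤
      (nodesIn a b (fun G => mprFloodSet G (K G) s) x).ncard := by
  have hex : ∀ k : ℤ, ∃ v : Fin n, k ∈ (Finset.Icc (-N : ℤ) N).filter (fun k : ℤ =>
      x s + k ∈ Icc (a + θ) (b - θ)) →
      v ∈ mprFloodSet (unitDiskGraph x) (K (unitDiskGraph x)) s ∧ |x v - (x s + k)| ≤ θ := by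
    intro k
    by_cases hk : k ∈ (Finset.Icc (-N : ℤ) N).filter (fun k : ℤ =>
      x s + k ∈ Icc (a + θ) (b - θ))
    · obtain ⟨hk1, hk2, hk3⟩ := Finset.mem_filter.1 hk
      obtain ⟨v, hv⟩ := exists_mem_mprFloodSet hx hη0 hη hθ (by linarith) hK hk1 (by linarith)
        (by linarith)
      exact ⟨v, fun _ => hv⟩
    · exact ⟨s, fun h => absurd h hk⟩
  choose f hf using hex
  rw [← Set.ncard_coe_finset]
  refine Set.ncard_le_ncard_of_injOn f (fun k hk => ?_) (fun k hk k' hk' heq => ?_)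
  · rw [Finset.mem_coe] at hk
    obtain ⟨h1, h2⟩ := hf k hk
    obtain ⟨h3, h4⟩ := (Finset.mem_filter.1 hk).2
    have h5 := abs_le.1 h2
    exact ⟨h1, by constructor <;> linarith⟩
  · have h1 := abs_le.1 (hf k (Finset.mem_coe.1 hk)).2
    have h2 := abs_le.1 (hf k' (Finset.mem_coe.1 hk')).2
    rw [← heq] at h2
    have h3 : ((k : ℤ) : ℝ) < (k' + 1 : ℤ) := by push_cast; linarith
    have h4 : ((k' : ℤ) : ℝ) < (k + 1 : ℤ) := by push_cast; linarith
    have h5 := Int.cast_lt.1 h3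
    have h6 := Int.cast_lt.1 h4
    omega

/-- No density is needed: transmitters of distinct rounds of the same parity are at least one apart,
and a round has one of them in the chain. The unit cell and the parity determine the node: `4 · 2 =
8`. -/
theorem ncard_rightChain_round_le (hK : ∀ v, IsMPRSet (unitDiskGraph x) v (K v)) {c d : ℝ}
    (hcd : d < c + 4) :
    {v | (∃ t, v ∈ (mprFloodRound (unitDiskGraph x) K s t).2 ∧ v ∈ rightChain x K s t) ∧
      x v ∈ Icc c d}.ncard ≤ 8 := by
  classical
  set S := {v | (∃ t, v ∈ (mprFloodRound (unitDiskGraph x) K s t).2 ∧ v ∈ rightChain x K s t) ∧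
      x v ∈ Icc c d}
  have hex : ∀ v : Fin n, ∃ t, v ∈ S → v ∈ (mprFloodRound (unitDiskGraph x) K s t).2 ∧
      v ∈ rightChain x K s t := by
    intro v
    by_cases hv : v ∈ S
    · obtain ⟨⟨t, ht⟩, -⟩ := hv
      exact ⟨t, fun _ => ht⟩
    · exact ⟨0, fun h => absurd h hv⟩
  choose f hf using hex
  have : ((Finset.range 4 ×ˢ Finset.range 2 : Finset (ℕ × ℕ)) : Set (ℕ × ℕ)).ncard = 8 := by
    rw [Set.ncard_coe_finset]; simp
  rw [← this]
  refine Set.ncard_le_ncard_of_injOn (fun v => (⌊x v - c⌋₊, f v % 2)) (fun v hv => ?_)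
    (fun v hv v' hv' heq => ?_) (Finset.finite_toSet _)
  · have h1 : x v ∈ Icc c d := hv.2
    rw [Finset.mem_coe, Finset.mem_product, Finset.mem_range, Finset.mem_range]
    refine ⟨(Nat.floor_lt (by linarith [h1.1])).2 (by push_cast; linarith [h1.2]),
      Nat.mod_lt _ two_pos⟩
  · simp only [Prod.mk.injEq] at heq
    obtain ⟨hfl, hpar⟩ := heq
    have h1 : x v ∈ Icc c d := hv.2
    have h2 : x v' ∈ Icc c d := hv'.2
    have a1 := Nat.floor_le (sub_nonneg.2 h1.1)
    have a2 := Nat.lt_floor_add_one (x v - c)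
    have a3 := Nat.floor_le (sub_nonneg.2 h2.1)
    have a4 := Nat.lt_floor_add_one (x v' - c)
    rw [hfl] at a1 a2
    obtain ⟨b1, b2⟩ := hf v hv
    obtain ⟨b3, b4⟩ := hf v' hv'
    rcases lt_trichotomy (f v) (f v') with h | h | h
    · have := add_one_le_of_mem_round hK b1 b2 b3 b4 (by omega)
      linarith
    · rw [← h] at b4
      exact rightChain_subsingleton hK _ b2 b4
    · have := add_one_le_of_mem_round hK b3 b4 b1 b2 (by omega)
      linarith

theorem ncard_nodesIn_mprFloodSet_le_border (hx : Function.Injective x)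
    {K : SimpleGraph (Fin n) → Fin n → Set (Fin n)}
    (hK : ∀ v, IsMPRSet (unitDiskGraph x) v (K (unitDiskGraph x) v)) {c d : ℝ}
    (hcd : d < c + 4) : (nodesIn c d (fun G => mprFloodSet G (K G) s) x).ncard ≤ 16 := by
  have hsub : nodesIn c d (fun G => mprFloodSet G (K G) s) x ⊆
      {v | (∃ t, v ∈ (mprFloodRound (unitDiskGraph x) (K (unitDiskGraph x)) s t).2 ∧
        v ∈ rightChain x (K (unitDiskGraph x)) s t) ∧ x v ∈ Icc c d} ∪
      {v | (∃ t, v ∈ (mprFloodRound (unitDiskGraph fun i => 0 - x i) (K (unitDiskGraph x)) s t).2 ∧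
        v ∈ rightChain (fun i => 0 - x i) (K (unitDiskGraph x)) s t) ∧
        0 - x v ∈ Icc (0 - d) (0 - c)} := by
    rintro v ⟨hv, hv1, hv2⟩
    obtain ⟨t, ht⟩ := mem_iUnion.1 hv
    rw [unitDiskGraph_reflect]
    rcases mem_rightChain_of_mem_round hx hK 0 ht with h | h
    · exact Or.inl ⟨⟨t, ht, h⟩, hv1, hv2⟩
    · exact Or.inr ⟨⟨t, ht, h⟩, by linarith, by linarith⟩
  refine (Set.ncard_le_ncard hsub).trans ((Set.ncard_union_le _ _).trans ?_)
  have h1 := ncard_rightChain_round_le (s := s) hK hcd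
  have h2 := ncard_rightChain_round_le (s := s) (x := fun i => 0 - x i) (isMPRSet_reflect 0 hK)
    (c := 0 - d) (d := 0 - c) (by linarith)
  omega

end Flooding

/-! ### Average number of nodes of the MPR flooding CDS -/

section FloodAverages

variable {L : ℝ} [hL : Fact (0 < L)] {n : ℕ}

/-- After the substitution `q = p + k`, summing over `k` leaves the integral over `[α, β]` of the
number of integers in `[q - L, q]`, which lies between `L - 1` and `L + 1`. This is the source of
the factors `1 ± 1 / L`. -/
theorem measureReal_translate (k : ℤ) (α β : ℝ) :
    (cond volume (Icc 0 L)).real {p | p + k ∈ Icc α β} =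
      (∫ q in Icc α β, {q : ℝ | q - k ∈ Icc 0 L}.indicator (1 : ℝ → ℝ) q) / L := by
  have hm : MeasurableSet {q : ℝ | q - k ∈ Icc 0 L} :=
    (measurable_id.sub_const (k : ℝ)) measurableSet_Icc
  rw [measureReal_cond_Icc hL.out, integral_indicator_one hm, measureReal_restrict_apply hm]
  congr 1
  have h1 : Icc 0 L ∩ {p : ℝ | p + k ∈ Icc α β} =
      (fun p : ℝ => p + k) ⁻¹' ({q : ℝ | q - k ∈ Icc 0 L} ∩ Icc α β) := by
    ext p
    simp only [mem_inter_iff, mem_preimage, mem_ofPred_eq, add_sub_cancel_right]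
  rw [h1, measureReal_def, measureReal_def, measure_preimage_add_right]

open Classical in
theorem sum_indicator_eq_card (N : ℕ) (q : ℝ) :
    ∑ k ∈ Finset.Icc (-N : ℤ) N, {q : ℝ | q - k ∈ Icc 0 L}.indicator (1 : ℝ → ℝ) q =
      ((Finset.Icc (-N : ℤ) N).filter fun k : ℤ => q - k ∈ Icc 0 L).card := by
  rw [← Finset.sum_boole]
  exact Finset.sum_congr rfl fun k _ => by simp [Set.indicator_apply]

theorem sum_indicator_le (N : ℕ) (q : ℝ) :
    ∑ k ∈ Finset.Icc (-N : ℤ) N, {q : ℝ | q - k ∈ Icc 0 L}.indicator (1 : ℝ → ℝ) q ≤ L + 1 := by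
  classical
  rw [sum_indicator_eq_card]
  have hsub : (Finset.Icc (-N : ℤ) N).filter (fun k : ℤ => q - k ∈ Icc 0 L) ⊆
      Finset.Icc ⌈q - L⌉ ⌊q⌋ := by
    intro k hk
    obtain ⟨h1, h2⟩ := (Finset.mem_filter.1 hk).2
    rw [Finset.mem_Icc]
    exact ⟨Int.ceil_le.2 (by linarith), Int.le_floor.2 (by linarith)⟩
  have h1 : (((Finset.Icc (-N : ℤ) N).filter (fun k : ℤ => q - k ∈ Icc 0 L)).card : ℝ) ≤
      ((⌊q⌋ + 1 - ⌈q - L⌉).toNat : ℝ) := by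
    have := Finset.card_le_card hsub
    rw [Int.card_Icc] at this
    exact_mod_cast this
  refine h1.trans ?_
  have h2 : (((⌊q⌋ + 1 - ⌈q - L⌉).toNat : ℤ) : ℝ) = max ((⌊q⌋ : ℝ) + 1 - ⌈q - L⌉) 0 := by
    rw [Int.toNat_eq_max]; push_cast; rfl
  rw [← Int.cast_natCast, h2, max_le_iff]
  constructor
  · linarith [Int.floor_le q, Int.le_ceil (q - L)]
  · linarith [hL.out]

theorem le_sum_indicator_translate {N : ℕ} (hN : L ≤ N) {q : ℝ} (h0 : 0 ≤ q) (h1 : q ≤ L) :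
    L - 1 ≤
      ∑ k ∈ Finset.Icc (-N : ℤ) N, {q : ℝ | q - k ∈ Icc 0 L}.indicator (1 : ℝ → ℝ) q := by
  classical
  rw [sum_indicator_eq_card]
  have hsub : Finset.Icc ⌈q - L⌉ ⌊q⌋ ⊆
      (Finset.Icc (-N : ℤ) N).filter (fun k : ℤ => q - k ∈ Icc 0 L) := by
    intro k hk
    rw [Finset.mem_Icc, Int.ceil_le, Int.le_floor] at hk
    rw [Finset.mem_filter, Finset.mem_Icc]
    refine ⟨⟨?_, ?_⟩, by linarith [hk.2], by linarith [hk.1]⟩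
    · have : ((-N : ℤ) : ℝ) ≤ k := by push_cast; linarith [hk.1]
      exact_mod_cast this
    · have : (k : ℝ) ≤ (N : ℤ) := by push_cast; linarith [hk.2]
      exact_mod_cast this
  have h2 : ((⌊q⌋ + 1 - ⌈q - L⌉).toNat : ℝ) ≤
      (((Finset.Icc (-N : ℤ) N).filter (fun k : ℤ => q - k ∈ Icc 0 L)).card : ℝ) := by
    have := Finset.card_le_card hsub
    rw [Int.card_Icc] at this
    exact_mod_cast this
  refine le_trans ?_ h2
  have h3 : ((⌊q⌋ + 1 - ⌈q - L⌉ : ℤ) : ℝ) ≤ (((⌊q⌋ + 1 - ⌈q - L⌉).toNat : ℤ) : ℝ) :=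
    Int.cast_le.2 (Int.self_le_toNat _)
  rw [← Int.cast_natCast (R := ℝ)]
  refine le_trans ?_ h3
  push_cast
  linarith [Int.lt_floor_add_one q, Int.ceil_lt_add_one (q - L)]

theorem integrableOn_indicator_translate (k : ℤ) (α β : ℝ) :
    IntegrableOn ({q : ℝ | q - k ∈ Icc 0 L}.indicator (1 : ℝ → ℝ)) (Icc α β) :=
  (integrable_const (1 : ℝ)).indicator ((measurable_id.sub_const (k : ℝ)) measurableSet_Icc)

theorem sum_measureReal_translate (N : ℕ) (α β : ℝ) :
    ∑ k ∈ Finset.Icc (-N : ℤ) N, (cond volume (Icc 0 L)).real {p | p + k ∈ Icc α β} =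
      (∫ q in Icc α β, ∑ k ∈ Finset.Icc (-N : ℤ) N,
        {q : ℝ | q - k ∈ Icc 0 L}.indicator (1 : ℝ → ℝ) q) / L := by
  rw [integral_finsetSum _ fun k _ => integrableOn_indicator_translate k α β, Finset.sum_div]
  exact Finset.sum_congr rfl fun k _ => measureReal_translate k α β

theorem sum_measureReal_translate_le (N : ℕ) {α β : ℝ} (h : α ≤ β) :
    ∑ k ∈ Finset.Icc (-N : ℤ) N, (cond volume (Icc 0 L)).real {p | p + k ∈ Icc α β} ≤
      (1 + 1 / L) * (β - α) := by
  have hL0 := hL.out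
  rw [sum_measureReal_translate, div_le_iff₀ hL0]
  calc _ ≤ ∫ _q in Icc α β, (L + 1) :=
        integral_mono (integrable_finsetSum _ fun k _ => integrableOn_indicator_translate k α β)
          (integrable_const _) fun q => sum_indicator_le N q
    _ = _ := by
        simp [h]
        field_simp

theorem le_sum_measureReal_translate {N : ℕ} (hN : L ≤ N) (h1L : 1 ≤ L) {α β : ℝ} (hα : 0 ≤ α)
    (hβ : β ≤ L) :
    (1 - 1 / L) * (β - α) ≤
      ∑ k ∈ Finset.Icc (-N : ℤ) N, (cond volume (Icc 0 L)).real {p | p + k ∈ Icc α β} := by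
  have hL0 := hL.out
  have h1 : 0 ≤ 1 - 1 / L := sub_nonneg.2 ((div_le_one hL0).2 h1L)
  rcases le_total α β with h | h
  · rw [sum_measureReal_translate, le_div_iff₀ hL0]
    calc _ = ∫ _q in Icc α β, (L - 1) := by
          simp [h]
          field_simp
      _ ≤ _ := setIntegral_mono_on (integrableOn_const (by simp))
          (integrable_finsetSum _ fun k _ => integrableOn_indicator_translate k α β)
          measurableSet_Icc fun q hq => le_sum_indicator_translate hN (hα.trans hq.1)
            (hq.2.trans hβ)
  · exact (mul_nonpos_of_nonneg_of_nonpos h1 (by linarith)).trans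
      (Finset.sum_nonneg fun _ _ => measureReal_nonneg)

theorem measurableSet_translate (s : Fin n) (α β : ℝ) (k : ℤ) :
    MeasurableSet {x : Fin n → ℝ | x s + k ∈ Icc α β} :=
  (show Measurable fun x : Fin n → ℝ => x s + (k : ℝ) by fun_prop) measurableSet_Icc

open Classical in
theorem card_filter_translate (s : Fin n) (N : ℕ) (α β : ℝ) (x : Fin n → ℝ) :
    (((Finset.Icc (-N : ℤ) N).filter fun k : ℤ => x s + k ∈ Icc α β).card : ℝ) =
      ∑ k ∈ Finset.Icc (-N : ℤ) N,
        {x : Fin n → ℝ | x s + k ∈ Icc α β}.indicator (1 : (Fin n → ℝ) → ℝ) x := by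
  rw [← Finset.sum_boole]
  exact Finset.sum_congr rfl fun k _ => by simp [Set.indicator_apply]

theorem integrable_sum_translate (s : Fin n) (N : ℕ) (α β : ℝ) :
    Integrable (fun x => ∑ k ∈ Finset.Icc (-N : ℤ) N,
      {x : Fin n → ℝ | x s + k ∈ Icc α β}.indicator (1 : (Fin n → ℝ) → ℝ) x) (positionLaw L n) :=
  integrable_finsetSum _ fun k _ =>
    (integrable_const (1 : ℝ)).indicator (measurableSet_translate s α β k)

theorem integral_sum_translate (s : Fin n) (N : ℕ) (α β : ℝ) :
    ∫ x, ∑ k ∈ Finset.Icc (-N : ℤ) N,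
      {x : Fin n → ℝ | x s + k ∈ Icc α β}.indicator (1 : (Fin n → ℝ) → ℝ) x ∂(positionLaw L n) =
    ∑ k ∈ Finset.Icc (-N : ℤ) N, (cond volume (Icc 0 L)).real {p | p + k ∈ Icc α β} := by
  have h : ∀ k ∈ Finset.Icc (-N : ℤ) N, Integrable
      ({x : Fin n → ℝ | x s + k ∈ Icc α β}.indicator (1 : (Fin n → ℝ) → ℝ)) (positionLaw L n) :=
    fun k _ => (integrable_const (1 : ℝ)).indicator (measurableSet_translate s α β k)
  rw [integral_finsetSum _ h]
  refine Finset.sum_congr rfl fun k _ => ?_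
  rw [integral_indicator_one (measurableSet_translate s α β k)]
  have hm : MeasurableSet {p : ℝ | p + k ∈ Icc α β} :=
    (measurable_id.add_const (k : ℝ)) measurableSet_Icc
  conv_rhs => rw [← map_eval_measure_pi (μ := cond volume (Icc 0 L)) s]
  rw [map_measureReal_apply (measurable_pi_apply s) hm]
  rfl

variable {M : SelectionRule}

/-- Order of choices: the number `N` of hops depends on `L` only, then the admissible drift `θ`,
then the gap size `η` small enough for `N` hops. -/
theorem exists_flood_precision (L : ℝ) {δ : ℝ} (hδ : 0 < δ) :
    ∃ (η θ : ℝ) (N : ℕ), 0 < η ∧ 6 * η ≤ 1 ∧ 2 * L ≤ N ∧ 3 * η * N ≤ θ ∧ 0 ≤ θ ∧ 2 * θ < 1 ∧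
      4 * θ ≤ δ := by
  obtain ⟨N, hN⟩ := exists_nat_ge (2 * L)
  have hN0 : (0 : ℝ) ≤ N := N.cast_nonneg
  have hθ : 0 < min (1 / 4) (δ / 4) := by positivity
  have h1 : min (1 / 4) (δ / 4) ≤ 1 / 4 := min_le_left _ _
  have h2 : min (1 / 4) (δ / 4) ≤ δ / 4 := min_le_right _ _
  set θ := min (1 / 4) (δ / 4)
  refine ⟨θ / (3 * (N + 1)), θ, N, by positivity, ?_, hN, ?_, hθ.le, by linarith, by linarith⟩
  · have : θ / (3 * (N + 1)) ≤ θ / 3 := by gcongr; linarith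
    linarith
  · have : 3 * (θ / (3 * (N + 1))) * N = θ * (N / (N + 1)) := by field_simp
    rw [this]
    exact mul_le_of_le_one_right hθ.le ((div_le_one (by positivity)).2 (by linarith))

theorem eventually_avgCount_mprFloodSet_le (hM : IsMPRRule M) (h1L : 1 ≤ L) {a b : ℝ} (ha : 2 ≤ a)
    (hab : a ≤ b) (hb : b ≤ L - 2) {δ : ℝ} (hδ : 0 < δ) :
    ∀ᶠ n : ℕ in atTop, ∀ s : Fin n,
      avgCount L n a b (fun G => mprFloodSet G (M n G) s) ≤ (1 + 1 / L) * (b - a) + δ := by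
  classical
  have hL0 := hL.out
  obtain ⟨η, θ, N, hη0, hη, hN, hθ, hθ0, hθ1, hθδ⟩ := exists_flood_precision L (half_pos hδ)
  obtain ⟨Ω, hΩm, hΩ, hlim, -⟩ := exists_dense_event (L := L) hη0
  filter_upwards [(tendsto_order.1 hlim).2 _ (half_pos hδ), eventually_gt_atTop 0] with n hn hn0 s
  have h1 := integral_ncard_le_add
    (measurableSet_mem_nodesIn a b (fun G => mprFloodSet G (M n G) s))
    (integrable_sum_translate (L := L) s N (a - θ) (b + θ))
    (fun x => Finset.sum_nonneg fun _ _ => Set.indicator_nonneg (fun _ _ => zero_le_one) _) (hΩm n)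
    (fun x hx => by
      rw [← card_filter_translate]
      exact_mod_cast ncard_nodesIn_mprFloodSet_le (hΩ n hn0 x hx) hη0 hη hN hθ (hM n x) ha hb)
  rw [integral_sum_translate] at h1
  have h2 := sum_measureReal_translate_le (L := L) N (α := a - θ) (β := b + θ) (by linarith)
  have h3 : avgCount L n a b (fun G => mprFloodSet G (M n G) s) ≤ _ := h1
  have h4 : 1 / L ≤ 1 := (div_le_one hL0).2 h1L
  have h5 : (1 + 1 / L) * (b + θ - (a - θ)) ≤ (1 + 1 / L) * (b - a) + 4 * θ := by nlinarith
  linarith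

theorem eventually_le_avgCount_mprFloodSet (hM : IsMPRRule M) (h1L : 1 ≤ L) {a b : ℝ} (ha : 1 ≤ a)
    (hb : b ≤ L - 1) {δ : ℝ} (hδ : 0 < δ) :
    ∀ᶠ n : ℕ in atTop, ∀ s : Fin n,
      (1 - 1 / L) * (b - a) - δ ≤ avgCount L n a b (fun G => mprFloodSet G (M n G) s) := by
  classical
  have hL0 := hL.out
  obtain ⟨η, θ, N, hη0, hη, hN, hθ, hθ0, hθ1, hθδ⟩ := exists_flood_precision L (half_pos hδ)
  obtain ⟨Ω, hΩm, hΩ, hlim, -⟩ := exists_dense_event (L := L) hη0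
  have hNpos : (0 : ℝ) < 2 * N + 1 := by positivity
  filter_upwards [(tendsto_order.1 hlim).2 (δ / 2 / (2 * N + 1)) (by positivity),
    eventually_gt_atTop 0] with n hn hn0 s
  have h1 := integral_le_integral_add
    (integrable_sum_translate (L := L) s N (a + θ) (b - θ))
    (integrable_ncard (measurableSet_mem_nodesIn a b (fun G => mprFloodSet G (M n G) s))) (hΩm n)
    -- The crude bound is the number of integers in `[-N, N]`.
    (K := 2 * N + 1)
    (fun x hx => by
      rw [← card_filter_translate]
      exact_mod_cast card_le_ncard_nodesIn_mprFloodSet (hΩ n hn0 x hx) hη0 hη hθ hθ0 hθ1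
        (hM n x) ha hb)
    (fun x => by
      rw [← card_filter_translate]
      have h2 : ((Finset.Icc (-N : ℤ) N).filter
          fun k : ℤ => x s + k ∈ Icc (a + θ) (b - θ)).card ≤ 2 * N + 1 :=
        (Finset.card_filter_le _ _).trans (by rw [Int.card_Icc]; omega)
      have h3 : (((Finset.Icc (-N : ℤ) N).filter
          fun k : ℤ => x s + k ∈ Icc (a + θ) (b - θ)).card : ℝ) ≤ 2 * N + 1 := by
        exact_mod_cast h2
      have h4 : (0 : ℝ) ≤ (nodesIn a b (fun G => mprFloodSet G (M n G) s) x).ncard :=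
        Nat.cast_nonneg _
      linarith)
  rw [integral_sum_translate] at h1
  have h2 := le_sum_measureReal_translate (L := L) (N := N) (by linarith) h1L (α := a + θ)
    (β := b - θ) (by linarith) (by linarith)
  have h3 : _ ≤ avgCount L n a b (fun G => mprFloodSet G (M n G) s) + _ := h1
  have h4 : 0 ≤ 1 / L := by positivity
  have h5 : (1 - 1 / L) * (b - a) - 4 * θ ≤ (1 - 1 / L) * (b - θ - (a + θ)) := by nlinarith
  have h6 : (2 * N + 1) * (positionLaw L n).real (Ω n)ᶜ ≤ δ / 2 := by
    have hn1 : (1 : ℝ) ≤ n := by exact_mod_cast hn0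
    have h7 : (positionLaw L n).real (Ω n)ᶜ ≤ n * (positionLaw L n).real (Ω n)ᶜ :=
      le_mul_of_one_le_left measureReal_nonneg hn1
    have h8 := h7.trans hn.le
    rw [le_div_iff₀ hNpos] at h8
    linarith
  linarith

theorem eventually_avgCount_mprFloodSet_le_border (hM : IsMPRRule M) {c d : ℝ}
    (hcd : d < c + 4) :
    ∀ᶠ n : ℕ in atTop, ∀ s : Fin n,
      avgCount L n c d (fun G => mprFloodSet G (M n G) s) ≤ 17 := by
  obtain ⟨Ω, hΩm, hΩ, hlim, -⟩ := exists_dense_event (L := L) one_pos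
  filter_upwards [(tendsto_order.1 hlim).2 1 one_pos, eventually_gt_atTop 0] with n hn hn0 s
  have h1 := integral_ncard_le_add
    (measurableSet_mem_nodesIn c d (fun G => mprFloodSet G (M n G) s))
    (integrable_const (μ := positionLaw L n) (16 : ℝ)) (fun _ => by norm_num) (hΩm n)
    (fun x hx => by
      exact_mod_cast ncard_nodesIn_mprFloodSet_le_border (hΩ n hn0 x hx).injective (hM n x) hcd)
  have h3 : avgCount L n c d (fun G => mprFloodSet G (M n G) s) ≤ _ := h1
  simp at h3
  linarith

end FloodAverages

/-! ### Total degrees -/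

section TotalDegrees

/-- The middle `[3, L - 3]` is governed by the density `c`, the two end strips contain on average at
most `17` nodes each. For `L < 6` there is no middle and two halves suffice. The family `F n` stands
for all sources at once. -/
theorem abs_avgDegree_sub_le_whole {L : ℝ} (h1L : 1 < L) {c : ℝ} (hc0 : 0 ≤ c) (hc2 : c ≤ 2)
    {F : ∀ n, Set (SimpleGraph (Fin n) → Set (Fin n))}
    (hmid : 6 ≤ L → ∀ᶠ n : ℕ in atTop, ∀ A ∈ F n, |avgCount L n 3 (L - 3) A - c * (L - 6)| ≤ 2)
    (hborder : ∀ a b, 0 ≤ a → a ≤ b → b ≤ L → b ≤ a + 3 → ∀ᶠ n : ℕ in atTop, ∀ A ∈ F n,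
      avgCount L n a b A ≤ 17) :
    ∀ᶠ n : ℕ in atTop, ∀ A ∈ F n,
      |avgDegree L n 0 L A - 2 * c * L * (n / L)| ≤ 73 * (n / L) := by
  have hL0 : 0 < L := by linarith
  have : Fact (0 < L) := ⟨hL0⟩
  have hcL : 0 ≤ c * L := by positivity
  -- Since `ε` may depend on `L`, it is chosen to make the relative error of the degrees contribute
  -- at most one in total: `(2 + ε)(c L + 36) + ε = 2 c L + 73`.
  set ε := 1 / (c * L + 37) with hε
  have hε0 : 0 < ε := by positivity
  have hε1 : ε * (c * L + 37) = 1 := by rw [hε]; field_simp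
  have hε2 : ε ≤ 1 := by
    rw [hε, div_le_one (by positivity)]; linarith
  -- `36 = 17 + 17 + 2`, two strips and the error of the middle.
  have hup : ∀ᶠ n : ℕ in atTop, ∀ A ∈ F n, avgCount L n 0 L A ≤ c * L + 36 := by
    rcases lt_or_ge L 6 with h6 | h6
    · filter_upwards [hborder 0 (L / 2) le_rfl (by linarith) (by linarith) (by linarith),
        hborder (L / 2) L (by linarith) (by linarith) le_rfl (by linarith)] with n h1 h2 A hA
      have := avgCount_le_add (L := L) 0 (L / 2) L A
      linarith [h1 A hA, h2 A hA]
    · filter_upwards [hborder 0 3 le_rfl (by norm_num) (by linarith) (by norm_num),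
        hborder (L - 3) L (by linarith) (by linarith) le_rfl (by linarith), hmid h6]
        with n h1 h2 h3 A hA
      have e1 := avgCount_le_add (L := L) 0 3 L A
      have e2 := avgCount_le_add (L := L) 3 (L - 3) L A
      have e3 := (abs_le.1 (h3 A hA)).2
      linarith [h1 A hA, h2 A hA]
  have hlow : ∀ᶠ n : ℕ in atTop, ∀ A ∈ F n,
      n / L * (2 * c * L - 73) ≤ avgDegree L n 0 L A := by
    rcases lt_or_ge L 6 with h6 | h6
    · refine Eventually.of_forall fun n A _ => le_trans ?_ (avgDegree_nonneg _ _ _)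
      have : c * L ≤ 2 * 6 := by gcongr
      exact mul_nonpos_of_nonneg_of_nonpos (by positivity) (by linarith)
    · filter_upwards [hmid h6, avgDegree_bounds (L := L) hε0] with n h3 h4 A hA
      refine le_trans ?_ (((h4 A 3 (L - 3)).2 (by norm_num) (by linarith)).trans
        (avgDegree_mono (by norm_num) (by linarith) A))
      refine mul_le_mul_of_nonneg_left ?_ (by positivity)
      have e3 := (abs_le.1 (h3 A hA)).1
      have e4 : (2 - ε) * (c * (L - 6) - 2) ≤ (2 - ε) * avgCount L n 3 (L - 3) A := by
        gcongr
        · linarith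
        · linarith
      have e5 : ε * (c * (L - 6) - 2) + ε ≤ ε * (c * L + 37) := by nlinarith
      linarith
  filter_upwards [hup, hlow, avgDegree_bounds (L := L) hε0] with n h1 h2 h3 A hA
  have hn : 0 ≤ (n : ℝ) / L := by positivity
  have e1 := (h3 A 0 L).1
  have e2 : n / L * ((2 + ε) * avgCount L n 0 L A + ε) ≤ n / L * (2 * c * L + 73) := by
    refine mul_le_mul_of_nonneg_left ?_ hn
    have e4 : (2 + ε) * avgCount L n 0 L A ≤ (2 + ε) * (c * L + 36) :=
      mul_le_mul_of_nonneg_left (h1 A hA) (by linarith)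
    linarith
  have e3 := h2 A hA
  rw [abs_le]
  constructor <;> linarith

theorem abs_avgDegree_sub_le_segment {L : ℝ} (hL0 : 0 < L) {c ε ℓ a : ℝ} (hc0 : 0 ≤ c)
    (hℓ : 0 ≤ ℓ) (hε : 0 < ε) (ha : 1 ≤ a) (haL : a + ℓ ≤ L - 1)
    {F : ∀ n, Set (SimpleGraph (Fin n) → Set (Fin n))}
    (h : ∀ᶠ n : ℕ in atTop, ∀ A ∈ F n, |avgCount L n a (a + ℓ) A - c * ℓ| ≤ ε / 4) :
    ∀ᶠ n : ℕ in atTop, ∀ A ∈ F n,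
      |avgDegree L n a (a + ℓ) A - 2 * c * ℓ * (n / L)| ≤ ε * (n / L) := by
  have : Fact (0 < L) := ⟨hL0⟩
  have hcℓ : 0 ≤ c * ℓ := by positivity
  have hpos : 0 < c * ℓ + ε / 4 + 1 := by positivity
  -- The count error `ε / 4` doubles to `ε / 2` in the degrees; `r` keeps the relative degree error
  -- below the other half.
  obtain ⟨r, hr0, hr1, hr⟩ : ∃ r : ℝ, 0 < r ∧ r ≤ 1 ∧ r * (c * ℓ + ε / 4 + 1) ≤ ε / 2 := by
    refine ⟨min 1 (ε / 2 / (c * ℓ + ε / 4 + 1)), by positivity, min_le_left _ _, ?_⟩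
    rw [← le_div_iff₀ hpos]
    exact min_le_right _ _
  filter_upwards [h, avgDegree_bounds (L := L) hr0] with n h1 h2 A hA
  have hn : 0 ≤ (n : ℝ) / L := by positivity
  obtain ⟨e1, e2⟩ := h2 A a (a + ℓ)
  have e2 := e2 ha haL
  obtain ⟨e3, e4⟩ := abs_le.1 (h1 A hA)
  have f1 : n / L * ((2 + r) * avgCount L n a (a + ℓ) A + r) ≤ n / L * (2 * c * ℓ + ε) := by
    refine mul_le_mul_of_nonneg_left ?_ hn
    have : (2 + r) * avgCount L n a (a + ℓ) A ≤ (2 + r) * (c * ℓ + ε / 4) :=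
      mul_le_mul_of_nonneg_left (by linarith) (by linarith)
    linarith
  have f2 : n / L * (2 * c * ℓ - ε) ≤ n / L * ((2 - r) * avgCount L n a (a + ℓ) A - r) := by
    refine mul_le_mul_of_nonneg_left ?_ hn
    have h3 : (2 - r) * (c * ℓ - ε / 4) ≤ (2 - r) * avgCount L n a (a + ℓ) A :=
      mul_le_mul_of_nonneg_left (by linarith) (by linarith)
    nlinarith
  rw [abs_le]
  constructor <;> linarith

theorem abs_avgDegreeFlood_sub_le {M : SelectionRule} {L a b B r : ℝ} {n : ℕ} (hn : 0 < n)
    (h : ∀ s : Fin n, |avgDegree L n a b (fun G => mprFloodSet G (M n G) s) - B| ≤ r) :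
    |avgDegreeFlood M L n a b - B| ≤ r := by
  have hn' : (0 : ℝ) < n := by exact_mod_cast hn
  have e : avgDegreeFlood M L n a b - B =
      (∑ s : Fin n, (avgDegree L n a b (fun G => mprFloodSet G (M n G) s) - B)) / n := by
    rw [avgDegreeFlood, Finset.sum_sub_distrib, sub_div]
    simp [hn'.ne']
  rw [e, abs_div, abs_of_pos hn', div_le_iff₀ hn']
  refine (Finset.abs_sum_le_sum_abs _ _).trans ((Finset.sum_le_sum fun s _ => h s).trans_eq ?_)
  simp [mul_comm]

end TotalDegrees

theorem theorem2 :
    -- The network occupies `[0, ℓ]`; whole sets; error `O(rate)`, uniformly in `ℓ`.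
    (∃ C : ℝ, ∀ ℓ : ℝ, 1 < ℓ → ∀ M : SelectionRule, IsMPRRule M →
      ∀ᶠ n : ℕ in atTop, ∀ rate : ℝ, rate = n / ℓ →
        |avgDegreeFlood M ℓ n 0 ℓ - 2 * ℓ * rate| ≤ C * rate ∧
        |avgDegreeMPR M ℓ n 0 ℓ - 3 * ℓ * rate| ≤ C * rate ∧
        |avgDegreeWuLi ℓ n 0 ℓ - 4 * ℓ * rate| ≤ C * rate) ∧
    -- The network occupies `[0, ℓ + 2 m]`; parts of the sets in `[m, m + ℓ]`, away from the ends.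
    (∀ ℓ : ℝ, 1 < ℓ → ∀ M : SelectionRule, IsMPRRule M →
      ∀ ε : ℝ, 0 < ε → ∀ᶠ m : ℝ in atTop,
      ∀ᶠ n : ℕ in atTop, ∀ rate : ℝ, rate = n / (ℓ + 2 * m) →
        |avgDegreeFlood M (ℓ + 2 * m) n m (m + ℓ) - 2 * ℓ * rate| ≤ ε * rate ∧
        |avgDegreeMPR M (ℓ + 2 * m) n m (m + ℓ) - 3 * ℓ * rate| ≤ ε * rate ∧
        |avgDegreeWuLi (ℓ + 2 * m) n m (m + ℓ) - 4 * ℓ * rate| ≤ ε * rate) := by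
  constructor
  · refine ⟨73, fun L h1L M hM => ?_⟩
    have hL0 : 0 < L := by linarith
    have : Fact (0 < L) := ⟨hL0⟩
    have hflood := abs_avgDegree_sub_le_whole (L := L) h1L (c := 1) zero_le_one one_le_two
      (F := fun n => Set.range fun (s : Fin n) G => mprFloodSet G (M n G) s)
      (fun h6 => by
        filter_upwards [eventually_avgCount_mprFloodSet_le (L := L) hM h1L.le (a := 3)
            (b := L - 3) (by norm_num) (by linarith) (by linarith) one_pos,
          eventually_le_avgCount_mprFloodSet (L := L) hM h1L.le (a := 3)
            (b := L - 3) (by norm_num) (by linarith) one_pos] with n h1 h2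
        rintro A ⟨s, rfl⟩
        -- The error from the position of the source is bounded uniformly in `L`, which makes the
        -- final constant absolute.
        have h3 : 1 / L * (L - 3 - 3) ≤ 1 := by
          rw [one_div, inv_mul_le_iff₀ hL0]; linarith
        have h4 := h1 s
        have h5 := h2 s
        rw [abs_le]
        constructor <;> linarith)
      (fun a b _ _ _ h3 => by
        filter_upwards [eventually_avgCount_mprFloodSet_le_border (L := L) hM (c := a) (d := b)
          (by linarith)] with n h1
        rintro A ⟨s, rfl⟩
        exact h1 s)
    have hmpr := abs_avgDegree_sub_le_whole (L := L) h1L (c := 3 / 2) (by norm_num) (by norm_num)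
      (F := fun n => {fun G => mprCDS G (M n G)})
      (fun h6 => by
        filter_upwards [eventually_avgCount_mprCDS_le (L := L) hM (a := 3)
            (b := L - 3) (by norm_num) (by linarith) (by linarith) one_pos,
          eventually_le_avgCount_mprCDS (L := L) hM (a := 3)
            (b := L - 3) (by norm_num) (by linarith) (by linarith) one_pos] with n h1 h2
        rintro A rfl
        rw [abs_le]
        constructor <;> linarith)
      (fun a b h0 h1 h2 h3 => by
        -- On a strip of length at most `3` the bound is `3 · 3 + 4 = 13 ≤ 17`.
        filter_upwards [eventually_avgCount_mprCDS_le_border (L := L) hM h1L h0 h1 h2] with n h4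
        rintro A rfl
        linarith)
    have hwl := abs_avgDegree_sub_le_whole (L := L) h1L (c := 2) (by norm_num) le_rfl
      (F := fun n => {wuLiSet})
      (fun h6 => by
        filter_upwards [eventually_avgCount_wuLiSet_le (L := L) (a := 3)
            (b := L - 3) (by norm_num) (by linarith) (by linarith) one_pos,
          eventually_le_avgCount_wuLiSet (L := L) (a := 3)
            (b := L - 3) (by norm_num) (by linarith) (by linarith) one_pos] with n h1 h2
        rintro A rfl
        rw [abs_le]
        constructor <;> linarith)
      (fun a b h0 h1 h2 h3 => by
        filter_upwards [eventually_avgCount_wuLiSet_le_border (L := L) h1L h1] with n h4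
        rintro A rfl
        linarith)
    filter_upwards [hflood, hmpr, hwl, eventually_gt_atTop 0] with n h1 h2 h3 hn rate hrate
    rw [hrate]
    refine ⟨abs_avgDegreeFlood_sub_le hn fun s => ?_, ?_, ?_⟩
    · convert h1 _ ⟨s, rfl⟩ using 3
      norm_num
    · have := h2 _ rfl
      rw [show (2 : ℝ) * (3 / 2) = 3 by norm_num] at this
      exact this
    · have := h3 _ rfl
      rw [show (2 : ℝ) * 2 = 4 by norm_num] at this
      exact this
  · intro ℓ hℓ M hM ε hε
    -- `m ≥ 3` keeps the segment away from the ends; `m ≥ 8 ℓ / ε` makes the source error `ℓ / L` of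
    -- the flooding at most `ε / 8`.
    filter_upwards [eventually_ge_atTop 3, eventually_ge_atTop (8 * ℓ / ε)] with m hm3 hmε
    have hL0 : 0 < ℓ + 2 * m := by linarith
    set L := ℓ + 2 * m with hL
    have : Fact (0 < L) := ⟨hL0⟩
    have hε8 : 0 < ε / 8 := by positivity
    have hℓL : 1 / L * ℓ ≤ ε / 8 := by
      rw [div_le_iff₀ hε] at hmε
      rw [one_div, inv_mul_le_iff₀ hL0]
      nlinarith
    have hflood := abs_avgDegree_sub_le_segment hL0 (c := 1) (ℓ := ℓ) (a := m) zero_le_one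
      (by linarith) hε (by linarith) (by linarith)
      (F := fun n => Set.range fun (s : Fin n) G => mprFloodSet G (M n G) s) (by
        filter_upwards [eventually_avgCount_mprFloodSet_le (L := L) hM (by linarith) (a := m)
            (b := m + ℓ) (by linarith) (by linarith) (by linarith) hε8,
          eventually_le_avgCount_mprFloodSet (L := L) hM (by linarith) (a := m)
            (b := m + ℓ) (by linarith) (by linarith) hε8] with n h1 h2
        rintro A ⟨s, rfl⟩
        have h4 := h1 s
        have h5 := h2 s
        rw [add_sub_cancel_left] at h4 h5
        rw [abs_le]
        constructor <;> linarith)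
    have hmpr := abs_avgDegree_sub_le_segment hL0 (c := 3 / 2) (ℓ := ℓ) (a := m) (by norm_num)
      (by linarith) hε (by linarith) (by linarith) (F := fun n => {fun G => mprCDS G (M n G)}) (by
        filter_upwards [eventually_avgCount_mprCDS_le (L := L) hM (a := m)
            (b := m + ℓ) (by linarith) (by linarith) (by linarith) hε8,
          eventually_le_avgCount_mprCDS (L := L) hM (a := m)
            (b := m + ℓ) (by linarith) (by linarith) (by linarith) hε8] with n h1 h2
        rintro A rfl
        rw [abs_le]
        constructor <;> linarith)
    have hwl := abs_avgDegree_sub_le_segment hL0 (c := 2) (ℓ := ℓ) (a := m) (by norm_num)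
      (by linarith) hε (by linarith) (by linarith) (F := fun n => {wuLiSet}) (by
        filter_upwards [eventually_avgCount_wuLiSet_le (L := L) (a := m)
            (b := m + ℓ) (by linarith) (by linarith) (by linarith) hε8,
          eventually_le_avgCount_wuLiSet (L := L) (a := m)
            (b := m + ℓ) (by linarith) (by linarith) (by linarith) hε8] with n h1 h2
        rintro A rfl
        rw [abs_le]
        constructor <;> linarith)
    filter_upwards [hflood, hmpr, hwl, eventually_gt_atTop 0] with n h1 h2 h3 hn rate hrate
    rw [hrate]
    refine ⟨abs_avgDegreeFlood_sub_le hn fun s => ?_, ?_, ?_⟩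
    · convert h1 _ ⟨s, rfl⟩ using 3
      norm_num
    · have := h2 _ rfl
      rw [show (2 : ℝ) * (3 / 2) = 3 by norm_num] at this
      exact this
    · have := h3 _ rfl
      rw [show (2 : ℝ) * 2 = 4 by norm_num] at this
      exact this
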